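/- **Theorem 2.2.** Let $\alpha\in(1,2)$, let $(S,\mu)$ be a measure space, $f,g\in L^\alpha(S,\mu)$ real-valued, $\|h\|_\alpha=(\int_S|h|^\alpha d\mu)^{1/\alpha}$, and let $(\xi,\eta)$ be a symmetric $\alpha$-stable ($S\alpha S$) random vector with representation $(\xi,\eta)=(\int_S f\,dM,\int_S g\,dM)$, $M$ an $S\alpha S$ random measure with control measure $\mu$; in terms of the law this means $$E e^{i(u\xi+v\eta)}=e^{-\|uf+vg\|_\alpha^\alpha},\qquad u,v\in\mathbb R,$$ so that $\xi,\eta$ have scale coefficients $\|\xi\|_\alpha=\|f\|_\alpha$ and $\|\eta\|_\alpha=\|g\|_\alpha$. Set $$[\xi,\eta]_1=\int_S|f|^{\alpha-1}|g|\,d\mu+\int_S|g|^{\alpha-1}|f|\,d\mu,\qquad [\xi,\eta]_2=\int_S|fg|^{\alpha/2}\,d\mu .$$ Assume that for some $\varepsilon_1,\varepsilon_2>0$ * (A1) $\ \|f\|_\alpha^{\alpha/2}\|g\|_\alpha^{\alpha/2}-\int_S|fg|^{\alpha/2}d\mu\ \ge\ \varepsilon_1\|f\|_\alpha^{\alpha/2}\|g\|_\alpha^{\alpha/2}$,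 * (A2) $\ \|uf+vg\|_\alpha^\alpha\ \ge\ \varepsilon_2(\|uf\|_\alpha^\alpha+\|vg\|_\alpha^\alpha)$ for all $u,v\in\mathbb R$. Let $\beta\in(0,\alpha/2)$, $b\ge1$, and let $K,L:\mathbb R\to\mathbb R$ satisfy * (K1) $|K(x)|\le c_K|x|^\beta$ and $|L(x)|\le c_L|x|^\beta$ for $|x|>b$, with constants $c_K,c_L$, * (K2) $K(x)/x$ and $L(x)/x$ are non-increasing on $(b,\infty)$, and each is monotone (non-decreasing or non-increasing) on $(-\infty,-b)$. Put $K_b(x)=K(x)1_{\{|x|>b\}}$ and $L_b(x)=L(x)1_{\{|x|>b\}}$. Then $K_b(\xi)$ and $L_b(\eta)$ are square integrable and $$|\mathrm{Cov}(K_b(\xi),L_b(\eta))|\le C\,c_K\,c_L\,b^{2\beta-\alpha}\bigl([\xi,\eta]_1+[\xi,\eta]_2\bigr),$$ where the constant $C$ depends only on $\varepsilon_1,\varepsilon_2,\alpha,\beta,\|\xi\|_\alpha$ and $\|\eta\|_\alpha$. -/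

import Mathlib

open MeasureTheory ProbabilityTheory

/-- `‖f‖_α = (∫ |f|^α dμ)^{1/α}`. It is only used for `α > 1` and `f ∈ L^α(μ)`. -/
noncomputable def alphaNorm {S : Type*} [MeasurableSpace S] (α : ℝ) (μ : Measure S)
    (f : S → ℝ) : ℝ :=
  (∫ s, |f s| ^ α ∂μ) ^ (1 / α)

/-- `(ξ, η)` is a symmetric `α`-stable random vector with the integral representation
`(∫ f dM, ∫ g dM)`, where `M` is a symmetric `α`-stable random measure with control measure `μ`
and `f, g ∈ L^α(μ)`. Only the law of `(ξ, η)` matters, and this law is determined by the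
characteristic function `E exp(i (u ξ + v η)) = exp(-‖u f + v g‖_α^α)`. In particular the scale
coefficients of `ξ` and `η` are `‖f‖_α` and `‖g‖_α`. -/
structure IsStableVector {Ω S : Type*} [MeasurableSpace Ω] [MeasurableSpace S] (α : ℝ)
    (P : Measure Ω) (ξ η : Ω → ℝ) (μ : Measure S) (f g : S → ℝ) : Prop where
  aemeasurable_fst : AEMeasurable ξ P
  aemeasurable_snd : AEMeasurable η P
  memLp_fst : MemLp f (ENNReal.ofReal α) μ
  memLp_snd : MemLp g (ENNReal.ofReal α) μ
  charFun_eq : ∀ u v : ℝ,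
    ∫ ω, Complex.exp (Complex.I * ((u * ξ ω + v * η ω : ℝ) : ℂ)) ∂P =
      ((Real.exp (-(alphaNorm α μ (fun s => u * f s + v * g s) ^ α)) : ℝ) : ℂ)

/-- `[ξ, η]₁^* = ∫ |f|^{α-1} |g| dμ`. -/
noncomputable def bracketOneStar {S : Type*} [MeasurableSpace S] (α : ℝ) (μ : Measure S)
    (f g : S → ℝ) : ℝ :=
  ∫ s, |f s| ^ (α - 1) * |g s| ∂μ

/-- `[ξ, η]₁ = [ξ, η]₁^* + [η, ξ]₁^*`. -/
noncomputable def bracketOne {S : Type*} [MeasurableSpace S] (α : ℝ) (μ : Measure S)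
    (f g : S → ℝ) : ℝ :=
  bracketOneStar α μ f g + bracketOneStar α μ g f

/-- `[ξ, η]₂ = ∫ |f g|^{α/2} dμ`. -/
noncomputable def bracketTwo {S : Type*} [MeasurableSpace S] (α : ℝ) (μ : Measure S)
    (f g : S → ℝ) : ℝ :=
  ∫ s, |f s * g s| ^ (α / 2) ∂μ

/-- Assumption (A1) with constant `ε`. -/
def AssumptionA1 {S : Type*} [MeasurableSpace S] (α ε : ℝ) (μ : Measure S)
    (f g : S → ℝ) : Prop :=
  alphaNorm α μ f ^ (α / 2) * alphaNorm α μ g ^ (α / 2) - ∫ s, |f s * g s| ^ (α / 2) ∂μ ≥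
    ε * (alphaNorm α μ f ^ (α / 2) * alphaNorm α μ g ^ (α / 2))

/-- Assumption (A2) with constant `ε`. -/
def AssumptionA2 {S : Type*} [MeasurableSpace S] (α ε : ℝ) (μ : Measure S)
    (f g : S → ℝ) : Prop :=
  ∀ u v : ℝ, alphaNorm α μ (fun s => u * f s + v * g s) ^ α ≥
    ε * (alphaNorm α μ (fun s => u * f s) ^ α + alphaNorm α μ (fun s => v * g s) ^ α)

/-- Assumption (K1) with exponent `β`, constant `c` and threshold `x₀`. -/
def AssumptionK1 (β c x₀ : ℝ) (K : ℝ → ℝ) : Prop :=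
  ∀ x : ℝ, x₀ < |x| → |K x| ≤ c * |x| ^ β

/-- Assumption (K2) with threshold `x₀`: `K(x)/x` is non-increasing on `(x₀, ∞)` and monotone on
`(-∞, -x₀)`. Both directions are allowed on the negative half-line, so that odd functions such as
`sign(x) |x|^β` (for which `K(x)/x` is non-decreasing there) as well as even functions such as
`|x|^β` (for which `K(x)/x` is non-increasing there) are covered. -/
def AssumptionK2 (x₀ : ℝ) (K : ℝ → ℝ) : Prop :=
  AntitoneOn (fun x => K x / x) (Set.Ioi x₀) ∧
    (MonotoneOn (fun x => K x / x) (Set.Iio (-x₀)) ∨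
      AntitoneOn (fun x => K x / x) (Set.Iio (-x₀)))

/-- `K_b(x) = K(x) 1_{|x| > b}`. -/
noncomputable def truncAbove (b : ℝ) (K : ℝ → ℝ) : ℝ → ℝ :=
  Set.indicator {x : ℝ | b < |x|} K

/-!
The covariance bound rests on a Fourier representation. Write `N(u, v) = ∫ |u f + v g|^α dμ`, so
that `φ = exp(-N)` is the characteristic function of `(ξ, η)`, and write `B₁`, `B₂` for the two
brackets.

*Truncations of the identity.* Let `I ⊆ [-R, R]` and `J ⊆ [-R', R']` be intervals. The function
`x ↦ x 1_I(x)`, smoothed by a Gaussian, is the Fourier transform of the derivative of a function `A`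
with `|A(u)| ≲ min(R, 1/|u|)`; let `B` be the function attached to `J`. The covariance of the two
truncations is, up to a constant factor, `∬ A'(u) B'(v) (φ(u, v) - φ(u, 0) φ(0, v)) du dv`.
Integrating by parts in both variables puts the mixed derivative on the difference. Since
`|·|^α` is not twice differentiable at the origin, the second integration by parts is carried out
under the integral over `S`, along the line `v ↦ u f(s) + v g(s)`, and produces the locally
integrable weight `|u f + v g|^{α-2} |f g|`. All terms are controlled by the brackets: the partial
derivatives of `N(u, v)` differ from those of `N(u, 0) + N(0, v)` by multiples of `B₁`, the difference
`N(u, v) - N(u, 0) - N(0, v)` is at most a multiple of `|u v|^{α/2} B₂`, and (A2) bounds `φ` by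
`exp(-ε (N(u, 0) + N(0, v)))`, which is integrable against every power that occurs. The remaining
singular integral `∬ min(R, 1/|u|) min(R', 1/|v|) |u + v|^{α-2} du dv` is at most a multiple of
`(R R')^{1-α/2}` (`lintegral_capInv_capInv_le`). By scaling, the weight `|u f + v g|^{α-2} |f g|`
contributes at most a multiple of `(R R')^{1-α/2} |f g|^{α/2}`, which integrates to
`(R R')^{1-α/2} B₂`. Removing the smoothing gives `abs_cov_indicator_le`: the covariance is at most
`C (R R')^{1-α/2} (B₁ + B₂)`.

*Layers.* On a half-line, `K_b(x) = ± x κ(x)` with `κ ≥ 0` whose superlevel sets `{κ > l}` are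
intervals (`exists_isLayered`): this is what the monotonicity of `K(x)/x` is for. Hence `K_b` is the
integral over `l > 0` of truncations of the identity to `{κ > l}`. By the growth condition this set
lies in `[-R, R]` with `R = (c / l)^{1/(1-β)}`, and it is empty unless `l < c b^{β-1}`. Since
`β < α/2`, the bound `R^{1-α/2}` is integrable near `l = 0`, and the integral over the layers gives
`c_K c_L b^{2β-α}` (`IsLayered.abs_cov_le`).

Square integrability holds because the tails of `ξ` and `η` are `O(r^{-α})`, by the standard estimate
of the tail through the characteristic function near zero (`measureReal_lt_abs_le`), and `2β < α`.
-/


/-! ### Signed powers and elementary inequalities -/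

/-- The signed power `x^{⟨α-1⟩} = |x|^{α-1} sign x`, written as `|x|^{α-2} x` so that it is `α⁻¹` times
the derivative of `|x|^α`. -/
noncomputable def signedPow (α x : ℝ) : ℝ := |x| ^ (α - 2) * x

theorem abs_signedPow {α : ℝ} (hα : 1 < α) (x : ℝ) : |signedPow α x| = |x| ^ (α - 1) := by
  rcases eq_or_ne x 0 with rfl | hx
  · simp [signedPow, Real.zero_rpow (by linarith : α - 1 ≠ 0)]
  · have h : 0 < |x| := abs_pos.2 hx
    rw [signedPow, abs_mul, abs_of_nonneg (by positivity)]
    nth_rewrite 2 [← Real.rpow_one |x|]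
    rw [← Real.rpow_add h]; ring_nf

theorem signedPow_of_nonneg {α : ℝ} (hα : 1 < α) {x : ℝ} (hx : 0 ≤ x) :
    signedPow α x = x ^ (α - 1) := by
  have h := abs_signedPow hα x
  rwa [abs_of_nonneg hx, abs_of_nonneg (by unfold signedPow; positivity)] at h

theorem signedPow_neg (α x : ℝ) : signedPow α (-x) = -signedPow α x := by
  simp [signedPow]

theorem signedPow_zero (α : ℝ) : signedPow α 0 = 0 := by simp [signedPow]

theorem measurable_signedPow (α : ℝ) : Measurable (signedPow α) := by
  unfold signedPow; fun_prop

theorem hasDerivAt_abs_rpow_of_ne {x : ℝ} (p : ℝ) (hx : x ≠ 0) :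
    HasDerivAt (fun y : ℝ => |y| ^ p) (p * |x| ^ (p - 2) * x) x := by
  have h0 : 0 < |x| := abs_pos.2 hx
  have h := (hasDerivAt_abs hx).rpow_const (p := p) (Or.inl h0.ne')
  refine h.congr_deriv ?_
  have h1 : |x| ^ (p - 1) = |x| ^ (p - 2) * |x| := by
    nth_rewrite 3 [← Real.rpow_one |x|]
    rw [← Real.rpow_add h0]; ring_nf
  rw [h1]
  rcases lt_or_gt_of_ne hx with h | h
  · simp [h, abs_of_neg h]; ring
  · simp [h, abs_of_pos h]; ring

theorem hasDerivAt_signedPow {x : ℝ} (α : ℝ) (hx : x ≠ 0) :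
    HasDerivAt (signedPow α) ((α - 1) * |x| ^ (α - 2)) x := by
  have h0 : 0 < |x| := abs_pos.2 hx
  have h := (hasDerivAt_abs_rpow_of_ne (α - 2) hx).mul (hasDerivAt_id x)
  refine h.congr_deriv ?_
  have h1 : |x| ^ (α - 2) = |x| ^ (α - 2 - 2) * (x * x) := by
    rw [← abs_mul_abs_self x, ← sq, ← Real.rpow_natCast |x| 2, ← Real.rpow_add h0]
    norm_num
  simp only [id_eq, mul_one]
  rw [h1]; ring

/-- Subadditivity of `t ↦ t ^ p` for `p ≤ 1`, as a Hölder estimate. -/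
theorem abs_rpow_sub_rpow_le {p : ℝ} (hp : 0 ≤ p) (hp1 : p ≤ 1) (x y : ℝ) :
    |(|x| ^ p - |y| ^ p)| ≤ |x - y| ^ p := by
  have key : ∀ x y : ℝ, |x| ^ p - |y| ^ p ≤ |x - y| ^ p := fun x y => by
    have h1 : |x| ≤ |x - y| + |y| := by simpa using abs_add_le (x - y) y
    have h2 := Real.rpow_le_rpow (abs_nonneg x) h1 hp
    have h3 := Real.rpow_add_le_add_rpow (abs_nonneg (x - y)) (abs_nonneg y) hp hp1
    linarith
  rw [abs_le]
  have := key y x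
  rw [abs_sub_comm] at this
  exact ⟨by linarith, key x y⟩

theorem abs_add_rpow_le {p : ℝ} (hp : 0 ≤ p) (hp1 : p ≤ 1) (x y : ℝ) :
    |x + y| ^ p ≤ |x| ^ p + |y| ^ p :=
  (Real.rpow_le_rpow (abs_nonneg _) (abs_add_le x y) hp).trans
    (Real.rpow_add_le_add_rpow (abs_nonneg _) (abs_nonneg _) hp hp1)

/-- The signed power `x^{⟨α-1⟩}` is Hölder continuous of order `α - 1`. -/
theorem abs_signedPow_sub_le {α : ℝ} (hα : 1 < α) (hα2 : α < 2) (x y : ℝ) :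
    |signedPow α x - signedPow α y| ≤ 2 * |x - y| ^ (α - 1) := by
  have hp : 0 ≤ α - 1 := by linarith
  have hp1 : α - 1 ≤ 1 := by linarith
  have nn : ∀ z : ℝ, 0 ≤ |z| ^ (α - 1) := fun z => by positivity
  have same : ∀ x y : ℝ, 0 ≤ x → 0 ≤ y →
      |signedPow α x - signedPow α y| ≤ 2 * |x - y| ^ (α - 1) := fun x y hx hy => by
    rw [signedPow_of_nonneg hα hx, signedPow_of_nonneg hα hy]
    have := abs_rpow_sub_rpow_le hp hp1 x y
    rw [abs_of_nonneg hx, abs_of_nonneg hy] at this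
    linarith [nn (x - y)]
  have opp : ∀ x y : ℝ, 0 ≤ x → y ≤ 0 →
      |signedPow α x - signedPow α y| ≤ 2 * |x - y| ^ (α - 1) := fun x y hx hy => by
    have h1 := abs_sub (signedPow α x) (signedPow α y)
    rw [abs_signedPow hα, abs_signedPow hα] at h1
    have hx' : |x| ≤ |x - y| := by
      rw [abs_of_nonneg hx, abs_of_nonneg (by linarith)]; linarith
    have hy' : |y| ≤ |x - y| := by
      rw [abs_of_nonpos hy, abs_of_nonneg (by linarith)]; linarith
    have h2 := Real.rpow_le_rpow (abs_nonneg _) hx' hp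
    have h3 := Real.rpow_le_rpow (abs_nonneg _) hy' hp
    linarith
  rcases le_total 0 x with hx | hx <;> rcases le_total 0 y with hy | hy
  · exact same x y hx hy
  · exact opp x y hx hy
  · rw [abs_sub_comm, abs_sub_comm x]; exact opp y x hy hx
  · have := same (-x) (-y) (by linarith) (by linarith)
    rw [signedPow_neg, signedPow_neg] at this
    rwa [← abs_neg, ← abs_neg (x - y), neg_sub', neg_sub']

theorem continuous_signedPow {α : ℝ} (hα : 1 < α) (hα2 : α < 2) : Continuous (signedPow α) := by
  rw [continuous_iff_continuousAt]
  intro x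
  rw [ContinuousAt, tendsto_iff_dist_tendsto_zero]
  have h : Filter.Tendsto (fun y : ℝ => 2 * |y - x| ^ (α - 1)) (nhds x) (nhds 0) := by
    have : Continuous fun y : ℝ => 2 * |y - x| ^ (α - 1) := by
      refine continuous_const.mul (Continuous.rpow_const (by fun_prop) fun _ => Or.inr (by linarith))
    simpa [Real.zero_rpow (by linarith : α - 1 ≠ 0)] using this.tendsto x
  exact squeeze_zero (fun _ => dist_nonneg) (fun y => abs_signedPow_sub_le hα hα2 y x) h

/-- The defect of additivity of `|x|^α` is controlled by the geometric mean. -/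
theorem abs_abs_add_rpow_sub_le {α : ℝ} (hα : 1 < α) (hα2 : α < 2) (x y : ℝ) :
    |(|x + y| ^ α - |x| ^ α - |y| ^ α)| ≤ 5 * (|x| ^ (α / 2) * |y| ^ (α / 2)) := by
  have hp : 0 ≤ α - 1 := by linarith
  have hp1 : α - 1 ≤ 1 := by linarith
  wlog hxy : |x| ≤ |y| generalizing x y
  · have := this y x (le_of_not_ge hxy)
    rw [add_comm x y, sub_right_comm, mul_comm (|x| ^ (α / 2))]; exact this
  rcases eq_or_ne x 0 with rfl | hx
  · simp [Real.zero_rpow (by linarith : α ≠ 0)]; positivity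
  have hx0 : 0 < |x| := abs_pos.2 hx
  have hy0 : 0 < |y| := hx0.trans_le hxy
  have split : ∀ z : ℝ, |z| ^ α = |z| * |z| ^ (α - 1) := fun z => by
    rcases eq_or_ne z 0 with rfl | hz
    · simp [Real.zero_rpow (by linarith : α ≠ 0)]
    · nth_rewrite 2 [← Real.rpow_one |z|]
      rw [← Real.rpow_add (abs_pos.2 hz)]; ring_nf
  have e1 : |x| ^ α = |x| ^ (α / 2) * |x| ^ (α / 2) := by
    rw [← Real.rpow_add hx0]; ring_nf
  have b1 : |x| ^ α ≤ |x| ^ (α / 2) * |y| ^ (α / 2) := by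
    rw [e1]; gcongr
  -- `|x| |y|^{α-1}` is at most the geometric mean because `|x|^{1-α/2} ≤ |y|^{1-α/2}`
  have b2 : |x| * |y| ^ (α - 1) ≤ |x| ^ (α / 2) * |y| ^ (α / 2) := by
    have e2 : |x| = |x| ^ (α / 2) * |x| ^ (1 - α / 2) := by
      rw [← Real.rpow_add hx0]; simp
    have e3 : |y| ^ (α / 2) = |y| ^ (1 - α / 2) * |y| ^ (α - 1) := by
      rw [← Real.rpow_add hy0]; ring_nf
    rw [e3, ← mul_assoc]
    nth_rewrite 1 [e2]
    gcongr
    linarith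
  -- write `|z|^α = |z| |z|^{α-1}` and use that `t ↦ t^{α-1}` is Hölder
  have b3 : |(|x + y| ^ α - |y| ^ α)| ≤ |x| * |x + y| ^ (α - 1) + |y| * |(|x + y| ^ (α - 1) - |y| ^ (α - 1))| := by
    rw [split (x + y), split y]
    have : |x + y| * |x + y| ^ (α - 1) - |y| * |y| ^ (α - 1) =
        (|x + y| - |y|) * |x + y| ^ (α - 1) + |y| * (|x + y| ^ (α - 1) - |y| ^ (α - 1)) := by ring
    rw [this]
    refine (abs_add_le _ _).trans ?_
    have hd := abs_abs_sub_abs_le_abs_sub (x + y) y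
    rw [add_sub_cancel_right] at hd
    rw [abs_mul, abs_mul, abs_abs, abs_of_nonneg (by positivity : 0 ≤ |x + y| ^ (α - 1))]
    exact add_le_add_left (mul_le_mul_of_nonneg_right hd (by positivity)) _
  have b4 : |x + y| ^ (α - 1) ≤ 2 * |y| ^ (α - 1) := by
    have h1 := abs_add_rpow_le hp hp1 x y
    have h2 := Real.rpow_le_rpow (abs_nonneg x) hxy hp
    linarith
  have b5 : |y| * |(|x + y| ^ (α - 1) - |y| ^ (α - 1))| ≤ 2 * (|x| * |y| ^ (α - 1)) := by
    -- `t ↦ t^{α-1} / t` is decreasing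
    have gen : ∀ z w : ℝ, 0 < w → w ≤ z → w * (z ^ (α - 1) - w ^ (α - 1)) ≤ (z - w) * z ^ (α - 1) := by
      intro z w hw hz
      have hz0 : 0 < z := hw.trans_le hz
      have i1 : z * w ^ (α - 1) ≥ w * z ^ (α - 1) := by
        have q1 : w ^ (α - 1) = w * w ^ (α - 2) := by
          nth_rewrite 2 [← Real.rpow_one w]
          rw [← Real.rpow_add hw]; ring_nf
        have q2 : z ^ (α - 1) = z * z ^ (α - 2) := by
          nth_rewrite 2 [← Real.rpow_one z]
          rw [← Real.rpow_add hz0]; ring_nf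
        have q3 : z ^ (α - 2) ≤ w ^ (α - 2) :=
          Real.rpow_le_rpow_of_nonpos hw hz (by linarith)
        rw [q1, q2]
        have : 0 < z * w := by positivity
        nlinarith
      have i2 : w ^ (α - 1) ≤ z ^ (α - 1) := Real.rpow_le_rpow hw.le hz hp
      nlinarith
    have hd := abs_abs_sub_abs_le_abs_sub (x + y) y
    rw [add_sub_cancel_right] at hd
    rw [abs_le] at hd
    rcases le_total |y| |x + y| with h | h
    · rw [abs_of_nonneg (sub_nonneg.2 (Real.rpow_le_rpow (abs_nonneg _) h hp))]
      refine (gen _ _ hy0 h).trans ?_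
      calc (|x + y| - |y|) * |x + y| ^ (α - 1) ≤ |x| * (2 * |y| ^ (α - 1)) := by
            gcongr; linarith [hd.2]
        _ = _ := by ring
    · rw [abs_of_nonpos (sub_nonpos.2 (Real.rpow_le_rpow (abs_nonneg _) h hp))]
      have hnn : 0 ≤ |x + y| ^ (α - 1) := by positivity
      have hy1 : 0 ≤ |y| ^ (α - 1) := by positivity
      have i0 : |y| - |x + y| ≤ |x| := by linarith [hd.1]
      rcases (abs_nonneg (x + y)).eq_or_lt with h0 | h0
      · rw [← h0, Real.zero_rpow (by linarith)]
        rw [← h0] at i0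
        nlinarith
      · have i1 := gen _ _ h0 h
        have i2 : |x + y| ^ (α - 1) ≤ |y| ^ (α - 1) := Real.rpow_le_rpow (abs_nonneg _) h hp
        nlinarith
  have b6 : |x| * |x + y| ^ (α - 1) ≤ 2 * (|x| * |y| ^ (α - 1)) := by nlinarith
  have b7 : |(|x + y| ^ α - |x| ^ α - |y| ^ α)| ≤ |(|x + y| ^ α - |y| ^ α)| + |x| ^ α := by
    have h := abs_sub (|x + y| ^ α - |y| ^ α) (|x| ^ α)
    rw [abs_of_nonneg (by positivity : 0 ≤ |x| ^ α)] at h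
    rwa [sub_right_comm]
  linarith

/-- Young's inequality with crude constants. -/
theorem rpow_mul_abs_le {α : ℝ} (hα : 1 < α) (x y : ℝ) :
    |x| ^ (α - 1) * |y| ≤ |x| ^ α + |y| ^ α := by
  have split : ∀ z : ℝ, |z| ^ α = |z| ^ (α - 1) * |z| := fun z => by
    rcases eq_or_ne z 0 with rfl | hz
    · simp [Real.zero_rpow (by linarith : α ≠ 0)]
    · nth_rewrite 3 [← Real.rpow_one |z|]
      rw [← Real.rpow_add (abs_pos.2 hz)]; ring_nf
  rw [split x, split y]
  have hx : 0 ≤ |x| ^ (α - 1) := by positivity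
  have hy : 0 ≤ |y| ^ (α - 1) := by positivity
  rcases le_total |x| |y| with h | h
  · have := Real.rpow_le_rpow (abs_nonneg x) h (by linarith : 0 ≤ α - 1)
    nlinarith [abs_nonneg x, abs_nonneg y]
  · nlinarith [abs_nonneg x, abs_nonneg y]

theorem abs_mul_rpow_half_le {α : ℝ} (hα : 1 < α) (x y : ℝ) :
    |x * y| ^ (α / 2) ≤ |x| ^ α + |y| ^ α := by
  have split : ∀ z : ℝ, |z| ^ α = |z| ^ (α / 2) * |z| ^ (α / 2) := fun z => by
    rw [← Real.rpow_add' (abs_nonneg z) (by linarith)]; ring_nf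
  rw [abs_mul, Real.mul_rpow (abs_nonneg _) (abs_nonneg _), split x, split y]
  have hx : 0 ≤ |x| ^ (α / 2) := by positivity
  have hy : 0 ≤ |y| ^ (α / 2) := by positivity
  nlinarith [sq_nonneg (|x| ^ (α / 2) - |y| ^ (α / 2))]

/-! ### A weighted singular double integral -/

theorem lintegral_comp_abs_eq (F : ℝ → ENNReal) :
    ∫⁻ x, F |x| = 2 * ∫⁻ x in Set.Ioi (0 : ℝ), F x := by
  have h1 : ∫⁻ x in Set.Ioi (0 : ℝ), F |x| = ∫⁻ x in Set.Ioi (0 : ℝ), F x :=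
    setLIntegral_congr_fun measurableSet_Ioi fun x hx => by
      rw [abs_of_pos (show (0:ℝ) < x from hx)]
  have h2 : ∫⁻ x in Set.Iio (0 : ℝ), F |x| = ∫⁻ x in Set.Ioi (0 : ℝ), F |x| := by
    have := (Measure.measurePreserving_neg (volume : Measure ℝ)).setLIntegral_comp_preimage_emb
      (Homeomorph.neg ℝ).measurableEmbedding (fun x => F |x|) (Set.Ioi 0)
    simpa using this
  rw [← lintegral_add_compl _ (measurableSet_Ioi (a := (0 : ℝ))), Set.compl_Ioi,
    setLIntegral_congr (Iio_ae_eq_Iic (a := (0:ℝ))).symm, h2, h1, two_mul]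

theorem lintegral_abs_rpow_le {p ρ : ℝ} (hp : -1 < p) (hρ : 0 ≤ ρ) :
    ∫⁻ x in {x : ℝ | |x| ≤ ρ}, ENNReal.ofReal (|x| ^ p) =
      ENNReal.ofReal (2 * (ρ ^ (p + 1) / (p + 1))) := by
  have hm : MeasurableSet {x : ℝ | |x| ≤ ρ} := measurableSet_le (by fun_prop) measurable_const
  rw [← lintegral_indicator hm]
  have e : ∀ x : ℝ, ({x : ℝ | |x| ≤ ρ}.indicator fun x => ENNReal.ofReal (|x| ^ p)) x =
      (Set.Iic ρ).indicator (fun x => ENNReal.ofReal (x ^ p)) |x| := fun x => by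
    simp only [Set.indicator, Set.mem_ofPred_eq, Set.mem_Iic]
  simp_rw [e]
  rw [lintegral_comp_abs_eq, setLIntegral_indicator measurableSet_Iic, Set.inter_comm, Set.Ioi_inter_Iic,
    ← ofReal_integral_eq_lintegral_ofReal, ← intervalIntegral.integral_of_le hρ,
    integral_rpow (Or.inl hp), Real.zero_rpow (by linarith), sub_zero, ENNReal.ofReal_mul (by norm_num)]
  · simp
  · exact (intervalIntegrable_iff_integrableOn_Ioc_of_le hρ).1 (intervalIntegral.intervalIntegrable_rpow' hp)
  · exact (ae_restrict_iff' measurableSet_Ioc).2 (ae_of_all _ fun x hx => Real.rpow_nonneg hx.1.le _)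

theorem lintegral_abs_rpow_gt {p ρ : ℝ} (hp : p < -1) (hρ : 0 < ρ) :
    ∫⁻ x in {x : ℝ | ρ < |x|}, ENNReal.ofReal (|x| ^ p) =
      ENNReal.ofReal (2 * (-ρ ^ (p + 1) / (p + 1))) := by
  have hm : MeasurableSet {x : ℝ | ρ < |x|} := measurableSet_lt measurable_const (by fun_prop)
  rw [← lintegral_indicator hm]
  have e : ∀ x : ℝ, ({x : ℝ | ρ < |x|}.indicator fun x => ENNReal.ofReal (|x| ^ p)) x =
      (Set.Ioi ρ).indicator (fun x => ENNReal.ofReal (x ^ p)) |x| := fun x => by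
    simp only [Set.indicator, Set.mem_ofPred_eq, Set.mem_Ioi]
  simp_rw [e]
  rw [lintegral_comp_abs_eq, setLIntegral_indicator measurableSet_Ioi, Set.Ioi_inter_Ioi, sup_of_le_left hρ.le,
    ← ofReal_integral_eq_lintegral_ofReal, integral_Ioi_rpow_of_lt hp hρ, ENNReal.ofReal_mul (by norm_num)]
  · simp
  · exact integrableOn_Ioi_rpow_of_lt hp hρ
  · exact (ae_restrict_iff' measurableSet_Ioi).2
      (ae_of_all _ fun x hx => Real.rpow_nonneg (hρ.trans hx).le _)

/-- The size `min R |u|⁻¹` of the Fourier transform of the indicator of an interval of length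
comparable to `R`. Because `|0|⁻¹ = 0`, its value at `0` is `0`, which matters only on a null set. -/
noncomputable def capInv (R u : ℝ) : ℝ := min R |u|⁻¹

theorem capInv_nonneg {R : ℝ} (hR : 0 ≤ R) (u : ℝ) : 0 ≤ capInv R u :=
  le_min hR (by positivity)

theorem measurable_capInv (R : ℝ) : Measurable (capInv R) := by
  unfold capInv; fun_prop

theorem capInv_le {R θ : ℝ} (hR : 0 < R) (h0 : 0 ≤ θ) (h1 : θ ≤ 1) (u : ℝ) :
    capInv R u ≤ R ^ θ * |u| ^ (θ - 1) := by
  have hn := capInv_nonneg hR.le u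
  rcases hn.eq_or_lt with h | h
  · rw [← h]; positivity
  have hu : 0 < |u| := by
    rcases eq_or_ne u 0 with rfl | hu
    · simp [capInv, hR.le] at h
    · exact abs_pos.2 hu
  calc capInv R u = capInv R u ^ θ * capInv R u ^ (1 - θ) := by
        rw [← Real.rpow_add h]; simp
    _ ≤ R ^ θ * (|u|⁻¹) ^ (1 - θ) := by
        have a1 : capInv R u ≤ R := min_le_left _ _
        have a2 : capInv R u ≤ |u|⁻¹ := min_le_right _ _
        have : 0 ≤ 1 - θ := by linarith
        gcongr
    _ = _ := by rw [Real.inv_rpow hu.le, ← Real.rpow_neg hu.le, neg_sub]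

theorem capInv_div {R c : ℝ} (hc : c ≠ 0) (u : ℝ) :
    capInv R u = |c| * capInv (R / |c|) (c * u) := by
  have : 0 < |c| := abs_pos.2 hc
  rw [capInv, capInv, mul_min_of_nonneg _ _ this.le, abs_mul]
  congr 1 <;> field_simp

theorem lintegral_capInv_mul_rpow_le {R θ : ℝ} (hR : 0 < R) (h0 : 0 < θ) (h1 : θ < 1) :
    ∫⁻ u, ENNReal.ofReal (capInv R u * |u| ^ (-θ)) ≤
      ENNReal.ofReal (2 * (1 / (1 - θ) + 1 / θ) * R ^ θ) := by
  have hm : MeasurableSet {x : ℝ | |x| ≤ R⁻¹} := measurableSet_le (by fun_prop) measurable_const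
  have hc : {x : ℝ | |x| ≤ R⁻¹}ᶜ = {x : ℝ | R⁻¹ < |x|} := by ext; simp
  rw [← lintegral_add_compl _ hm, hc]
  have b1 : ∫⁻ u in {x : ℝ | |x| ≤ R⁻¹}, ENNReal.ofReal (capInv R u * |u| ^ (-θ)) ≤
      ENNReal.ofReal R * ENNReal.ofReal (2 * ((R⁻¹) ^ (-θ + 1) / (-θ + 1))) := by
    rw [← lintegral_abs_rpow_le (by linarith) (by positivity),
      ← lintegral_const_mul' _ _ ENNReal.ofReal_ne_top]
    refine lintegral_mono fun u => ?_
    rw [← ENNReal.ofReal_mul hR.le]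
    apply ENNReal.ofReal_le_ofReal
    gcongr
    exact min_le_left _ _
  have b2 : ∫⁻ u in {x : ℝ | R⁻¹ < |x|}, ENNReal.ofReal (capInv R u * |u| ^ (-θ)) ≤
      ENNReal.ofReal (2 * (-(R⁻¹) ^ (-θ - 1 + 1) / (-θ - 1 + 1))) := by
    rw [← lintegral_abs_rpow_gt (by linarith) (by positivity)]
    refine setLIntegral_mono (by fun_prop) fun u hu => ?_
    apply ENNReal.ofReal_le_ofReal
    have hu0 : 0 < |u| := lt_trans (by positivity) (show R⁻¹ < |u| from hu)
    calc capInv R u * |u| ^ (-θ) ≤ |u|⁻¹ * |u| ^ (-θ) := by gcongr; exact min_le_right _ _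
      _ = |u| ^ (-θ - 1) := by rw [Real.rpow_sub_one hu0.ne']; ring
  refine (add_le_add b1 b2).trans ?_
  have h1' : 0 < 1 - θ := by linarith
  rw [← ENNReal.ofReal_mul hR.le, ← ENNReal.ofReal_add]
  · apply ENNReal.ofReal_le_ofReal
    have e1 : R * (R⁻¹) ^ (-θ + 1) = R ^ θ := by
      rw [Real.inv_rpow hR.le, ← Real.rpow_neg hR.le]
      nth_rewrite 1 [← Real.rpow_one R]
      rw [← Real.rpow_add hR]; ring_nf
    have e2 : (R⁻¹) ^ (-θ - 1 + 1) = R ^ θ := by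
      rw [Real.inv_rpow hR.le, ← Real.rpow_neg hR.le]; ring_nf
    rw [e2]
    apply le_of_eq
    calc R * (2 * (R⁻¹ ^ (-θ + 1) / (-θ + 1))) + 2 * (-R ^ θ / (-θ - 1 + 1))
        = 2 * ((R * R⁻¹ ^ (-θ + 1)) / (1 - θ)) + 2 * (-R ^ θ / (-θ)) := by ring_nf
      _ = _ := by rw [e1, neg_div_neg_eq]; field_simp
  · have : 0 < -θ + 1 := by linarith
    positivity
  · have : -θ - 1 + 1 = -θ := by ring
    rw [this, neg_div_neg_eq]; positivity

/-- Constant in `lintegral_singular_inner_le`. -/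
noncomputable def singularConst (α : ℝ) : ℝ :=
  2 * (2 : ℝ) ^ (α / 2) * (2 ^ (α - 1)) / (α - 1) + 2 * 2 ^ (2 - α) / (1 - α / 2)

theorem lintegral_singular_inner_le {α R u : ℝ} (hα : 1 < α) (hα2 : α < 2) (hR : 0 < R) (hu : u ≠ 0) :
    ∫⁻ v in {v : ℝ | |v| ≤ |u|}, ENNReal.ofReal (capInv R v * |u + v| ^ (α - 2)) ≤
      ENNReal.ofReal (singularConst α * R ^ (1 - α / 2) * |u| ^ (-(1 - α / 2))) := by
  set r := |u| with hr
  have hr0 : 0 < r := abs_pos.2 hu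
  -- either `|v|` or `|u + v|` is at least `r / 2`
  have pt : ∀ v : ℝ, capInv R v * |u + v| ^ (α - 2) ≤
      R ^ (1 - α / 2) * (r / 2) ^ (-(α / 2)) * |u + v| ^ (α - 2) +
        R ^ (1 - α / 2) * (r / 2) ^ (α - 2) * |v| ^ (-(α / 2)) := fun v => by
    have h := capInv_le hR (by linarith : 0 ≤ 1 - α / 2) (by linarith) v
    rw [show 1 - α / 2 - 1 = -(α / 2) by ring] at h
    have hRp : 0 < R ^ (1 - α / 2) := by positivity
    have n1 : 0 ≤ |u + v| ^ (α - 2) := by positivity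
    have n2 : 0 ≤ |v| ^ (-(α / 2)) := by positivity
    have n3 : 0 ≤ (r / 2) ^ (-(α / 2)) := by positivity
    have n4 : 0 ≤ (r / 2) ^ (α - 2) := by positivity
    refine (mul_le_mul_of_nonneg_right h n1).trans ?_
    rcases le_total (r / 2) |v| with hv | hv
    · have : |v| ^ (-(α / 2)) ≤ (r / 2) ^ (-(α / 2)) :=
        Real.rpow_le_rpow_of_nonpos (by positivity) hv (by linarith)
      have i1 : R ^ (1 - α / 2) * |v| ^ (-(α / 2)) * |u + v| ^ (α - 2) ≤
          R ^ (1 - α / 2) * (r / 2) ^ (-(α / 2)) * |u + v| ^ (α - 2) := by gcongr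
      have : 0 ≤ R ^ (1 - α / 2) * (r / 2) ^ (α - 2) * |v| ^ (-(α / 2)) := by positivity
      linarith
    · have huv : r / 2 ≤ |u + v| := by
        have : |u| ≤ |u + v| + |v| := by simpa using abs_sub (u + v) v
        rw [← hr] at this; linarith
      have : |u + v| ^ (α - 2) ≤ (r / 2) ^ (α - 2) :=
        Real.rpow_le_rpow_of_nonpos (by positivity) huv (by linarith)
      have i1 : R ^ (1 - α / 2) * |v| ^ (-(α / 2)) * |u + v| ^ (α - 2) ≤
          R ^ (1 - α / 2) * |v| ^ (-(α / 2)) * (r / 2) ^ (α - 2) := by gcongr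
      have : 0 ≤ R ^ (1 - α / 2) * (r / 2) ^ (-(α / 2)) * |u + v| ^ (α - 2) := by positivity
      linarith
  have hm : MeasurableSet {x : ℝ | |x| ≤ 2 * r} := measurableSet_le (by fun_prop) measurable_const
  have b1 : ∫⁻ v in {v : ℝ | |v| ≤ r}, ENNReal.ofReal (|u + v| ^ (α - 2)) ≤
      ENNReal.ofReal (2 * ((2 * r) ^ (α - 1) / (α - 1))) := by
    have := lintegral_abs_rpow_le (p := α - 2) (ρ := 2 * r) (by linarith) (by positivity)
    rw [show α - 2 + 1 = α - 1 by ring] at this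
    rw [← this, ← lintegral_indicator hm, ← lintegral_indicator
      (measurableSet_le (by fun_prop) measurable_const)]
    refine le_trans ?_ (lintegral_add_left_eq_self
      ({x : ℝ | |x| ≤ 2 * r}.indicator fun x => ENNReal.ofReal (|x| ^ (α - 2))) u).le
    refine lintegral_mono fun v => ?_
    by_cases hv : |v| ≤ r
    · have : |u + v| ≤ 2 * r := (abs_add_le _ _).trans (by rw [← hr]; linarith)
      simp [Set.indicator, hv, this]
    · simp [Set.indicator, hv]
  have b2 := lintegral_abs_rpow_le (p := -(α / 2)) (ρ := r) (by linarith) hr0.le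
  calc ∫⁻ v in {v : ℝ | |v| ≤ r}, ENNReal.ofReal (capInv R v * |u + v| ^ (α - 2))
      ≤ ∫⁻ v in {v : ℝ | |v| ≤ r},
          (ENNReal.ofReal (R ^ (1 - α / 2) * (r / 2) ^ (-(α / 2))) * ENNReal.ofReal (|u + v| ^ (α - 2)) +
          ENNReal.ofReal (R ^ (1 - α / 2) * (r / 2) ^ (α - 2)) * ENNReal.ofReal (|v| ^ (-(α / 2)))) := by
        refine lintegral_mono fun v => ?_
        rw [← ENNReal.ofReal_mul (by positivity), ← ENNReal.ofReal_mul (by positivity),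
          ← ENNReal.ofReal_add (by positivity) (by positivity)]
        exact ENNReal.ofReal_le_ofReal (pt v)
    _ ≤ ENNReal.ofReal (R ^ (1 - α / 2) * (r / 2) ^ (-(α / 2))) *
          ENNReal.ofReal (2 * ((2 * r) ^ (α - 1) / (α - 1))) +
        ENNReal.ofReal (R ^ (1 - α / 2) * (r / 2) ^ (α - 2)) *
          ENNReal.ofReal (2 * (r ^ (-(α / 2) + 1) / (-(α / 2) + 1))) := by
        rw [lintegral_add_left (by fun_prop), lintegral_const_mul' _ _ ENNReal.ofReal_ne_top,
          lintegral_const_mul' _ _ ENNReal.ofReal_ne_top, b2]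
        gcongr
    _ = _ := by
        have q1 : 0 < α - 1 := by linarith
        have q2 : 0 < -(α / 2) + 1 := by linarith
        rw [← ENNReal.ofReal_mul (by positivity), ← ENNReal.ofReal_mul (by positivity),
          ← ENNReal.ofReal_add (by positivity) (by positivity)]
        congr 1
        have e1 : (r / 2) ^ (-(α / 2)) = r ^ (-(α / 2)) * 2 ^ (α / 2) := by
          rw [Real.div_rpow hr0.le (by norm_num), Real.rpow_neg (by norm_num : (0:ℝ) ≤ 2), div_inv_eq_mul]
        have e2 : (r / 2) ^ (α - 2) = r ^ (α - 2) * 2 ^ (2 - α) := by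
          rw [Real.div_rpow hr0.le (by norm_num), ← neg_sub 2 α, Real.rpow_neg (by norm_num : (0:ℝ) ≤ 2),
            div_inv_eq_mul]
        have e3 : (2 * r) ^ (α - 1) = 2 ^ (α - 1) * r ^ (α - 1) :=
          Real.mul_rpow (by norm_num) hr0.le
        have e4 : r ^ (-(α / 2)) * r ^ (α - 1) = r ^ (-(1 - α / 2)) := by
          rw [← Real.rpow_add hr0]; ring_nf
        have e5 : r ^ (α - 2) * r ^ (-(α / 2) + 1) = r ^ (-(1 - α / 2)) := by
          rw [← Real.rpow_add hr0]; ring_nf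
        rw [e1, e2, e3, singularConst, show -(α / 2) + 1 = 1 - α / 2 by ring] at *
        calc _ = R ^ (1 - α / 2) * (2 * 2 ^ (α / 2) * 2 ^ (α - 1) / (α - 1)) * (r ^ (-(α / 2)) * r ^ (α - 1))
              + R ^ (1 - α / 2) * (2 * 2 ^ (2 - α) / (1 - α / 2)) * (r ^ (α - 2) * r ^ (1 - α / 2)) := by ring
          _ = _ := by rw [e4, e5]; ring

theorem singularConst_nonneg {α : ℝ} (hα : 1 < α) (hα2 : α < 2) : 0 ≤ singularConst α := by
  have q1 : 0 < α - 1 := by linarith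
  have q2 : 0 < 1 - α / 2 := by linarith
  unfold singularConst; positivity

/-- Constant in `lintegral_capInv_capInv_le`. -/
noncomputable def capConst (α : ℝ) : ℝ :=
  2 * (singularConst α * (2 * (1 / (1 - (1 - α / 2)) + 1 / (1 - α / 2))))

theorem capConst_nonneg {α : ℝ} (hα : 1 < α) (hα2 : α < 2) : 0 ≤ capConst α := by
  have q1 : 0 < 1 - (1 - α / 2) := by linarith
  have q2 : 0 < 1 - α / 2 := by linarith
  have := singularConst_nonneg hα hα2
  unfold capConst; positivity

theorem lintegral_singular_half_le {α R R' : ℝ} (hα : 1 < α) (hα2 : α < 2) (hR : 0 < R)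
    (hR' : 0 < R') :
    ∫⁻ u, ∫⁻ v in {v : ℝ | |v| ≤ |u|},
        ENNReal.ofReal (capInv R u * capInv R' v * |u + v| ^ (α - 2)) ≤
      ENNReal.ofReal (capConst α / 2 * (R * R') ^ (1 - α / 2)) := by
  have hs := singularConst_nonneg hα hα2
  calc ∫⁻ u, ∫⁻ v in {v : ℝ | |v| ≤ |u|},
        ENNReal.ofReal (capInv R u * capInv R' v * |u + v| ^ (α - 2))
      ≤ ∫⁻ u, ENNReal.ofReal (singularConst α * R' ^ (1 - α / 2)) *
          ENNReal.ofReal (capInv R u * |u| ^ (-(1 - α / 2))) := by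
        refine lintegral_mono_ae ?_
        filter_upwards [compl_mem_ae_iff.2 (measure_singleton (0 : ℝ))] with u hu
        simp_rw [mul_assoc, ENNReal.ofReal_mul (capInv_nonneg hR.le u)]
        rw [lintegral_const_mul' _ _ ENNReal.ofReal_ne_top]
        refine (mul_le_mul_right (lintegral_singular_inner_le hα hα2 hR' hu) _).trans ?_
        rw [← ENNReal.ofReal_mul (capInv_nonneg hR.le u), ← ENNReal.ofReal_mul (capInv_nonneg hR.le u),
          ← ENNReal.ofReal_mul (by positivity)]
        apply le_of_eq; congr 1; ring
    _ ≤ ENNReal.ofReal (singularConst α * R' ^ (1 - α / 2)) *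
        ENNReal.ofReal (2 * (1 / (1 - (1 - α / 2)) + 1 / (1 - α / 2)) * R ^ (1 - α / 2)) := by
        rw [lintegral_const_mul' _ _ ENNReal.ofReal_ne_top]
        gcongr
        exact lintegral_capInv_mul_rpow_le hR (by linarith) (by linarith)
    _ = _ := by
        rw [← ENNReal.ofReal_mul (by positivity), Real.mul_rpow hR.le hR'.le, capConst]
        congr 1; ring

/-- A Hardy–Littlewood–Sobolev estimate for the functions `min R |u|⁻¹`: the kernel `|u + v|^{α-2}`
has homogeneity `α - 2`, and splitting along `|u| = |v|` reduces the bound to one-dimensional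
integrals of powers. -/
theorem lintegral_capInv_capInv_le {α R R' : ℝ} (hα : 1 < α) (hα2 : α < 2) (hR : 0 < R)
    (hR' : 0 < R') :
    ∫⁻ u, ∫⁻ v, ENNReal.ofReal (capInv R u * capInv R' v * |u + v| ^ (α - 2)) ≤
      ENNReal.ofReal (capConst α * (R * R') ^ (1 - α / 2)) := by
  have mR := measurable_capInv R
  have mR' := measurable_capInv R'
  have hF : Measurable (Function.uncurry fun u v : ℝ =>
      ENNReal.ofReal (capInv R u * capInv R' v * |u + v| ^ (α - 2))) := by
    unfold Function.uncurry; fun_prop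
  have hS : MeasurableSet {p : ℝ × ℝ | |p.1| ≤ |p.2|} :=
    measurableSet_le (by fun_prop) (by fun_prop)
  have hm : ∀ r : ℝ, MeasurableSet {x : ℝ | |x| ≤ r} := fun r =>
    measurableSet_le (by fun_prop) measurable_const
  have hsplit : ∀ u : ℝ, ∫⁻ v, ENNReal.ofReal (capInv R u * capInv R' v * |u + v| ^ (α - 2)) ≤
      (∫⁻ v in {v : ℝ | |v| ≤ |u|}, ENNReal.ofReal (capInv R u * capInv R' v * |u + v| ^ (α - 2))) +
      ∫⁻ v, {p : ℝ × ℝ | |p.1| ≤ |p.2|}.indicator (Function.uncurry fun u v : ℝ =>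
        ENNReal.ofReal (capInv R u * capInv R' v * |u + v| ^ (α - 2))) (u, v) := fun u => by
    rw [← lintegral_add_compl _ (hm |u|)]
    refine add_le_add le_rfl ?_
    rw [← lintegral_indicator (hm |u|).compl]
    refine lintegral_mono fun v => ?_
    by_cases hv : |v| ≤ |u|
    · simp [Set.indicator, hv]
    · simp [Set.indicator, hv, (not_le.1 hv).le, Function.uncurry]
  have hI : Measurable ({p : ℝ × ℝ | |p.1| ≤ |p.2|}.indicator (Function.uncurry fun u v : ℝ =>
        ENNReal.ofReal (capInv R u * capInv R' v * |u + v| ^ (α - 2)))) := hF.indicator hS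
  refine (lintegral_mono hsplit).trans ?_
  rw [lintegral_add_right _ hI.lintegral_prod_right',
    lintegral_lintegral_swap (f := fun u v => {p : ℝ × ℝ | |p.1| ≤ |p.2|}.indicator
      (Function.uncurry fun u v : ℝ =>
        ENNReal.ofReal (capInv R u * capInv R' v * |u + v| ^ (α - 2))) (u, v)) hI.aemeasurable]
  have h2 : ∀ v u : ℝ, {p : ℝ × ℝ | |p.1| ≤ |p.2|}.indicator (Function.uncurry fun u v : ℝ =>
        ENNReal.ofReal (capInv R u * capInv R' v * |u + v| ^ (α - 2))) (u, v) =
      {u : ℝ | |u| ≤ |v|}.indicator (fun u =>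
        ENNReal.ofReal (capInv R' v * capInv R u * |v + u| ^ (α - 2))) u := fun v u => by
    simp only [Set.indicator, Set.mem_ofPred_eq, Function.uncurry, add_comm v u, mul_comm (capInv R' v)]
  simp_rw [h2, lintegral_indicator (hm _)]
  refine (add_le_add (lintegral_singular_half_le hα hα2 hR hR')
    (lintegral_singular_half_le hα hα2 hR' hR)).trans ?_
  have := capConst_nonneg hα hα2
  rw [← ENNReal.ofReal_add (by positivity) (by positivity), mul_comm R' R]
  apply le_of_eq; congr 1; ring

theorem lintegral_comp_mul_left_eq {F : ℝ → ENNReal} (hF : Measurable F) {c : ℝ} (hc : c ≠ 0) :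
    ∫⁻ u, F (c * u) = ENNReal.ofReal |c|⁻¹ * ∫⁻ u, F u := by
  rw [← lintegral_map hF (by fun_prop), Real.map_volume_mul_left hc, lintegral_smul_measure, abs_inv,
    smul_eq_mul]

theorem lintegral_capInv_capInv_scaled_le {α R R' x y : ℝ} (hα : 1 < α) (hα2 : α < 2) (hR : 0 < R)
    (hR' : 0 < R') :
    ENNReal.ofReal |x * y| * ∫⁻ u, ∫⁻ v,
      ENNReal.ofReal (capInv R u * capInv R' v * |u * x + v * y| ^ (α - 2)) ≤
      ENNReal.ofReal (capConst α * (R * R') ^ (1 - α / 2) * |x * y| ^ (α / 2)) := by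
  rcases eq_or_ne (x * y) 0 with h | h
  · simp [h]
  have hx : x ≠ 0 := left_ne_zero_of_mul h
  have hy : y ≠ 0 := right_ne_zero_of_mul h
  have hx0 : 0 < |x| := abs_pos.2 hx
  have hy0 : 0 < |y| := abs_pos.2 hy
  have mR := measurable_capInv (R / |x|)
  have mR' := measurable_capInv (R' / |y|)
  have hF : Measurable (Function.uncurry fun u v : ℝ =>
      ENNReal.ofReal (capInv (R / |x|) u * capInv (R' / |y|) v * |u + v| ^ (α - 2))) := by
    unfold Function.uncurry; fun_prop
  have e : ∀ u v : ℝ, ENNReal.ofReal (capInv R u * capInv R' v * |u * x + v * y| ^ (α - 2)) =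
      ENNReal.ofReal |x * y| * (fun p : ℝ × ℝ => ENNReal.ofReal
        (capInv (R / |x|) p.1 * capInv (R' / |y|) p.2 * |p.1 + p.2| ^ (α - 2))) (x * u, y * v) :=
      fun u v => by
    rw [← ENNReal.ofReal_mul (abs_nonneg _), capInv_div hx u, capInv_div hy v, abs_mul]
    simp only []
    rw [mul_comm u x, mul_comm v y]; congr 1; ring
  have e2 : ∀ u : ℝ, ∫⁻ v, (fun p : ℝ × ℝ => ENNReal.ofReal
        (capInv (R / |x|) p.1 * capInv (R' / |y|) p.2 * |p.1 + p.2| ^ (α - 2))) (x * u, y * v) =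
      ENNReal.ofReal |y|⁻¹ * ∫⁻ v, ENNReal.ofReal
        (capInv (R / |x|) (x * u) * capInv (R' / |y|) v * |x * u + v| ^ (α - 2)) := fun u =>
    lintegral_comp_mul_left_eq (F := fun v => ENNReal.ofReal
        (capInv (R / |x|) (x * u) * capInv (R' / |y|) v * |x * u + v| ^ (α - 2))) (by fun_prop) hy
  simp_rw [e, lintegral_const_mul' _ _ ENNReal.ofReal_ne_top, e2,
    lintegral_const_mul' _ _ ENNReal.ofReal_ne_top]
  rw [lintegral_comp_mul_left_eq (F := fun u => ∫⁻ v, ENNReal.ofReal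
        (capInv (R / |x|) u * capInv (R' / |y|) v * |u + v| ^ (α - 2))) hF.lintegral_prod_right' hx]
  have hxy : ENNReal.ofReal |x * y| * (ENNReal.ofReal |y|⁻¹ * (ENNReal.ofReal |x|⁻¹ *
      ∫⁻ u, ∫⁻ v, ENNReal.ofReal
        (capInv (R / |x|) u * capInv (R' / |y|) v * |u + v| ^ (α - 2)))) =
      ∫⁻ u, ∫⁻ v, ENNReal.ofReal
        (capInv (R / |x|) u * capInv (R' / |y|) v * |u + v| ^ (α - 2)) := by
    rw [← mul_assoc, ← mul_assoc, ← ENNReal.ofReal_mul (by positivity),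
      ← ENNReal.ofReal_mul (by positivity), abs_mul]
    have : |x| * |y| * |y|⁻¹ * |x|⁻¹ = 1 := by field_simp
    rw [this]; simp
  rw [hxy]
  refine (mul_le_mul_right (lintegral_capInv_capInv_le hα hα2 (div_pos hR hx0) (div_pos hR' hy0)) _).trans ?_
  rw [← ENNReal.ofReal_mul (by positivity)]
  apply le_of_eq; congr 1
  have e3 : R / |x| * (R' / |y|) = R * R' / |x * y| := by rw [abs_mul]; field_simp
  have h0 : 0 < |x * y| := abs_pos.2 h
  rw [e3, Real.div_rpow (by positivity) h0.le]
  have e4 : |x * y| ^ (α / 2) * |x * y| ^ (1 - α / 2) = |x * y| := by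
    rw [← Real.rpow_add h0]; simp
  have : |x * y| ^ (1 - α / 2) ≠ 0 := by positivity
  rw [mul_left_comm, mul_div_assoc', mul_assoc]
  congr 1
  rw [div_eq_iff this, mul_assoc, e4, mul_comm]

/-! ### The exponent of the characteristic function and its partial derivatives -/

section Exponent

variable {S : Type*} [MeasurableSpace S]

/-- The exponent `N(u, v) = ∫ |u f + v g|^α dμ` of the characteristic function. -/
noncomputable def stableExponent (α : ℝ) (μ : Measure S) (f g : S → ℝ) (u v : ℝ) : ℝ :=
  ∫ s, |u * f s + v * g s| ^ α ∂μ

/-- `∫ (u f + v g)^{⟨α-1⟩} f dμ`, which is `α⁻¹` times the derivative of `N(u, v)` in `u`; exchanging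
the roles of the two functions gives the derivative in `v`. -/
noncomputable def stableDeriv (α : ℝ) (μ : Measure S) (f g : S → ℝ) (u v : ℝ) : ℝ :=
  ∫ s, signedPow α (u * f s + v * g s) * f s ∂μ

variable {α : ℝ} {μ : Measure S} {f g : S → ℝ}

theorem stableExponent_swap (u v : ℝ) :
    stableExponent α μ g f v u = stableExponent α μ f g u v := by
  simp only [stableExponent, add_comm]

theorem stableExponent_nonneg (u v : ℝ) : 0 ≤ stableExponent α μ f g u v :=
  integral_nonneg fun _ => by positivity

theorem abs_add_rpow_le_six (hα : 1 < α) (hα2 : α < 2) (x y : ℝ) :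
    |x + y| ^ α ≤ 6 * (|x| ^ α + |y| ^ α) := by
  have h1 := (abs_le.1 (abs_abs_add_rpow_sub_le hα hα2 x y)).2
  have h2 := abs_mul_rpow_half_le hα x y
  rw [abs_mul, Real.mul_rpow (abs_nonneg _) (abs_nonneg _)] at h2
  linarith

theorem integrable_abs_add_rpow (hα : 1 < α) (hα2 : α < 2) (hf : Measurable f) (hg : Measurable g)
    (hfi : Integrable (fun s => |f s| ^ α) μ) (hgi : Integrable (fun s => |g s| ^ α) μ) (u v : ℝ) :
    Integrable (fun s => |u * f s + v * g s| ^ α) μ := by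
  refine (((hfi.const_mul (|u| ^ α)).add (hgi.const_mul (|v| ^ α))).const_mul 6).mono'
    (Measurable.aestronglyMeasurable (by fun_prop)) (ae_of_all _ fun s => ?_)
  rw [Real.norm_of_nonneg (by positivity)]
  refine (abs_add_rpow_le_six hα hα2 _ _).trans_eq ?_
  simp only [Pi.add_apply, abs_mul, Real.mul_rpow (abs_nonneg _) (abs_nonneg _)]

theorem integrable_rpow_mul_abs (hα : 1 < α) (hf : Measurable f) (hg : Measurable g)
    (hfi : Integrable (fun s => |f s| ^ α) μ) (hgi : Integrable (fun s => |g s| ^ α) μ) :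
    Integrable (fun s => |f s| ^ (α - 1) * |g s|) μ := by
  refine (hfi.add hgi).mono' (Measurable.aestronglyMeasurable (by fun_prop)) (ae_of_all _ fun s => ?_)
  rw [Real.norm_of_nonneg (by positivity)]
  exact rpow_mul_abs_le hα _ _

theorem integrable_abs_mul_rpow (hα : 1 < α) (hf : Measurable f) (hg : Measurable g)
    (hfi : Integrable (fun s => |f s| ^ α) μ) (hgi : Integrable (fun s => |g s| ^ α) μ) :
    Integrable (fun s => |f s * g s| ^ (α / 2)) μ := by
  refine (hfi.add hgi).mono' (Measurable.aestronglyMeasurable (by fun_prop)) (ae_of_all _ fun s => ?_)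
  rw [Real.norm_of_nonneg (by positivity)]
  exact abs_mul_rpow_half_le hα _ _

theorem bracketOneStar_le (hα : 1 < α) (hf : Measurable f) (hg : Measurable g)
    (hfi : Integrable (fun s => |f s| ^ α) μ) (hgi : Integrable (fun s => |g s| ^ α) μ) :
    bracketOneStar α μ f g ≤ ∫ s, |f s| ^ α ∂μ + ∫ s, |g s| ^ α ∂μ := by
  rw [← integral_add hfi hgi]
  exact integral_mono (integrable_rpow_mul_abs hα hf hg hfi hgi) (hfi.add hgi) fun s =>
    rpow_mul_abs_le hα _ _

theorem bracketOneStar_nonneg : 0 ≤ bracketOneStar α μ f g :=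
  integral_nonneg fun _ => by positivity

theorem bracketTwo_nonneg : 0 ≤ bracketTwo α μ f g :=
  integral_nonneg fun _ => by positivity

theorem abs_signedPow_mul_le (hα : 1 < α) (x y : ℝ) : |signedPow α x * y| ≤ |x| ^ α + |y| ^ α := by
  rw [abs_mul, abs_signedPow hα]
  exact rpow_mul_abs_le hα x y

theorem integrable_signedPow_mul (hα : 1 < α) (hα2 : α < 2) (hf : Measurable f) (hg : Measurable g)
    (hfi : Integrable (fun s => |f s| ^ α) μ) (hgi : Integrable (fun s => |g s| ^ α) μ) (u v : ℝ) :
    Integrable (fun s => signedPow α (u * f s + v * g s) * f s) μ := by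
  have hm := measurable_signedPow α
  refine ((integrable_abs_add_rpow hα hα2 hf hg hfi hgi u v).add hfi).mono' (by fun_prop)
    (ae_of_all _ fun s => ?_)
  exact abs_signedPow_mul_le hα _ _

theorem hasDerivAt_stableExponent (hα : 1 < α) (hα2 : α < 2) (hf : Measurable f) (hg : Measurable g)
    (hfi : Integrable (fun s => |f s| ^ α) μ) (hgi : Integrable (fun s => |g s| ^ α) μ) (u v : ℝ) :
    HasDerivAt (fun u => stableExponent α μ f g u v) (α * stableDeriv α μ f g u v) u := by
  have hm := measurable_signedPow α
  have hd := hasDerivAt_integral_of_dominated_loc_of_deriv_le (μ := μ)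
    (F := fun u s => |u * f s + v * g s| ^ α)
    (F' := fun u s => α * (signedPow α (u * f s + v * g s) * f s)) (x₀ := u) (s := Metric.ball u 1)
    (bound := fun s => α * (6 * ((|u| + 1) ^ α * |f s| ^ α + |v| ^ α * |g s| ^ α) + |f s| ^ α))
    (Metric.ball_mem_nhds u one_pos) (Filter.Eventually.of_forall fun u => Measurable.aestronglyMeasurable (by fun_prop))
    (integrable_abs_add_rpow hα hα2 hf hg hfi hgi u v) (by fun_prop)
    (ae_of_all _ fun s w hw => ?_)
    (((((hfi.const_mul _).add (hgi.const_mul _)).const_mul 6).add hfi).const_mul α)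
    (ae_of_all _ fun s w _ => ?_)
  · refine hd.2.congr_deriv ?_
    rw [integral_const_mul]; rfl
  · rw [norm_mul, Real.norm_of_nonneg (by linarith : 0 ≤ α)]
    refine mul_le_mul_of_nonneg_left ?_ (by linarith)
    refine (abs_signedPow_mul_le hα _ _).trans ?_
    refine add_le_add ((abs_add_rpow_le_six hα hα2 _ _).trans ?_) le_rfl
    rw [abs_mul, abs_mul, Real.mul_rpow (abs_nonneg _) (abs_nonneg _),
      Real.mul_rpow (abs_nonneg v) (abs_nonneg _)]
    have : |w| ≤ |u| + 1 := by
      have h1 : |w - u| < 1 := by simpa [Real.dist_eq] using hw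
      have h2 := abs_sub_abs_le_abs_sub w u
      linarith
    have h0 : 0 ≤ α := by linarith
    gcongr
  · have h1 : HasDerivAt (fun u => u * f s + v * g s) (f s) w := by
      simpa using ((hasDerivAt_id w).mul_const (f s)).add_const (v * g s)
    refine ((hasDerivAt_abs_rpow (w * f s + v * g s) hα).comp w h1).congr_deriv ?_
    rw [signedPow]; ring

theorem signedPow_mul_mul_self (hα : 1 < α) (u x : ℝ) :
    signedPow α (u * x) * x = signedPow α u * |x| ^ α := by
  rcases eq_or_ne x 0 with rfl | hx
  · simp [Real.zero_rpow (by linarith : α ≠ 0)]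
  have : |x| ^ α = |x| ^ (α - 2) * (x * x) := by
    rw [← abs_mul_abs_self x, ← sq, ← Real.rpow_natCast |x| 2, ← Real.rpow_add (abs_pos.2 hx)]
    norm_num
  rw [this, signedPow, signedPow, abs_mul, Real.mul_rpow (abs_nonneg _) (abs_nonneg _)]
  ring

theorem abs_stableDeriv_sub_le (hα : 1 < α) (hα2 : α < 2) (hf : Measurable f) (hg : Measurable g)
    (hfi : Integrable (fun s => |f s| ^ α) μ) (hgi : Integrable (fun s => |g s| ^ α) μ) (u v : ℝ) :
    |stableDeriv α μ f g u v - signedPow α u * ∫ s, |f s| ^ α ∂μ| ≤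
      2 * |v| ^ (α - 1) * bracketOneStar α μ g f := by
  have e : stableDeriv α μ f g u v - signedPow α u * ∫ s, |f s| ^ α ∂μ =
      ∫ s, (signedPow α (u * f s + v * g s) * f s - signedPow α u * |f s| ^ α) ∂μ := by
    rw [integral_sub (integrable_signedPow_mul hα hα2 hf hg hfi hgi u v) (hfi.const_mul _),
      integral_const_mul, stableDeriv]
  rw [e, bracketOneStar, ← integral_const_mul, ← Real.norm_eq_abs]
  refine norm_integral_le_of_norm_le ((integrable_rpow_mul_abs hα hg hf hgi hfi).const_mul _)
    (ae_of_all _ fun s => ?_)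
  rw [← signedPow_mul_mul_self hα, ← sub_mul, Real.norm_eq_abs, abs_mul, ← mul_assoc]
  refine mul_le_mul_of_nonneg_right ((abs_signedPow_sub_le hα hα2 _ _).trans_eq ?_) (abs_nonneg _)
  rw [add_sub_cancel_left, abs_mul, Real.mul_rpow (abs_nonneg _) (abs_nonneg _), mul_assoc]

theorem abs_stableExponent_sub_le (hα : 1 < α) (hα2 : α < 2) (hf : Measurable f) (hg : Measurable g)
    (hfi : Integrable (fun s => |f s| ^ α) μ) (hgi : Integrable (fun s => |g s| ^ α) μ) (u v : ℝ) :
    |stableExponent α μ f g u v - (|u| ^ α * ∫ s, |f s| ^ α ∂μ + |v| ^ α * ∫ s, |g s| ^ α ∂μ)| ≤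
      5 * (|u| ^ (α / 2) * |v| ^ (α / 2)) * bracketTwo α μ f g := by
  have e : stableExponent α μ f g u v -
      (|u| ^ α * ∫ s, |f s| ^ α ∂μ + |v| ^ α * ∫ s, |g s| ^ α ∂μ) =
      ∫ s, (|u * f s + v * g s| ^ α - (|u| ^ α * |f s| ^ α + |v| ^ α * |g s| ^ α)) ∂μ := by
    have hi : Integrable (fun s => |u| ^ α * |f s| ^ α + |v| ^ α * |g s| ^ α) μ :=
      (hfi.const_mul _).add (hgi.const_mul _)
    rw [integral_sub (integrable_abs_add_rpow hα hα2 hf hg hfi hgi u v) hi, integral_add (hfi.const_mul _) (hgi.const_mul _),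
      integral_const_mul, integral_const_mul, stableExponent]
  rw [e, bracketTwo, ← integral_const_mul, ← Real.norm_eq_abs]
  refine norm_integral_le_of_norm_le ((integrable_abs_mul_rpow hα hf hg hfi hgi).const_mul _)
    (ae_of_all _ fun s => ?_)
  have h := abs_abs_add_rpow_sub_le hα hα2 (u * f s) (v * g s)
  rw [sub_sub] at h
  simp only [abs_mul, Real.mul_rpow (abs_nonneg _) (abs_nonneg _)] at h ⊢
  refine h.trans_eq ?_
  ring

theorem rpow_le_one_add {p x : ℝ} (hp : 0 ≤ p) (hp1 : p ≤ 1) : |x| ^ p ≤ 1 + |x| := by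
  rcases le_total |x| 1 with h | h
  · have := Real.rpow_le_one (abs_nonneg x) h hp
    linarith [abs_nonneg x]
  · have := Real.rpow_le_rpow_of_exponent_le h hp1
    rw [Real.rpow_one] at this; linarith

theorem exists_abs_stableDeriv_le (hα : 1 < α) (hα2 : α < 2) (hf : Measurable f) (hg : Measurable g)
    (hfi : Integrable (fun s => |f s| ^ α) μ) (hgi : Integrable (fun s => |g s| ^ α) μ) :
    ∃ c : ℝ, 0 ≤ c ∧ ∀ u v : ℝ, |stableDeriv α μ f g u v| ≤ c * ((1 + |u|) * (1 + |v|)) := by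
  have hs : 0 ≤ ∫ s, |f s| ^ α ∂μ := integral_nonneg fun _ => by positivity
  have hb : 0 ≤ bracketOneStar α μ g f := bracketOneStar_nonneg
  refine ⟨∫ s, |f s| ^ α ∂μ + 2 * bracketOneStar α μ g f, by positivity, fun u v => ?_⟩
  have h1 := abs_stableDeriv_sub_le hα hα2 hf hg hfi hgi u v
  have h2 := abs_sub_abs_le_abs_sub (stableDeriv α μ f g u v) (signedPow α u * ∫ s, |f s| ^ α ∂μ)
  rw [abs_mul, abs_signedPow hα, abs_of_nonneg hs] at h2
  have hu := rpow_le_one_add (x := u) (by linarith : 0 ≤ α - 1) (by linarith)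
  have hv := rpow_le_one_add (x := v) (by linarith : 0 ≤ α - 1) (by linarith)
  have u0 := abs_nonneg u
  have v0 := abs_nonneg v
  have i1 : |u| ^ (α - 1) * ∫ s, |f s| ^ α ∂μ ≤ ((1 + |u|) * (1 + |v|)) * ∫ s, |f s| ^ α ∂μ := by
    gcongr; nlinarith
  have i2 : 2 * |v| ^ (α - 1) * bracketOneStar α μ g f ≤
      2 * ((1 + |u|) * (1 + |v|)) * bracketOneStar α μ g f := by
    gcongr; nlinarith
  linarith

theorem measurable_stableExponent [SFinite μ] (hf : Measurable f) (hg : Measurable g) :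
    Measurable (fun p : ℝ × ℝ => stableExponent α μ f g p.1 p.2) := by
  have : StronglyMeasurable (fun q : (ℝ × ℝ) × S => |q.1.1 * f q.2 + q.1.2 * g q.2| ^ α) :=
    Measurable.stronglyMeasurable (by fun_prop)
  exact this.integral_prod_right'.measurable

theorem measurable_stableDeriv [SFinite μ] (hf : Measurable f) (hg : Measurable g) :
    Measurable (fun p : ℝ × ℝ => stableDeriv α μ f g p.1 p.2) := by
  have hm := measurable_signedPow α
  have : StronglyMeasurable
      (fun q : (ℝ × ℝ) × S => signedPow α (q.1.1 * f q.2 + q.1.2 * g q.2) * f q.2) :=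
    Measurable.stronglyMeasurable (by fun_prop)
  exact this.integral_prod_right'.measurable

theorem abs_exp_neg_sub_le {m x y : ℝ} (hx : m ≤ x) (hy : m ≤ y) :
    |Real.exp (-x) - Real.exp (-y)| ≤ Real.exp (-m) * |x - y| := by
  wlog h : x ≤ y generalizing x y
  · rw [abs_sub_comm, abs_sub_comm x]; exact this hy hx (le_of_not_ge h)
  have h1 : Real.exp (-y) ≤ Real.exp (-x) := Real.exp_le_exp.2 (by linarith)
  rw [abs_of_nonneg (by linarith), abs_of_nonpos (by linarith)]
  have h2 : Real.exp (-y) = Real.exp (-x) * Real.exp (x - y) := by rw [← Real.exp_add]; ring_nf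
  have h3 := Real.add_one_le_exp (x - y)
  have h4 : Real.exp (-x) ≤ Real.exp (-m) := Real.exp_le_exp.2 (by linarith)
  have h5 := Real.exp_pos (-x)
  rw [h2]
  calc Real.exp (-x) - Real.exp (-x) * Real.exp (x - y)
      = Real.exp (-x) * (1 - Real.exp (x - y)) := by ring
    _ ≤ Real.exp (-x) * (-(x - y)) := by gcongr; linarith
    _ ≤ _ := by gcongr; linarith

/-- Collects the three error terms of a product of two perturbed factors; the hypothesis `X ≤ s + t`
makes the quadratic term `X Y` linear in `Y`. -/
theorem mul_add_mul_add_mul_le {s t a b X Y : ℝ} (hs : 0 ≤ s) (ht : 0 ≤ t) (ha : 1 ≤ a) (hb : 1 ≤ b)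
    (hX : 0 ≤ X) (hY : 0 ≤ Y) (hXst : X ≤ s + t) :
    (a * s) * (2 * a * X) + (2 * b * Y) * (b * t) + (2 * b * Y) * (2 * a * X) ≤
      (6 * s + 6 * t) * (X + Y) * (a ^ 2 * b ^ 2) := by
  have a2 : 1 ≤ a ^ 2 := one_le_pow₀ ha
  have b2 : 1 ≤ b ^ 2 := one_le_pow₀ hb
  have hab : a ^ 2 ≤ a ^ 2 * b ^ 2 := le_mul_of_one_le_right (by positivity) b2
  have hba : b ^ 2 ≤ a ^ 2 * b ^ 2 := le_mul_of_one_le_left (by positivity) a2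
  have hab' : a * b ≤ a ^ 2 * b ^ 2 :=
    mul_le_mul (le_self_pow₀ ha two_ne_zero) (le_self_pow₀ hb two_ne_zero) (by linarith)
      (by positivity)
  calc _ = 2 * (s * X) * a ^ 2 + 2 * (t * Y) * b ^ 2 + 4 * (X * Y) * (a * b) := by ring
    _ ≤ 2 * (s * X) * (a ^ 2 * b ^ 2) + 2 * (t * Y) * (a ^ 2 * b ^ 2) +
        4 * ((s + t) * Y) * (a ^ 2 * b ^ 2) := by gcongr
    _ = (2 * (s * X) + 2 * (t * Y) + 4 * ((s + t) * Y)) * (a ^ 2 * b ^ 2) := by ring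
    _ ≤ _ := by
      gcongr
      nlinarith [mul_nonneg hs hX, mul_nonneg hs hY, mul_nonneg ht hX, mul_nonneg ht hY]

/-- The difference between the regular part of the mixed derivative of `exp(-N)` and its value for
independent components is controlled by the brackets. -/
theorem abs_deriv_mul_sub_le (hα : 1 < α) (hα2 : α < 2) (hf : Measurable f) (hg : Measurable g)
    (hfi : Integrable (fun s => |f s| ^ α) μ) (hgi : Integrable (fun s => |g s| ^ α) μ)
    {ε s t : ℝ} (hs : ∫ s, |f s| ^ α ∂μ = s) (ht : ∫ s, |g s| ^ α ∂μ = t)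
    (hε1 : ε ≤ 1) (u v : ℝ)
    (hN : ε * (|u| ^ α * s + |v| ^ α * t) ≤ stableExponent α μ f g u v) :
    |Real.exp (-stableExponent α μ f g u v) * stableDeriv α μ f g u v * stableDeriv α μ g f v u -
        Real.exp (-(|u| ^ α * s + |v| ^ α * t)) * (signedPow α u * s) * (signedPow α v * t)| ≤
      (5 * (s * t) + 6 * s + 6 * t) * (bracketOne α μ f g + bracketTwo α μ f g) *
        (Real.exp (-(ε * (|u| ^ α * s + |v| ^ α * t))) * ((1 + |u|) ^ 2 * (1 + |v|) ^ 2)) := by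
  have hs0 : 0 ≤ s := hs ▸ integral_nonneg fun _ => by positivity
  have ht0 : 0 ≤ t := ht ▸ integral_nonneg fun _ => by positivity
  set N := stableExponent α μ f g u v
  set M := |u| ^ α * s + |v| ^ α * t with hM
  have hM0 : 0 ≤ M := by positivity
  set m := ε * M
  have hmM : m ≤ M := mul_le_of_le_one_left hM0 hε1
  have d1 := abs_stableDeriv_sub_le hα hα2 hf hg hfi hgi u v
  have d2 := abs_stableDeriv_sub_le hα hα2 hg hf hgi hfi v u
  have d3 := abs_stableExponent_sub_le hα hα2 hf hg hfi hgi u v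
  have b1 : 0 ≤ bracketOneStar α μ f g := bracketOneStar_nonneg
  have b2 : 0 ≤ bracketOneStar α μ g f := bracketOneStar_nonneg
  have b3 : 0 ≤ bracketTwo α μ f g := bracketTwo_nonneg
  have b4 := bracketOneStar_le hα hf hg hfi hgi
  rw [hs, ht] at b4 d3
  rw [hs] at d1
  rw [ht] at d2
  rw [bracketOne]
  set X := bracketOneStar α μ f g
  set Y := bracketOneStar α μ g f
  set Z := bracketTwo α μ f g
  set p := signedPow α u * s
  set q := signedPow α v * t
  set P := stableDeriv α μ f g u v
  set Q := stableDeriv α μ g f v u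
  have hu := rpow_le_one_add (x := u) (by linarith : 0 ≤ α - 1) (by linarith)
  have hv := rpow_le_one_add (x := v) (by linarith : 0 ≤ α - 1) (by linarith)
  have hu' := rpow_le_one_add (x := u) (by linarith : 0 ≤ α / 2) (by linarith)
  have hv' := rpow_le_one_add (x := v) (by linarith : 0 ≤ α / 2) (by linarith)
  set a := 1 + |u| with ha
  set b := 1 + |v| with hb
  have a1 : 1 ≤ a := by rw [ha]; linarith [abs_nonneg u]
  have b1' : 1 ≤ b := by rw [hb]; linarith [abs_nonneg v]
  have hp : |p| ≤ a * s := by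
    rw [abs_mul, abs_signedPow hα, abs_of_nonneg hs0]; gcongr
  have hq : |q| ≤ b * t := by
    rw [abs_mul, abs_signedPow hα, abs_of_nonneg ht0]; gcongr
  have hP : |P - p| ≤ 2 * b * Y := d1.trans (by gcongr)
  have hQ : |Q - q| ≤ 2 * a * X := d2.trans (by gcongr)
  have hE : |Real.exp (-N) - Real.exp (-M)| ≤ Real.exp (-m) * (5 * (a * b) * Z) :=
    (abs_exp_neg_sub_le hN hmM).trans (by gcongr; exact d3.trans (by gcongr))
  have hN' : Real.exp (-N) ≤ Real.exp (-m) := Real.exp_le_exp.2 (by linarith)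
  have id1 : Real.exp (-N) * P * Q - Real.exp (-M) * p * q =
      (Real.exp (-N) - Real.exp (-M)) * (p * q) +
        Real.exp (-N) * (p * (Q - q) + (P - p) * q + (P - p) * (Q - q)) := by ring
  have a0 : 0 ≤ a := by linarith
  have b0 : 0 ≤ b := by linarith
  have t1 : |(Real.exp (-N) - Real.exp (-M)) * (p * q)| ≤
      Real.exp (-m) * (5 * (a * b) * Z) * ((a * s) * (b * t)) := by
    rw [abs_mul, abs_mul]; gcongr
  have t2 : |p * (Q - q) + (P - p) * q + (P - p) * (Q - q)| ≤
      (a * s) * (2 * a * X) + (2 * b * Y) * (b * t) + (2 * b * Y) * (2 * a * X) := by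
    refine (abs_add_three _ _ _).trans ?_
    rw [abs_mul p, abs_mul (P - p), abs_mul (P - p)]
    exact add_le_add (add_le_add (mul_le_mul hp hQ (abs_nonneg _) (by positivity))
      (mul_le_mul hP hq (abs_nonneg _) (by positivity)))
      (mul_le_mul hP hQ (abs_nonneg _) (by positivity))
  have t3 : |Real.exp (-N) * (p * (Q - q) + (P - p) * q + (P - p) * (Q - q))| ≤
      Real.exp (-m) * ((a * s) * (2 * a * X) + (2 * b * Y) * (b * t) + (2 * b * Y) * (2 * a * X)) := by
    rw [abs_mul, abs_of_pos (Real.exp_pos _)]; gcongr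
  have t4 := mul_add_mul_add_mul_le hs0 ht0 a1 b1' b1 b2 b4
  rw [id1]
  calc _ ≤ _ := abs_add_le _ _
    _ ≤ Real.exp (-m) * (5 * (a * b) * Z) * ((a * s) * (b * t)) +
        Real.exp (-m) * ((6 * s + 6 * t) * (X + Y) * (a ^ 2 * b ^ 2)) := by
      refine add_le_add t1 (t3.trans ?_)
      gcongr
    _ ≤ _ := by
      have e1 : 0 ≤ Real.exp (-m) * (a ^ 2 * b ^ 2) := by positivity
      have e2 : 5 * (s * t) * Z + (6 * s + 6 * t) * (X + Y) ≤
          (5 * (s * t) + 6 * s + 6 * t) * (X + Y + Z) := by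
        have h1 := mul_nonneg (mul_nonneg hs0 ht0) (add_nonneg b1 b2)
        have h2 := mul_nonneg (add_nonneg hs0 ht0) b3
        linarith
      calc _ = Real.exp (-m) * (a ^ 2 * b ^ 2) * (5 * (s * t) * Z + (6 * s + 6 * t) * (X + Y)) := by ring
        _ ≤ _ := mul_le_mul_of_nonneg_left e2 e1
        _ = _ := by ring

end Exponent

/-! ### Integration by parts against the characteristic function -/

/-- The decay `(1 + u²)⁻³` required of test functions; it outweighs the polynomial growth of the
derivatives of the exponent in all integrals below. -/
noncomputable def decay (u : ℝ) : ℝ := ((1 + u ^ 2) ^ 3)⁻¹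

theorem decay_pos (u : ℝ) : 0 < decay u := by unfold decay; positivity

theorem decay_mul_le (u : ℝ) : decay u * (1 + |u|) ^ 4 ≤ 4 * (1 + u ^ 2)⁻¹ := by
  have h1 : (1 + |u|) ^ 2 ≤ 2 * (1 + u ^ 2) := by nlinarith [sq_abs u, sq_nonneg (1 - |u|)]
  have h2 : (1 + |u|) ^ 4 ≤ (2 * (1 + u ^ 2)) ^ 2 := by
    calc (1 + |u|) ^ 4 = ((1 + |u|) ^ 2) ^ 2 := by ring
      _ ≤ _ := by gcongr
  calc decay u * (1 + |u|) ^ 4 ≤ decay u * (2 * (1 + u ^ 2)) ^ 2 := by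
        gcongr; exact (decay_pos u).le
    _ = _ := by
      have : 1 + u ^ 2 ≠ 0 := by positivity
      rw [decay]; field_simp; ring

theorem integrable_decay : Integrable fun u : ℝ => decay u * (1 + |u|) ^ 4 := by
  refine (integrable_inv_one_add_sq.const_mul 4).mono' ?_ (ae_of_all _ fun u => ?_)
  · unfold decay; exact Measurable.aestronglyMeasurable (by fun_prop)
  · rw [Real.norm_of_nonneg (mul_nonneg (decay_pos u).le (by positivity))]
    exact decay_mul_le u

theorem integrable_of_norm_le_decay {F : ℝ → ℂ} (hF : AEStronglyMeasurable F) {C : ℝ}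
    (h : ∀ u, ‖F u‖ ≤ C * (decay u * (1 + |u|) ^ 4)) : Integrable F :=
  (integrable_decay.const_mul C).mono' hF (ae_of_all _ h)

theorem integrable_prod_of_norm_le_decay {F : ℝ × ℝ → ℂ} (hF : AEStronglyMeasurable F) {C : ℝ}
    (h : ∀ p, ‖F p‖ ≤ C * ((decay p.1 * (1 + |p.1|) ^ 4) * (decay p.2 * (1 + |p.2|) ^ 4))) :
    Integrable F :=
  ((integrable_decay.mul_prod integrable_decay).const_mul C).mono' hF (ae_of_all _ h)

/-- A differentiable function `A` with derivative `A'`, both decaying like `(1 + u²)⁻³`. -/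
structure IsTestPair (A A' : ℝ → ℂ) : Prop where
  hasDerivAt : ∀ u, HasDerivAt A (A' u) u
  measurable_deriv : Measurable A'
  bound : ∃ M, 0 ≤ M ∧ ∀ u, ‖A u‖ ≤ M * decay u ∧ ‖A' u‖ ≤ M * decay u

theorem IsTestPair.continuous {A A' : ℝ → ℂ} (h : IsTestPair A A') : Continuous A :=
  continuous_iff_continuousAt.2 fun u => (h.hasDerivAt u).continuousAt

theorem integrable_indicator_abs_rpow {α : ℝ} (hα : 1 < α) :
    Integrable ({x : ℝ | |x| ≤ 1}.indicator fun x => |x| ^ (α - 2)) := by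
  have hm : MeasurableSet {x : ℝ | |x| ≤ 1} := measurableSet_le (by fun_prop) measurable_const
  rw [integrable_indicator_iff hm]
  refine ⟨Measurable.aestronglyMeasurable (by fun_prop), ?_⟩
  rw [hasFiniteIntegral_iff_ofReal (ae_of_all _ fun x => by positivity),
    lintegral_abs_rpow_le (by linarith) zero_le_one]
  exact ENNReal.ofReal_lt_top

theorem integrable_mul_abs_rpow {α : ℝ} (hα : 1 < α) (hα2 : α < 2) {H : ℝ → ℂ} (hH : Integrable H) {M : ℝ}
    (hM : ∀ v, ‖H v‖ ≤ M) (c d : ℝ) :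
    Integrable fun v => H v * ((|c + v * d| ^ (α - 2) : ℝ) : ℂ) := by
  rcases eq_or_ne d 0 with rfl | hd
  · simpa using hH.mul_const _
  have hk := ((integrable_indicator_abs_rpow hα).comp_add_left c).comp_mul_right' hd
  refine (hH.norm.add (hk.const_mul M)).mono' ?_ (ae_of_all _ fun v => ?_)
  · refine hH.aestronglyMeasurable.mul (Measurable.aestronglyMeasurable ?_)
    fun_prop
  · rw [norm_mul, Complex.norm_real, Real.norm_of_nonneg (by positivity), Pi.add_apply]
    have hM0 : 0 ≤ M := (norm_nonneg _).trans (hM v)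
    by_cases hv : |c + v * d| ≤ 1
    · rw [Set.indicator_of_mem (show c + v * d ∈ {x : ℝ | |x| ≤ 1} from hv)]
      have : 0 ≤ |c + v * d| ^ (α - 2) := by positivity
      nlinarith [norm_nonneg (H v), mul_le_mul_of_nonneg_right (hM v) this]
    · rw [Set.indicator_of_notMem (show c + v * d ∉ {x : ℝ | |x| ≤ 1} from hv)]
      have := Real.rpow_le_one_of_one_le_of_nonpos (not_le.1 hv).le (by linarith : α - 2 ≤ 0)
      nlinarith [norm_nonneg (H v)]

/-- Integration by parts against `v ↦ (c + v d)^{⟨α-1⟩}`, whose derivative has an integrable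
singularity at the zero of `c + v d`. -/
theorem integral_deriv_mul_signedPow {α : ℝ} (hα : 1 < α) (hα2 : α < 2) {H H' : ℝ → ℂ}
    (hd : ∀ v, HasDerivAt H (H' v) v) (c d : ℝ)
    (h0 : Integrable fun v => H v * (signedPow α (c + v * d) : ℂ))
    (h1 : Integrable fun v => H' v * (signedPow α (c + v * d) : ℂ))
    (h2 : Integrable fun v => H v * ((|c + v * d| ^ (α - 2) : ℝ) : ℂ)) :
    ∫ v, H' v * (signedPow α (c + v * d) : ℂ) =
      -((α - 1 : ℝ) * d * ∫ v, H v * ((|c + v * d| ^ (α - 2) : ℝ) : ℂ)) := by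
  by_cases hcd : c = 0 ∧ d = 0
  · simp [hcd.1, hcd.2, signedPow_zero]
  -- `F` is continuous, and differentiable except at `-c / d`. For `d = 0` there is no singularity, and
  -- the point `-c / 0 = 0` at which the line is cut is harmless.
  set F : ℝ → ℂ := fun v => H v * (signedPow α (c + v * d) : ℂ)
  set F' : ℝ → ℂ := fun v => H' v * (signedPow α (c + v * d) : ℂ) +
    (α - 1 : ℝ) * d * (H v * ((|c + v * d| ^ (α - 2) : ℝ) : ℂ)) with hF'
  have hne : ∀ v, v ≠ -c / d → c + v * d ≠ 0 := fun v hv h => by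
    rcases eq_or_ne d 0 with hd0 | hd0
    · exact hcd ⟨by simpa [hd0] using h, hd0⟩
    · exact hv (by rw [eq_div_iff hd0]; linarith)
  have hF : ∀ v, v ≠ -c / d → HasDerivAt F (F' v) v := fun v hv => by
    have i1 : HasDerivAt (fun v => c + v * d) d v := by
      simpa using ((hasDerivAt_id v).mul_const d).const_add c
    have i2 := ((hasDerivAt_signedPow α (hne v hv)).comp v i1).ofReal_comp
    refine ((hd v).mul i2).congr_deriv ?_
    simp only [hF', Function.comp]
    push_cast; ring
  have hFc : Continuous F := by
    have hc : Continuous H := continuous_iff_continuousAt.2 fun v => (hd v).continuousAt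
    have := continuous_signedPow hα hα2
    fun_prop
  have hFi : Integrable F' := h1.add (h2.const_mul _)
  have t1 := tendsto_zero_of_hasDerivAt_of_integrableOn_Ioi (a := -c / d)
    (fun v hv => hF v (ne_of_gt hv)) hFi.integrableOn h0.integrableOn
  have t2 := tendsto_zero_of_hasDerivAt_of_integrableOn_Iic (a := -c / d - 1)
    (fun v hv => hF v (ne_of_lt (lt_of_le_of_lt hv (by linarith)))) hFi.integrableOn h0.integrableOn
  have e1 := integral_Ioi_of_hasDerivAt_of_tendsto (a := -c / d) hFc.continuousWithinAt
    (fun v hv => hF v (ne_of_gt hv)) hFi.integrableOn t1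
  have e2 := integral_Iic_of_hasDerivAt_of_tendsto (a := -c / d) hFc.continuousWithinAt
    (fun v hv => hF v (ne_of_lt hv)) hFi.integrableOn t2
  have e3 : ∫ v, F' v = 0 := by
    rw [← intervalIntegral.integral_Iic_add_Ioi hFi.integrableOn hFi.integrableOn, e1, e2]; ring
  rw [hF', integral_add h1 (h2.const_mul _), integral_const_mul] at e3
  exact eq_neg_of_add_eq_zero_left e3

section ByParts

variable {S : Type*} [MeasurableSpace S]

/-- The characteristic function `exp(-N(u, v))`, as a real number. -/
noncomputable def stableChar (α : ℝ) (μ : Measure S) (f g : S → ℝ) (u v : ℝ) : ℝ :=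
  Real.exp (-stableExponent α μ f g u v)

variable {α : ℝ} {μ : Measure S} {f g : S → ℝ}

theorem stableChar_nonneg (u v : ℝ) : 0 ≤ stableChar α μ f g u v := (Real.exp_pos _).le

theorem stableChar_le_one (u v : ℝ) : stableChar α μ f g u v ≤ 1 :=
  Real.exp_le_one_iff.2 (neg_nonpos.2 (stableExponent_nonneg u v))

theorem norm_stableChar_le_one (u v : ℝ) : ‖(stableChar α μ f g u v : ℂ)‖ ≤ 1 := by
  rw [Complex.norm_real, Real.norm_of_nonneg (stableChar_nonneg u v)]
  exact stableChar_le_one u v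

theorem measurable_stableChar [SFinite μ] (hf : Measurable f) (hg : Measurable g) :
    Measurable (fun p : ℝ × ℝ => stableChar α μ f g p.1 p.2) :=
  (measurable_stableExponent hf hg).neg.exp

theorem hasDerivAt_stableChar_fst (hα : 1 < α) (hα2 : α < 2) (hf : Measurable f) (hg : Measurable g)
    (hfi : Integrable (fun s => |f s| ^ α) μ) (hgi : Integrable (fun s => |g s| ^ α) μ) (u v : ℝ) :
    HasDerivAt (fun u => (stableChar α μ f g u v : ℂ))
      (-(stableChar α μ f g u v * (α * stableDeriv α μ f g u v))) u := by
  have h := ((hasDerivAt_stableExponent hα hα2 hf hg hfi hgi u v).neg.exp).ofReal_comp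
  refine h.congr_deriv ?_
  simp only [Pi.neg_apply, stableChar]
  push_cast; ring

theorem hasDerivAt_stableChar_snd (hα : 1 < α) (hα2 : α < 2) (hf : Measurable f) (hg : Measurable g)
    (hfi : Integrable (fun s => |f s| ^ α) μ) (hgi : Integrable (fun s => |g s| ^ α) μ) (u v : ℝ) :
    HasDerivAt (fun v => (stableChar α μ f g u v : ℂ))
      (-(stableChar α μ f g u v * (α * stableDeriv α μ g f v u))) v := by
  have h := hasDerivAt_stableChar_fst hα hα2 hg hf hgi hfi v u
  simpa only [stableChar, stableExponent_swap] using h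

theorem norm_stableDeriv_le {c : ℝ} (hα : 1 < α)
    (hc : ∀ u v : ℝ, |stableDeriv α μ f g u v| ≤ c * ((1 + |u|) * (1 + |v|))) (u v : ℝ) :
    ‖(α * stableDeriv α μ f g u v : ℂ)‖ ≤ α * c * (1 + |u|) * (1 + |v|) := by
  rw [norm_mul, Complex.norm_real α, Complex.norm_real (stableDeriv _ _ _ _ _ _),
    Real.norm_of_nonneg (by linarith), Real.norm_eq_abs]
  calc _ ≤ α * (c * ((1 + |u|) * (1 + |v|))) := by gcongr; exact hc u v
    _ = _ := by ring

variable [SFinite μ]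

/-- Integration by parts in the first variable. -/
theorem integral_deriv_mul_stableChar (hα : 1 < α) (hα2 : α < 2) (hf : Measurable f)
    (hg : Measurable g) (hfi : Integrable (fun s => |f s| ^ α) μ)
    (hgi : Integrable (fun s => |g s| ^ α) μ) {A A' : ℝ → ℂ} (hA : IsTestPair A A') (v : ℝ) :
    ∫ u, A' u * (stableChar α μ f g u v : ℂ) =
      ∫ u, A u * (stableChar α μ f g u v * (α * stableDeriv α μ f g u v)) := by
  obtain ⟨M, hM0, hM⟩ := hA.bound
  obtain ⟨c, hc0, hc⟩ := exists_abs_stableDeriv_le hα hα2 hf hg hfi hgi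
  have mφ : Measurable fun u => stableChar α μ f g u v :=
    (measurable_stableChar hf hg).comp (measurable_id.prodMk measurable_const)
  have mN : Measurable fun u => stableDeriv α μ f g u v :=
    (measurable_stableDeriv hf hg).comp (measurable_id.prodMk measurable_const)
  have mA := hA.continuous.measurable
  have mA' := hA.measurable_deriv
  have one_le : ∀ u : ℝ, 1 ≤ 1 + |u| := fun u => by linarith [abs_nonneg u]
  have i1 : Integrable (fun u => A' u * (stableChar α μ f g u v : ℂ)) := by
    refine integrable_of_norm_le_decay (C := M) (Measurable.aestronglyMeasurable (by fun_prop)) fun u => ?_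
    rw [norm_mul]
    have h1 := (hM u).2
    have h2 := norm_stableChar_le_one (α := α) (μ := μ) (f := f) (g := g) u v
    have h3 : 1 ≤ (1 + |u|) ^ 4 := one_le_pow₀ (one_le u)
    have h4 := decay_pos u
    calc ‖A' u‖ * ‖(stableChar α μ f g u v : ℂ)‖ ≤ M * decay u * (1 + |u|) ^ 4 := by
          gcongr; exact h2.trans h3
      _ = _ := by ring
  have i2 : Integrable (fun u => A u * -(stableChar α μ f g u v * (α * stableDeriv α μ f g u v) : ℂ)) := by
    refine integrable_of_norm_le_decay (C := M * (α * (c * (1 + |v|))))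
      (Measurable.aestronglyMeasurable (by fun_prop)) fun u => ?_
    rw [norm_mul, norm_neg, norm_mul, norm_mul, Complex.norm_real α, Complex.norm_real (stableDeriv _ _ _ _ _ _),
      Real.norm_of_nonneg (by linarith : 0 ≤ α), Real.norm_eq_abs]
    have h1 := (hM u).1
    have h2 := norm_stableChar_le_one (α := α) (μ := μ) (f := f) (g := g) u v
    have h3 : 1 + |u| ≤ (1 + |u|) ^ 4 := le_self_pow₀ (one_le u) (by norm_num)
    have h4 := decay_pos u
    have h5 := hc u v
    have h6 : 0 ≤ α := by linarith
    calc _ ≤ M * decay u * (1 * (α * (c * ((1 + |u|) ^ 4 * (1 + |v|))))) := by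
          gcongr; exact h5.trans (by gcongr)
      _ = _ := by ring
  have i3 : Integrable (fun u => A u * (stableChar α μ f g u v : ℂ)) := by
    refine integrable_of_norm_le_decay (C := M) (Measurable.aestronglyMeasurable (by fun_prop)) fun u => ?_
    rw [norm_mul]
    have h1 := (hM u).1
    have h2 := norm_stableChar_le_one (α := α) (μ := μ) (f := f) (g := g) u v
    have h3 : 1 ≤ (1 + |u|) ^ 4 := one_le_pow₀ (one_le u)
    have h4 := decay_pos u
    calc ‖A u‖ * ‖(stableChar α μ f g u v : ℂ)‖ ≤ M * decay u * (1 + |u|) ^ 4 := by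
          gcongr; exact h2.trans h3
      _ = _ := by ring
  have := integral_mul_deriv_eq_deriv_mul_of_integrable (fun u _ => hA.hasDerivAt u)
    (fun u _ => hasDerivAt_stableChar_fst hα hα2 hf hg hfi hgi u v) i2 i1 i3
  simp only [mul_neg, integral_neg] at this
  exact (neg_injective this).symm

/-- Integrability over `ℝ × S` needed to exchange the integrals in `integral_deriv_mul_stableDeriv`. -/
theorem integrable_mul_signedPow_prod (hα : 1 < α) (hα2 : α < 2) (hf : Measurable f)
    (hg : Measurable g) (hfi : Integrable (fun s => |f s| ^ α) μ)
    (hgi : Integrable (fun s => |g s| ^ α) μ) {H' : ℝ → ℂ} (mH' : Measurable H') {C : ℝ} (hC : 0 ≤ C)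
    (bH' : ∀ v, ‖H' v‖ ≤ C * (decay v * (1 + |v|))) (u : ℝ) :
    Integrable (Function.uncurry fun (v : ℝ) (s : S) =>
      H' v * ((signedPow α (u * f s + v * g s) * f s : ℝ) : ℂ)) (volume.prod μ) := by
  have mS := measurable_signedPow α
  have one_le : ∀ v : ℝ, 1 ≤ 1 + |v| := fun v => by linarith [abs_nonneg v]
  have hm : Measurable (Function.uncurry fun (v : ℝ) (s : S) =>
      H' v * ((signedPow α (u * f s + v * g s) * f s : ℝ) : ℂ)) := by
    unfold Function.uncurry; fun_prop
  rw [integrable_prod_iff hm.aestronglyMeasurable]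
  refine ⟨ae_of_all _ fun v =>
    (integrable_signedPow_mul hα hα2 hf hg hfi hgi u v).ofReal.const_mul (H' v), ?_⟩
  set G := ∫ s, (6 * |u| ^ α + 1) * |f s| ^ α ∂μ
  set G' := ∫ s, 6 * |g s| ^ α ∂μ
  have hG : 0 ≤ G := integral_nonneg fun _ => by positivity
  have hG' : 0 ≤ G' := integral_nonneg fun _ => by positivity
  refine (integrable_decay.const_mul (C * (G + G'))).mono'
    hm.aestronglyMeasurable.norm.integral_prod_right' (ae_of_all _ fun v => ?_)
  have h4 := decay_pos v
  have hv : |v| ^ α ≤ (1 + |v|) ^ 3 := by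
    calc |v| ^ α ≤ (1 + |v|) ^ α := by gcongr; linarith
      _ ≤ (1 + |v|) ^ (3 : ℝ) := Real.rpow_le_rpow_of_exponent_le (one_le v) (by linarith)
      _ = _ := by norm_cast
  have hint : ∫ s, |signedPow α (u * f s + v * g s) * f s| ∂μ ≤ (G + G') * (1 + |v|) ^ 3 := by
    calc _ ≤ ∫ s, ((6 * |u| ^ α + 1) * |f s| ^ α + |v| ^ α * (6 * |g s| ^ α)) ∂μ := by
          refine integral_mono (integrable_signedPow_mul hα hα2 hf hg hfi hgi u v).abs
            ((hfi.const_mul _).add ((hgi.const_mul _).const_mul _)) fun s => ?_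
          refine (abs_signedPow_mul_le hα _ _).trans ?_
          have := abs_add_rpow_le_six hα hα2 (u * f s) (v * g s)
          rw [abs_mul, abs_mul, Real.mul_rpow (abs_nonneg _) (abs_nonneg _),
            Real.mul_rpow (abs_nonneg _) (abs_nonneg _)] at this
          linarith
      _ = G + |v| ^ α * G' := by
          rw [integral_add (hfi.const_mul _) ((hgi.const_mul _).const_mul _),
            integral_const_mul (|v| ^ α)]
      _ ≤ G * (1 + |v|) ^ 3 + (1 + |v|) ^ 3 * G' := by
          gcongr
          exact le_mul_of_one_le_right hG (one_le_pow₀ (one_le v))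
      _ = _ := by ring
  rw [Real.norm_of_nonneg (integral_nonneg fun _ => norm_nonneg _)]
  simp only [Function.uncurry, norm_mul (H' v), Complex.norm_real, Real.norm_eq_abs, integral_const_mul]
  calc _ ≤ (C * (decay v * (1 + |v|))) * ((G + G') * (1 + |v|) ^ 3) := by
        refine mul_le_mul (bH' v) hint (integral_nonneg fun _ => abs_nonneg _) ?_
        positivity
    _ = _ := by ring

/-- The function `stableDeriv` is differentiable in its second variable only under the integral
over `S`, with a singular derivative, so that the integration by parts is done for each point
of `S` separately. -/
theorem integral_deriv_mul_stableDeriv (hα : 1 < α) (hα2 : α < 2) (hf : Measurable f)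
    (hg : Measurable g) (hfi : Integrable (fun s => |f s| ^ α) μ)
    (hgi : Integrable (fun s => |g s| ^ α) μ) {H H' : ℝ → ℂ} (dH : ∀ v, HasDerivAt H (H' v) v)
    (mH' : Measurable H') {M C : ℝ} (hM : 0 ≤ M) (hC : 0 ≤ C) (bH : ∀ v, ‖H v‖ ≤ M * decay v)
    (bH' : ∀ v, ‖H' v‖ ≤ C * (decay v * (1 + |v|))) (u : ℝ) :
    ∫ v, H' v * stableDeriv α μ f g u v =
      -((α - 1 : ℝ) * ∫ s, (f s * g s : ℝ) *
        (∫ v, H v * ((|u * f s + v * g s| ^ (α - 2) : ℝ) : ℂ)) ∂μ) := by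
  have mS := measurable_signedPow α
  have mH : Measurable H :=
    (continuous_iff_continuousAt.2 fun v => (dH v).continuousAt : Continuous H).measurable
  have one_le : ∀ v : ℝ, 1 ≤ 1 + |v| := fun v => by linarith [abs_nonneg v]
  have e2 : ∀ v, H' v * (stableDeriv α μ f g u v : ℂ) =
      ∫ s, H' v * ((signedPow α (u * f s + v * g s) * f s : ℝ) : ℂ) ∂μ := fun v => by
    rw [integral_const_mul, integral_complex_ofReal, stableDeriv]
  rw [integral_congr_ae (ae_of_all _ e2), integral_integral_swap
    (integrable_mul_signedPow_prod hα hα2 hf hg hfi hgi mH' hC bH' u)]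
  have e3 : ∀ s, ∫ v, H' v * ((signedPow α (u * f s + v * g s) * f s : ℝ) : ℂ) =
      -((α - 1 : ℝ) * ((f s * g s : ℝ) *
        ∫ v, H v * ((|u * f s + v * g s| ^ (α - 2) : ℝ) : ℂ))) := fun s => by
    set w := |u * f s| + |g s| + 1
    have hw : 0 ≤ w := by positivity
    have bS : ∀ v, ‖(signedPow α (u * f s + v * g s) : ℂ)‖ ≤ 2 * w * (1 + |v|) := fun v => by
      rw [Complex.norm_real, Real.norm_eq_abs, abs_signedPow hα]
      refine (rpow_le_one_add (by linarith) (by linarith)).trans ?_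
      have h1 := abs_add_le (u * f s) (v * g s)
      rw [abs_mul v] at h1
      have h2 := abs_nonneg (u * f s)
      have h3 := abs_nonneg (g s)
      have h4 := abs_nonneg v
      nlinarith [mul_nonneg h2 h4, mul_nonneg h3 h4]
    have i0 : Integrable fun v => H v * (signedPow α (u * f s + v * g s) : ℂ) := by
      refine integrable_of_norm_le_decay (C := M * (2 * w))
        (Measurable.aestronglyMeasurable (by fun_prop)) fun v => ?_
      have h4 := decay_pos v
      have h3 : 1 + |v| ≤ (1 + |v|) ^ 4 := le_self_pow₀ (one_le v) (by norm_num)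
      rw [norm_mul]
      calc _ ≤ M * decay v * (2 * w * (1 + |v|)) := by
            gcongr
            · exact bH v
            · exact bS v
        _ = M * (2 * w) * (decay v * (1 + |v|)) := by ring
        _ ≤ _ := by gcongr
    have i1 : Integrable fun v => H' v * (signedPow α (u * f s + v * g s) : ℂ) := by
      refine integrable_of_norm_le_decay (C := C * (2 * w))
        (Measurable.aestronglyMeasurable (by fun_prop)) fun v => ?_
      have h4 := decay_pos v
      have h3 : (1 + |v|) ^ 2 ≤ (1 + |v|) ^ 4 := pow_le_pow_right₀ (one_le v) (by norm_num)
      rw [norm_mul]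
      calc _ ≤ (C * (decay v * (1 + |v|))) * (2 * w * (1 + |v|)) := by
            gcongr
            · exact bH' v
            · exact bS v
        _ = C * (2 * w) * (decay v * (1 + |v|) ^ 2) := by ring
        _ ≤ _ := by gcongr
    have iH : Integrable H := by
      refine integrable_of_norm_le_decay (C := M) mH.aestronglyMeasurable fun v => (bH v).trans ?_
      gcongr
      exact le_mul_of_one_le_right (decay_pos v).le (one_le_pow₀ (one_le v))
    have cH : ∀ v, ‖H v‖ ≤ M := fun v => (bH v).trans (mul_le_of_le_one_right hM
      (inv_le_one_of_one_le₀ (one_le_pow₀ (by nlinarith [sq_nonneg v]))))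
    have e4 : ∀ v, H' v * ((signedPow α (u * f s + v * g s) * f s : ℝ) : ℂ) =
        f s * (H' v * (signedPow α (u * f s + v * g s) : ℂ)) := fun v => by
      push_cast; ring
    rw [integral_congr_ae (ae_of_all _ e4), integral_const_mul,
      integral_deriv_mul_signedPow hα hα2 dH (u * f s) (g s) i0 i1
        (integrable_mul_abs_rpow hα hα2 iH cH _ _)]
    push_cast; ring
  rw [integral_congr_ae (ae_of_all _ e3), integral_neg, integral_const_mul]

set_option maxHeartbeats 1000000 in
/-- Integration by parts in the second variable, by `integral_deriv_mul_stableDeriv` for the product of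
`B` and the characteristic function. -/
theorem integral_deriv_mul_stableChar_mul (hα : 1 < α) (hα2 : α < 2) (hf : Measurable f)
    (hg : Measurable g) (hfi : Integrable (fun s => |f s| ^ α) μ)
    (hgi : Integrable (fun s => |g s| ^ α) μ) {B B' : ℝ → ℂ} (hB : IsTestPair B B') (u : ℝ) :
    ∫ v, B' v * (stableChar α μ f g u v * (α * stableDeriv α μ f g u v)) =
      (∫ v, B v * (stableChar α μ f g u v * (α * stableDeriv α μ f g u v) *
        (α * stableDeriv α μ g f v u))) -
      (α * (α - 1) : ℝ) * ∫ s, (f s * g s : ℝ) *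
        (∫ v, B v * stableChar α μ f g u v * ((|u * f s + v * g s| ^ (α - 2) : ℝ) : ℂ)) ∂μ := by
  obtain ⟨M, hM0, hM⟩ := hB.bound
  obtain ⟨c, hc0, hc⟩ := exists_abs_stableDeriv_le hα hα2 hf hg hfi hgi
  obtain ⟨c', hc0', hc'⟩ := exists_abs_stableDeriv_le hα hα2 hg hf hgi hfi
  have hα0 : 0 ≤ α := by linarith
  have mφ : Measurable fun v => stableChar α μ f g u v :=
    (measurable_stableChar hf hg).comp (measurable_const.prodMk measurable_id)
  have mN : Measurable fun v => stableDeriv α μ f g u v :=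
    (measurable_stableDeriv hf hg).comp (measurable_const.prodMk measurable_id)
  have mN' : Measurable fun v => stableDeriv α μ g f v u :=
    (measurable_stableDeriv hg hf).comp (measurable_id.prodMk measurable_const)
  have mB := hB.continuous.measurable
  have mB' := hB.measurable_deriv
  have one_le : ∀ v : ℝ, 1 ≤ 1 + |v| := fun v => by linarith [abs_nonneg v]
  set D := α * c' * (1 + |u|) with hD
  set E := α * c * (1 + |u|) with hE
  have hD0 : 0 ≤ D := by positivity
  have hE0 : 0 ≤ E := by positivity
  have bN : ∀ v, ‖(stableChar α μ f g u v * (α * stableDeriv α μ g f v u) : ℂ)‖ ≤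
      D * (1 + |v|) := fun v => by
    rw [norm_mul]
    have h2 := norm_stableChar_le_one (α := α) (μ := μ) (f := f) (g := g) u v
    calc _ ≤ 1 * (α * c' * (1 + |v|) * (1 + |u|)) := by
          gcongr
          exact norm_stableDeriv_le hα hc' v u
      _ = _ := by ring
  have bN1 : ∀ v, ‖(α * stableDeriv α μ f g u v : ℂ)‖ ≤ E * (1 + |v|) := fun v =>
    norm_stableDeriv_le hα hc u v
  have dH : ∀ v, HasDerivAt (fun v => B v * (stableChar α μ f g u v : ℂ))
      (B' v * (stableChar α μ f g u v : ℂ) +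
        B v * -(stableChar α μ f g u v * (α * stableDeriv α μ g f v u))) v := fun v =>
    (hB.hasDerivAt v).mul (hasDerivAt_stableChar_snd hα hα2 hf hg hfi hgi u v)
  have bH : ∀ v, ‖B v * (stableChar α μ f g u v : ℂ)‖ ≤ M * decay v := fun v => by
    rw [norm_mul]
    have h4 := decay_pos v
    calc _ ≤ M * decay v * 1 := by
          gcongr
          · exact (hM v).1
          · exact norm_stableChar_le_one u v
      _ = _ := mul_one _
  have bH' : ∀ v, ‖B' v * (stableChar α μ f g u v : ℂ) +
        B v * -(stableChar α μ f g u v * (α * stableDeriv α μ g f v u))‖ ≤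
      M * (1 + D) * (decay v * (1 + |v|)) := fun v => by
    have h4 := decay_pos v
    have h3 := one_le v
    refine (norm_add_le _ _).trans ?_
    rw [norm_mul, norm_mul, norm_neg]
    calc _ ≤ M * decay v * 1 + M * decay v * (D * (1 + |v|)) := by
          gcongr
          · exact (hM v).2
          · exact norm_stableChar_le_one u v
          · exact (hM v).1
          · exact bN v
      _ ≤ M * decay v * (1 + |v|) + M * decay v * (D * (1 + |v|)) := by gcongr
      _ = _ := by ring
  have i1 : Integrable fun v => (B' v * (stableChar α μ f g u v : ℂ) +
        B v * -(stableChar α μ f g u v * (α * stableDeriv α μ g f v u))) *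
          (α * stableDeriv α μ f g u v : ℂ) := by
    refine integrable_of_norm_le_decay (C := M * (1 + D) * E)
      (Measurable.aestronglyMeasurable (by fun_prop)) fun v => ?_
    have h4 := decay_pos v
    have h3 : (1 + |v|) ^ 2 ≤ (1 + |v|) ^ 4 := pow_le_pow_right₀ (one_le v) (by norm_num)
    rw [norm_mul]
    calc _ ≤ (M * (1 + D) * (decay v * (1 + |v|))) * (E * (1 + |v|)) :=
          mul_le_mul (bH' v) (bN1 v) (norm_nonneg _) (by positivity)
      _ = M * (1 + D) * E * (decay v * (1 + |v|) ^ 2) := by ring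
      _ ≤ _ := by gcongr
  have i2 : Integrable fun v => B v * (stableChar α μ f g u v * (α * stableDeriv α μ f g u v) *
        (α * stableDeriv α μ g f v u) : ℂ) := by
    refine integrable_of_norm_le_decay (C := M * (D * E))
      (Measurable.aestronglyMeasurable (by fun_prop)) fun v => ?_
    have h4 := decay_pos v
    have h3 : (1 + |v|) ^ 2 ≤ (1 + |v|) ^ 4 := pow_le_pow_right₀ (one_le v) (by norm_num)
    rw [norm_mul, mul_right_comm, norm_mul (_ * _)]
    calc _ ≤ M * decay v * (D * (1 + |v|) * (E * (1 + |v|))) :=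
          mul_le_mul (hM v).1 (mul_le_mul (bN v) (bN1 v) (norm_nonneg _) (by positivity))
            (by positivity) (by positivity)
      _ = M * (D * E) * (decay v * (1 + |v|) ^ 2) := by ring
      _ ≤ _ := by gcongr
  have e1 : ∀ v, B' v * (stableChar α μ f g u v * (α * stableDeriv α μ f g u v) : ℂ) =
      (B' v * (stableChar α μ f g u v : ℂ) +
        B v * -(stableChar α μ f g u v * (α * stableDeriv α μ g f v u))) *
          (α * stableDeriv α μ f g u v : ℂ) +
      B v * (stableChar α μ f g u v * (α * stableDeriv α μ f g u v) *
        (α * stableDeriv α μ g f v u) : ℂ) := fun v => by ring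
  rw [integral_congr_ae (ae_of_all _ e1), integral_add i1 i2, add_comm, sub_eq_add_neg]
  congr 1
  simp_rw [mul_left_comm _ (α : ℂ) (stableDeriv α μ f g u _ : ℂ)]
  rw [integral_const_mul, integral_deriv_mul_stableDeriv hα hα2 hf hg hfi hgi dH (by fun_prop) hM0
    (by positivity) bH bH' u]
  push_cast; ring

end ByParts

section Bound

variable {S : Type*} [MeasurableSpace S] {α : ℝ} {μ : Measure S} {f g : S → ℝ}

theorem norm_stableChar_mul_deriv_le {c c' : ℝ} (hα : 1 < α)
    (hc : ∀ u v : ℝ, |stableDeriv α μ f g u v| ≤ c * ((1 + |u|) * (1 + |v|)))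
    (hc' : ∀ u v : ℝ, |stableDeriv α μ g f u v| ≤ c' * ((1 + |u|) * (1 + |v|))) (hc0 : 0 ≤ c) (u v : ℝ) :
    ‖(stableChar α μ f g u v * (α * stableDeriv α μ f g u v) * (α * stableDeriv α μ g f v u) : ℂ)‖ ≤
      (α * c) * (α * c') * (1 + |u|) ^ 2 * (1 + |v|) ^ 2 := by
  have hα0 : 0 ≤ α := by linarith
  rw [norm_mul, norm_mul]
  calc _ ≤ 1 * (α * c * (1 + |u|) * (1 + |v|)) * (α * c' * (1 + |v|) * (1 + |u|)) :=
        mul_le_mul (mul_le_mul (norm_stableChar_le_one u v) (norm_stableDeriv_le hα hc u v)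
          (norm_nonneg _) zero_le_one) (norm_stableDeriv_le hα hc' v u) (norm_nonneg _) (by positivity)
    _ = _ := by ring

variable [SFinite μ]

theorem integrable_test_mul_deriv (hα : 1 < α) (hα2 : α < 2) (hf : Measurable f)
    (hg : Measurable g) (hfi : Integrable (fun s => |f s| ^ α) μ)
    (hgi : Integrable (fun s => |g s| ^ α) μ) {A A' B B' : ℝ → ℂ} (hA : IsTestPair A A')
    (hB : IsTestPair B B') :
    Integrable fun p : ℝ × ℝ => A p.1 * (B p.2 * (stableChar α μ f g p.1 p.2 *
      (α * stableDeriv α μ f g p.1 p.2) * (α * stableDeriv α μ g f p.2 p.1))) := by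
  obtain ⟨M, hM0, hM⟩ := hA.bound
  obtain ⟨M', hM0', hM'⟩ := hB.bound
  obtain ⟨c, hc0, hc⟩ := exists_abs_stableDeriv_le hα hα2 hf hg hfi hgi
  obtain ⟨c', hc0', hc'⟩ := exists_abs_stableDeriv_le hα hα2 hg hf hgi hfi
  have hα0 : 0 ≤ α := by linarith
  have mA := hA.continuous.measurable
  have mB := hB.continuous.measurable
  have m1 := measurable_stableChar (α := α) (μ := μ) hf hg
  have m2 := measurable_stableDeriv (α := α) (μ := μ) hf hg
  have m3 : Measurable fun p : ℝ × ℝ => stableDeriv α μ g f p.2 p.1 :=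
    (measurable_stableDeriv (α := α) (μ := μ) hg hf).comp measurable_swap
  refine integrable_prod_of_norm_le_decay (C := M * M' * ((α * c) * (α * c')))
    (Measurable.aestronglyMeasurable (by fun_prop)) fun p => ?_
  have d1 := decay_pos p.1
  have d2 := decay_pos p.2
  have pw : ∀ x : ℝ, (1 + |x|) ^ 2 ≤ (1 + |x|) ^ 4 := fun x =>
    pow_le_pow_right₀ (by linarith [abs_nonneg x]) (by norm_num)
  rw [norm_mul, norm_mul]
  calc _ ≤ (M * decay p.1) * ((M' * decay p.2) *
          ((α * c) * (α * c') * (1 + |p.1|) ^ 2 * (1 + |p.2|) ^ 2)) :=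
        mul_le_mul (hM _).1 (mul_le_mul (hM' _).1 (norm_stableChar_mul_deriv_le hα hc hc' hc0 _ _)
          (norm_nonneg _) (by positivity)) (by positivity) (by positivity)
    _ = M * M' * ((α * c) * (α * c')) * ((decay p.1 * (1 + |p.1|) ^ 2) * (decay p.2 * (1 + |p.2|) ^ 2)) := by
        ring
    _ ≤ _ := mul_le_mul_of_nonneg_left (mul_le_mul (mul_le_mul_of_nonneg_left (pw _) d1.le)
          (mul_le_mul_of_nonneg_left (pw _) d2.le) (by positivity) (by positivity)) (by positivity)

/-- Integration by parts in both variables: a term with the product of the first derivatives of the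
exponent, and a singular term from its mixed second derivative. -/
theorem integral_deriv_deriv_mul_stableChar (hα : 1 < α) (hα2 : α < 2) (hf : Measurable f)
    (hg : Measurable g) (hfi : Integrable (fun s => |f s| ^ α) μ)
    (hgi : Integrable (fun s => |g s| ^ α) μ) {A A' B B' : ℝ → ℂ} (hA : IsTestPair A A')
    (hB : IsTestPair B B') :
    ∫ p : ℝ × ℝ, A' p.1 * (B' p.2 * stableChar α μ f g p.1 p.2) =
      (∫ p : ℝ × ℝ, A p.1 * (B p.2 * (stableChar α μ f g p.1 p.2 *
        (α * stableDeriv α μ f g p.1 p.2) * (α * stableDeriv α μ g f p.2 p.1)))) -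
      (α * (α - 1) : ℝ) * ∫ u, A u * (∫ s, (f s * g s : ℝ) *
        (∫ v, B v * stableChar α μ f g u v * ((|u * f s + v * g s| ^ (α - 2) : ℝ) : ℂ)) ∂μ) := by
  obtain ⟨M, hM0, hM⟩ := hA.bound
  obtain ⟨M', hM0', hM'⟩ := hB.bound
  obtain ⟨c, hc0, hc⟩ := exists_abs_stableDeriv_le hα hα2 hf hg hfi hgi
  have hα0 : 0 ≤ α := by linarith
  have mA := hA.continuous.measurable
  have mA' := hA.measurable_deriv
  have mB' := hB.measurable_deriv
  have m1 := measurable_stableChar (α := α) (μ := μ) hf hg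
  have m2 := measurable_stableDeriv (α := α) (μ := μ) hf hg
  have one_le : ∀ x : ℝ, 1 ≤ 1 + |x| := fun x => by linarith [abs_nonneg x]
  have i1 : Integrable fun p : ℝ × ℝ => A' p.1 * (B' p.2 * (stableChar α μ f g p.1 p.2 : ℂ)) := by
    refine integrable_prod_of_norm_le_decay (C := M * M')
      (Measurable.aestronglyMeasurable (by fun_prop)) fun p => ?_
    have d1 := decay_pos p.1
    have d2 := decay_pos p.2
    rw [norm_mul, norm_mul]
    calc _ ≤ (M * decay p.1) * ((M' * decay p.2) * 1) :=
          mul_le_mul (hM _).2 (mul_le_mul (hM' _).2 (norm_stableChar_le_one _ _)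
            (norm_nonneg _) (by positivity)) (by positivity) (by positivity)
      _ = M * M' * ((decay p.1 * 1) * (decay p.2 * 1)) := by ring
      _ ≤ _ := by
          gcongr
          · exact one_le_pow₀ (one_le _)
          · exact one_le_pow₀ (one_le _)
  have i2 : Integrable fun p : ℝ × ℝ => A p.1 * (B' p.2 *
      (stableChar α μ f g p.1 p.2 * (α * stableDeriv α μ f g p.1 p.2) : ℂ)) := by
    refine integrable_prod_of_norm_le_decay (C := M * M' * (α * c))
      (Measurable.aestronglyMeasurable (by fun_prop)) fun p => ?_
    have d1 := decay_pos p.1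
    have d2 := decay_pos p.2
    rw [norm_mul, norm_mul, norm_mul]
    calc _ ≤ (M * decay p.1) * ((M' * decay p.2) * (1 * (α * c * (1 + |p.1|) * (1 + |p.2|)))) :=
          mul_le_mul (hM _).1 (mul_le_mul (hM' _).2 (mul_le_mul (norm_stableChar_le_one _ _)
            (norm_stableDeriv_le hα hc _ _) (norm_nonneg _) zero_le_one) (by positivity)
            (by positivity)) (by positivity) (by positivity)
      _ = M * M' * (α * c) * ((decay p.1 * (1 + |p.1|)) * (decay p.2 * (1 + |p.2|))) := by ring
      _ ≤ _ := by
          gcongr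
          · exact le_self_pow₀ (one_le _) (by norm_num)
          · exact le_self_pow₀ (one_le _) (by norm_num)
  have i3 := integrable_test_mul_deriv hα hα2 hf hg hfi hgi hA hB
  have e1 : ∀ v : ℝ, ∫ u, A' u * (B' v * (stableChar α μ f g u v : ℂ)) =
      ∫ u, A u * (B' v * (stableChar α μ f g u v * (α * stableDeriv α μ f g u v) : ℂ)) := fun v => by
    simp_rw [mul_left_comm _ (B' v)]
    rw [integral_const_mul, integral_const_mul,
      integral_deriv_mul_stableChar hα hα2 hf hg hfi hgi hA v]
  rw [Measure.volume_eq_prod] at i1 i2 i3 ⊢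
  rw [integral_prod_symm _ i1]
  simp only [e1]
  rw [← integral_prod_symm (fun p : ℝ × ℝ => A p.1 * (B' p.2 *
      (stableChar α μ f g p.1 p.2 * (α * stableDeriv α μ f g p.1 p.2) : ℂ))) i2,
    integral_prod _ i2, integral_prod _ i3]
  have j2 := i2.integral_prod_left
  have j3 := i3.integral_prod_left
  simp only [integral_const_mul, integral_deriv_mul_stableChar_mul hα hα2 hf hg hfi hgi hB] at j2 j3 ⊢
  have j4 := j3.sub j2
  rw [← integral_const_mul, ← integral_sub j3 ?_]
  · refine integral_congr_ae (ae_of_all _ fun u => ?_)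
    simp only
    ring
  · refine j4.congr (ae_of_all _ fun u => ?_)
    simp only [Pi.sub_apply]
    ring

/-- The singular part of the mixed derivative contributes at most a multiple of `[ξ, η]₂`. -/
theorem norm_integral_singular_le (hα : 1 < α) (hα2 : α < 2) (hf : Measurable f)
    (hg : Measurable g) (hfi : Integrable (fun s => |f s| ^ α) μ)
    (hgi : Integrable (fun s => |g s| ^ α) μ) {A B : ℝ → ℂ} {a R R' : ℝ} (ha : 0 ≤ a) (hR : 0 < R) (hR' : 0 < R')
    (hA : ∀ u, u ≠ 0 → ‖A u‖ ≤ a * capInv R u) (hB : ∀ u, u ≠ 0 → ‖B u‖ ≤ a * capInv R' u) :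
    ‖∫ u, A u * (∫ s, (f s * g s : ℝ) *
        (∫ v, B v * stableChar α μ f g u v * ((|u * f s + v * g s| ^ (α - 2) : ℝ) : ℂ)) ∂μ)‖ ≤
      a * a * capConst α * (R * R') ^ (1 - α / 2) * bracketTwo α μ f g := by
  have hcap := capConst_nonneg hα hα2
  have hb2 : 0 ≤ bracketTwo α μ f g := bracketTwo_nonneg
  have mR := measurable_capInv R
  have mR' := measurable_capInv R'
  have ne0 : ∀ᵐ x : ℝ, x ≠ 0 := compl_mem_ae_iff.2 (measure_singleton (0 : ℝ))
  have hv : ∀ u s, ‖∫ v, B v * stableChar α μ f g u v * ((|u * f s + v * g s| ^ (α - 2) : ℝ) : ℂ)‖ₑ ≤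
      ∫⁻ v, ENNReal.ofReal (a * capInv R' v * |u * f s + v * g s| ^ (α - 2)) := fun u s => by
    refine (enorm_integral_le_lintegral_enorm _).trans (lintegral_mono_ae ?_)
    filter_upwards [ne0] with v hv
    rw [← ofReal_norm, norm_mul, norm_mul, Complex.norm_real (_ ^ _),
      Real.norm_of_nonneg (by positivity)]
    apply ENNReal.ofReal_le_ofReal
    refine mul_le_mul_of_nonneg_right ?_ (by positivity)
    calc _ ≤ a * capInv R' v * 1 :=
          mul_le_mul (hB v hv) (norm_stableChar_le_one _ _) (norm_nonneg _)
            (mul_nonneg ha (capInv_nonneg hR'.le _))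
      _ = _ := mul_one _
  have hs : ∀ u, ‖∫ s, (f s * g s : ℝ) *
        (∫ v, B v * stableChar α μ f g u v * ((|u * f s + v * g s| ^ (α - 2) : ℝ) : ℂ)) ∂μ‖ₑ ≤
      ∫⁻ s, ENNReal.ofReal |f s * g s| *
        (∫⁻ v, ENNReal.ofReal (a * capInv R' v * |u * f s + v * g s| ^ (α - 2))) ∂μ := fun u => by
    refine (enorm_integral_le_lintegral_enorm _).trans (lintegral_mono fun s => ?_)
    rw [enorm_mul, ← ofReal_norm ((f s * g s : ℝ) : ℂ), Complex.norm_real, Real.norm_eq_abs]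
    gcongr
    exact hv u s
  have hm : Measurable (Function.uncurry fun (u : ℝ) (s : S) =>
      ENNReal.ofReal |f s * g s| * (∫⁻ v, ENNReal.ofReal
        (capInv R u * capInv R' v * |u * f s + v * g s| ^ (α - 2)))) := by
    unfold Function.uncurry
    refine Measurable.mul (by fun_prop) ?_
    have : Measurable (fun q : (ℝ × S) × ℝ => ENNReal.ofReal
        (capInv R q.1.1 * capInv R' q.2 * |q.1.1 * f q.1.2 + q.2 * g q.1.2| ^ (α - 2))) := by
      fun_prop
    exact this.lintegral_prod_right'
  have key : ‖∫ u, A u * (∫ s, (f s * g s : ℝ) *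
        (∫ v, B v * stableChar α μ f g u v * ((|u * f s + v * g s| ^ (α - 2) : ℝ) : ℂ)) ∂μ)‖ₑ ≤
      ENNReal.ofReal (a * a * capConst α * (R * R') ^ (1 - α / 2) * bracketTwo α μ f g) := by
    calc _ ≤ ∫⁻ u, ENNReal.ofReal (a * a) * ∫⁻ s, ENNReal.ofReal |f s * g s| *
            (∫⁻ v, ENNReal.ofReal (capInv R u * capInv R' v * |u * f s + v * g s| ^ (α - 2))) ∂μ := by
          refine (enorm_integral_le_lintegral_enorm _).trans (lintegral_mono_ae ?_)
          filter_upwards [ne0] with u hu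
          have hAu : ‖A u‖ₑ ≤ ENNReal.ofReal (a * capInv R u) := by
            rw [← ofReal_norm]; exact ENNReal.ofReal_le_ofReal (hA u hu)
          rw [enorm_mul]
          refine (mul_le_mul' hAu (hs u)).trans (le_of_eq ?_)
          rw [← lintegral_const_mul' _ _ ENNReal.ofReal_ne_top,
            ← lintegral_const_mul' _ _ ENNReal.ofReal_ne_top]
          refine lintegral_congr fun s => ?_
          rw [mul_left_comm, mul_left_comm (ENNReal.ofReal (a * a))]
          congr 1
          rw [← lintegral_const_mul' _ _ ENNReal.ofReal_ne_top,
            ← lintegral_const_mul' _ _ ENNReal.ofReal_ne_top]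
          refine lintegral_congr fun v => ?_
          rw [← ENNReal.ofReal_mul (mul_nonneg ha (capInv_nonneg hR.le _)),
            ← ENNReal.ofReal_mul (by positivity)]
          congr 1; ring
      _ = ENNReal.ofReal (a * a) * ∫⁻ s, ENNReal.ofReal |f s * g s| * (∫⁻ u,
            ∫⁻ v, ENNReal.ofReal (capInv R u * capInv R' v * |u * f s + v * g s| ^ (α - 2))) ∂μ := by
          rw [lintegral_const_mul' _ _ ENNReal.ofReal_ne_top, lintegral_lintegral_swap hm.aemeasurable]
          simp_rw [lintegral_const_mul' _ _ ENNReal.ofReal_ne_top]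
      _ ≤ ENNReal.ofReal (a * a) * ∫⁻ s,
            ENNReal.ofReal (capConst α * (R * R') ^ (1 - α / 2) * |f s * g s| ^ (α / 2)) ∂μ := by
          gcongr with s
          exact lintegral_capInv_capInv_scaled_le hα hα2 hR hR'
      _ = _ := by
          rw [← ofReal_integral_eq_lintegral_ofReal
            ((integrable_abs_mul_rpow hα hf hg hfi hgi).const_mul _)
            (ae_of_all _ fun s => by positivity), integral_const_mul, ← ENNReal.ofReal_mul (by positivity),
            bracketTwo]
          congr 1; ring
  rw [← ofReal_norm] at key
  exact (ENNReal.ofReal_le_ofReal_iff (by positivity)).1 key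

end Bound

/-- The weight `|u|^{-α/2} (1 + |u|)² exp(-k |u|^α)`: the first factor comes from
`min R |u|⁻¹ ≤ R^{1-α/2} |u|^{-α/2}`, the others from `abs_deriv_mul_sub_le`. -/
noncomputable def expWeight (α k u : ℝ) : ℝ :=
  |u| ^ (-(α / 2)) * (1 + |u|) ^ 2 * Real.exp (-(k * |u| ^ α))

theorem expWeight_nonneg (α k u : ℝ) : 0 ≤ expWeight α k u := by
  unfold expWeight; positivity

theorem integrable_expWeight {α k : ℝ} (hα : 1 < α) (hα2 : α < 2) (hk : 0 < k) :
    Integrable (expWeight α k) := by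
  refine ⟨Measurable.aestronglyMeasurable (by unfold expWeight; fun_prop), ?_⟩
  rw [hasFiniteIntegral_iff_ofReal (ae_of_all _ fun u => expWeight_nonneg _ _ _)]
  have e := lintegral_comp_abs_eq fun x =>
    ENNReal.ofReal (x ^ (-(α / 2)) * (1 + x) ^ 2 * Real.exp (-(k * x ^ α)))
  unfold expWeight
  rw [e]
  refine ENNReal.mul_lt_top (by simp) ?_
  have h1 := integrableOn_rpow_mul_exp_neg_mul_rpow (p := α) (s := -(α / 2)) (by linarith)
    (by linarith) hk
  have h2 := integrableOn_rpow_mul_exp_neg_mul_rpow (p := α) (s := 2 - α / 2) (by linarith)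
    (by linarith) hk
  refine lt_of_le_of_lt ?_ ((h1.const_mul 2).add (h2.const_mul 2)).lintegral_lt_top
  refine setLIntegral_mono' measurableSet_Ioi fun x hx => ENNReal.ofReal_le_ofReal ?_
  have hx0 : (0:ℝ) < x := hx
  have e2 : x ^ (2 - α / 2) = x ^ 2 * x ^ (-(α / 2)) := by
    rw [← Real.rpow_natCast, ← Real.rpow_add hx0]; norm_num; ring_nf
  simp only [Pi.add_apply]
  rw [e2, ← neg_mul]
  have : 0 ≤ x ^ (-(α / 2)) * Real.exp (-k * x ^ α) := by positivity
  nlinarith [mul_nonneg this (sq_nonneg (1 - x))]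

section SmoothBound

variable {S : Type*} [MeasurableSpace S] {α : ℝ} {μ : Measure S} {f g : S → ℝ}

theorem stableExponent_zero_right (u : ℝ) :
    stableExponent α μ f g u 0 = |u| ^ α * ∫ s, |f s| ^ α ∂μ := by
  simp only [stableExponent, zero_mul, add_zero, abs_mul,
    Real.mul_rpow (abs_nonneg _) (abs_nonneg _), integral_const_mul]

theorem stableDeriv_zero_right (hα : 1 < α) (u : ℝ) :
    stableDeriv α μ f g u 0 = signedPow α u * ∫ s, |f s| ^ α ∂μ := by
  simp only [stableDeriv, zero_mul, add_zero, signedPow_mul_mul_self hα, integral_const_mul]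

/-- Constant in `norm_integral_test_sub_le`. -/
noncomputable def smoothConst (α ε s t : ℝ) : ℝ :=
  α ^ 2 * (5 * (s * t) + 6 * s + 6 * t) *
    ((∫ u, expWeight α (ε * s) u) * ∫ v, expWeight α (ε * t) v) + α * (α - 1) * capConst α

theorem smoothConst_nonneg {ε s t : ℝ} (hα : 1 < α) (hα2 : α < 2) (hs : 0 ≤ s) (ht : 0 ≤ t) :
    0 ≤ smoothConst α ε s t := by
  have h1 : ∀ k, 0 ≤ ∫ u, expWeight α k u := fun k => integral_nonneg fun u => expWeight_nonneg _ _ _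
  have h2 := capConst_nonneg hα hα2
  have h3 := h1 (ε * s)
  have h4 := h1 (ε * t)
  have h5 : 0 ≤ α - 1 := by linarith
  unfold smoothConst
  positivity

/-- The nonsingular part of the mixed derivative, compared with the one for independent components,
contributes at most a multiple of `[ξ, η]₁ + [ξ, η]₂`. -/
theorem norm_integral_regular_le (hα : 1 < α) (hα2 : α < 2) (hf : Measurable f)
    (hg : Measurable g) (hfi : Integrable (fun s => |f s| ^ α) μ)
    (hgi : Integrable (fun s => |g s| ^ α) μ) {ε s t : ℝ} (hs : ∫ x, |f x| ^ α ∂μ = s)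
    (ht : ∫ x, |g x| ^ α ∂μ = t) (hs0 : 0 < s) (ht0 : 0 < t) (hε : 0 < ε) (hε1 : ε ≤ 1)
    (hN : ∀ u v, ε * (|u| ^ α * s + |v| ^ α * t) ≤ stableExponent α μ f g u v)
    {A B : ℝ → ℂ} {a R R' : ℝ} (ha : 0 ≤ a) (hR : 0 < R) (hR' : 0 < R')
    (hA : ∀ u, u ≠ 0 → ‖A u‖ ≤ a * capInv R u) (hB : ∀ u, u ≠ 0 → ‖B u‖ ≤ a * capInv R' u) :
    ‖∫ p : ℝ × ℝ, A p.1 * (B p.2 * (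
        stableChar α μ f g p.1 p.2 * (α * stableDeriv α μ f g p.1 p.2) *
          (α * stableDeriv α μ g f p.2 p.1) -
        (stableChar α μ f g p.1 0 * (α * stableDeriv α μ f g p.1 0)) *
          (stableChar α μ g f p.2 0 * (α * stableDeriv α μ g f p.2 0))))‖ ≤
      a * a * (α ^ 2 * (5 * (s * t) + 6 * s + 6 * t) *
        ((∫ u, expWeight α (ε * s) u) * ∫ v, expWeight α (ε * t) v)) *
        (R * R') ^ (1 - α / 2) * (bracketOne α μ f g + bracketTwo α μ f g) := by
  have ne0 : ∀ᵐ x : ℝ, x ≠ 0 := compl_mem_ae_iff.2 (measure_singleton (0 : ℝ))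
  have hprod : ∀ᵐ p : ℝ × ℝ, p.1 ≠ 0 ∧ p.2 ≠ 0 := by
    have h1 : ∀ᵐ p : ℝ × ℝ, p.1 ≠ 0 :=
      Measure.quasiMeasurePreserving_fst.ae (p := fun x : ℝ => x ≠ 0) ne0
    have h2 : ∀ᵐ p : ℝ × ℝ, p.2 ≠ 0 :=
      Measure.quasiMeasurePreserving_snd.ae (p := fun x : ℝ => x ≠ 0) ne0
    filter_upwards [h1, h2] with p h1 h2 using ⟨h1, h2⟩
  set K := (5 * (s * t) + 6 * s + 6 * t) * (bracketOne α μ f g + bracketTwo α μ f g) with hK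
  have hB12 : 0 ≤ bracketOne α μ f g + bracketTwo α μ f g :=
    add_nonneg (add_nonneg bracketOneStar_nonneg bracketOneStar_nonneg) bracketTwo_nonneg
  have hK0 : 0 ≤ K := by positivity
  have hi : Integrable fun p : ℝ × ℝ => a * a * (R ^ (1 - α / 2) * R' ^ (1 - α / 2)) * (α ^ 2 * K) *
      (expWeight α (ε * s) p.1 * expWeight α (ε * t) p.2) :=
    ((integrable_expWeight hα hα2 (by positivity)).mul_prod
      (integrable_expWeight hα hα2 (by positivity))).const_mul _
  refine (norm_integral_le_of_norm_le hi ?_).trans_eq ?_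
  · filter_upwards [hprod] with p hp
    obtain ⟨u, v⟩ := p
    have h := abs_deriv_mul_sub_le hα hα2 hf hg hfi hgi hs ht hε1 u v (hN u v)
    rw [← hK] at h
    have hAu : ‖A u‖ ≤ a * (R ^ (1 - α / 2) * |u| ^ (-(α / 2))) := by
      refine (hA u hp.1).trans (mul_le_mul_of_nonneg_left ?_ ha)
      simpa [sub_sub_cancel_left] using capInv_le hR (by linarith : 0 ≤ 1 - α / 2) (by linarith) u
    have hBv : ‖B v‖ ≤ a * (R' ^ (1 - α / 2) * |v| ^ (-(α / 2))) := by
      refine (hB v hp.2).trans (mul_le_mul_of_nonneg_left ?_ ha)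
      simpa [sub_sub_cancel_left] using capInv_le hR' (by linarith : 0 ≤ 1 - α / 2) (by linarith) v
    have hX : ‖(stableChar α μ f g u v * (α * stableDeriv α μ f g u v) *
          (α * stableDeriv α μ g f v u) -
        (stableChar α μ f g u 0 * (α * stableDeriv α μ f g u 0)) *
          (stableChar α μ g f v 0 * (α * stableDeriv α μ g f v 0)) : ℂ)‖ ≤
        α ^ 2 * (K * (Real.exp (-(ε * (|u| ^ α * s + |v| ^ α * t))) *
          ((1 + |u|) ^ 2 * (1 + |v|) ^ 2))) := by
      have e : (stableChar α μ f g u v * (α * stableDeriv α μ f g u v) *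
          (α * stableDeriv α μ g f v u) -
        (stableChar α μ f g u 0 * (α * stableDeriv α μ f g u 0)) *
          (stableChar α μ g f v 0 * (α * stableDeriv α μ g f v 0)) : ℂ) =
          ((α ^ 2 * (Real.exp (-stableExponent α μ f g u v) * stableDeriv α μ f g u v *
            stableDeriv α μ g f v u - Real.exp (-(|u| ^ α * s + |v| ^ α * t)) *
            (signedPow α u * s) * (signedPow α v * t)) : ℝ) : ℂ) := by
        rw [stableDeriv_zero_right hα, stableDeriv_zero_right hα, stableChar, stableChar, stableChar,
          stableExponent_zero_right, stableExponent_zero_right, hs, ht, neg_add, Real.exp_add]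
        push_cast; ring
      rw [e, Complex.norm_real, norm_mul, Real.norm_of_nonneg (sq_nonneg α)]
      exact mul_le_mul_of_nonneg_left h (sq_nonneg α)
    rw [norm_mul, norm_mul]
    calc _ ≤ (a * (R ^ (1 - α / 2) * |u| ^ (-(α / 2)))) * ((a * (R' ^ (1 - α / 2) * |v| ^ (-(α / 2)))) *
          (α ^ 2 * (K * (Real.exp (-(ε * (|u| ^ α * s + |v| ^ α * t))) *
          ((1 + |u|) ^ 2 * (1 + |v|) ^ 2))))) :=
          mul_le_mul hAu (mul_le_mul hBv hX (norm_nonneg _) (by positivity)) (by positivity) (by positivity)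
      _ = _ := by
          have : Real.exp (-(ε * (|u| ^ α * s + |v| ^ α * t))) =
              Real.exp (-(ε * s * |u| ^ α)) * Real.exp (-(ε * t * |v| ^ α)) := by
            rw [← Real.exp_add]; ring_nf
          rw [this, expWeight, expWeight]; ring
  · rw [integral_const_mul, Measure.volume_eq_prod, integral_prod_mul, Real.mul_rpow hR.le hR'.le]
    ring

variable [SFinite μ]

/-- The central estimate for smooth truncations, on the Fourier side. Integration by parts turns
`A'`, `B'` into `A`, `B`; for the product of the marginals this produces no singular term. -/
theorem norm_integral_test_sub_le (hα : 1 < α) (hα2 : α < 2) (hf : Measurable f)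
    (hg : Measurable g) (hfi : Integrable (fun s => |f s| ^ α) μ)
    (hgi : Integrable (fun s => |g s| ^ α) μ) {ε s t : ℝ} (hs : ∫ x, |f x| ^ α ∂μ = s)
    (ht : ∫ x, |g x| ^ α ∂μ = t) (hs0 : 0 < s) (ht0 : 0 < t) (hε : 0 < ε) (hε1 : ε ≤ 1)
    (hN : ∀ u v, ε * (|u| ^ α * s + |v| ^ α * t) ≤ stableExponent α μ f g u v)
    {A A' B B' : ℝ → ℂ} (tA : IsTestPair A A') (tB : IsTestPair B B')
    {a R R' : ℝ} (ha : 0 ≤ a) (hR : 0 < R) (hR' : 0 < R')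
    (hA : ∀ u, u ≠ 0 → ‖A u‖ ≤ a * capInv R u) (hB : ∀ u, u ≠ 0 → ‖B u‖ ≤ a * capInv R' u) :
    ‖(∫ p : ℝ × ℝ, A' p.1 * (B' p.2 * stableChar α μ f g p.1 p.2)) -
        (∫ u, A' u * stableChar α μ f g u 0) * ∫ v, B' v * stableChar α μ f g 0 v‖ ≤
      a * a * smoothConst α ε s t * (R * R') ^ (1 - α / 2) *
        (bracketOne α μ f g + bracketTwo α μ f g) := by
  have hα0 : 0 ≤ α - 1 := by linarith
  have e0 : ∀ v, stableChar α μ f g 0 v = stableChar α μ g f v 0 := fun v => by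
    rw [stableChar, stableChar, stableExponent_swap]
  simp only [e0]
  rw [integral_deriv_deriv_mul_stableChar hα hα2 hf hg hfi hgi tA tB,
    integral_deriv_mul_stableChar hα hα2 hf hg hfi hgi tA,
    integral_deriv_mul_stableChar hα hα2 hg hf hgi hfi tB, ← integral_prod_mul,
    ← Measure.volume_eq_prod, sub_right_comm]
  have i1 := integrable_test_mul_deriv hα hα2 hf hg hfi hgi tA tB
  have single : ∀ {f g : S → ℝ} {A A' : ℝ → ℂ}, Measurable f → Measurable g →
      Integrable (fun s => |f s| ^ α) μ → Integrable (fun s => |g s| ^ α) μ → IsTestPair A A' →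
      Integrable fun u => A u * (stableChar α μ f g u 0 * (α * stableDeriv α μ f g u 0) : ℂ) := by
    intro f g A A' hf hg hfi hgi tA
    obtain ⟨M, hM0, hM⟩ := tA.bound
    obtain ⟨c, hc0, hc⟩ := exists_abs_stableDeriv_le hα hα2 hf hg hfi hgi
    have mA := tA.continuous.measurable
    have mφ : Measurable fun u => stableChar α μ f g u 0 :=
      (measurable_stableChar hf hg).comp (measurable_id.prodMk measurable_const)
    have mN : Measurable fun u => stableDeriv α μ f g u 0 :=
      (measurable_stableDeriv hf hg).comp (measurable_id.prodMk measurable_const)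
    refine integrable_of_norm_le_decay (C := M * (α * c))
      (Measurable.aestronglyMeasurable (by fun_prop)) fun u => ?_
    have d := decay_pos u
    have h1 : 1 + |u| ≤ (1 + |u|) ^ 4 :=
      le_self_pow₀ (by linarith [abs_nonneg u]) (by norm_num)
    have hαp : 0 ≤ α := by linarith
    rw [norm_mul, norm_mul]
    calc _ ≤ M * decay u * (1 * (α * c * (1 + |u|) * (1 + |(0:ℝ)|))) :=
          mul_le_mul (hM u).1 (mul_le_mul (norm_stableChar_le_one _ _) (norm_stableDeriv_le hα hc _ _)
            (norm_nonneg _) zero_le_one) (by positivity) (by positivity)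
      _ = M * (α * c) * (decay u * (1 + |u|)) := by rw [abs_zero]; ring
      _ ≤ _ := by gcongr
  have i2 := (single hf hg hfi hgi tA).mul_prod (single hg hf hgi hfi tB)
  rw [← Measure.volume_eq_prod] at i2
  have e2 : (∫ p : ℝ × ℝ, A p.1 * (B p.2 * (stableChar α μ f g p.1 p.2 *
        (α * stableDeriv α μ f g p.1 p.2) * (α * stableDeriv α μ g f p.2 p.1) : ℂ))) -
      (∫ p : ℝ × ℝ, (A p.1 * (stableChar α μ f g p.1 0 * (α * stableDeriv α μ f g p.1 0) : ℂ)) *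
        (B p.2 * (stableChar α μ g f p.2 0 * (α * stableDeriv α μ g f p.2 0) : ℂ))) =
      ∫ p : ℝ × ℝ, A p.1 * (B p.2 * (
        stableChar α μ f g p.1 p.2 * (α * stableDeriv α μ f g p.1 p.2) *
          (α * stableDeriv α μ g f p.2 p.1) -
        (stableChar α μ f g p.1 0 * (α * stableDeriv α μ f g p.1 0)) *
          (stableChar α μ g f p.2 0 * (α * stableDeriv α μ g f p.2 0)) : ℂ)) := by
    rw [← integral_sub i1 i2]
    refine integral_congr_ae (ae_of_all _ fun p => ?_)
    simp only
    ring
  rw [e2]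
  refine (norm_sub_le _ _).trans ?_
  have h1 := norm_integral_regular_le hα hα2 hf hg hfi hgi hs ht hs0 ht0 hε hε1 hN ha hR hR' hA hB
  have h2 := norm_integral_singular_le hα hα2 hf hg hfi hgi ha hR hR' hA hB
  have hb1 : 0 ≤ bracketOne α μ f g := add_nonneg bracketOneStar_nonneg bracketOneStar_nonneg
  have hcap := capConst_nonneg hα hα2
  rw [norm_mul, Complex.norm_real, Real.norm_of_nonneg (by positivity)]
  refine (add_le_add h1 (mul_le_mul_of_nonneg_left h2 (by positivity))).trans ?_
  have h3 : 0 ≤ α * (α - 1) * (a * a * capConst α * (R * R') ^ (1 - α / 2)) * bracketOne α μ f g := by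
    positivity
  rw [smoothConst]
  linarith

end SmoothBound

/-! ### Smoothed truncations -/

/-- The Fourier transform `∫_a^b e^{-iuy} dy` of the indicator of `(a, b)`. -/
noncomputable def windowFT (a b u : ℝ) : ℂ := ∫ y in a..b, Complex.exp (-(Complex.I * u * y))

/-- The derivative of `windowFT a b`. -/
noncomputable def windowFTDeriv (a b u : ℝ) : ℂ :=
  ∫ y in a..b, -(Complex.I * y) * Complex.exp (-(Complex.I * u * y))

theorem norm_exp_neg_I_mul (u y : ℝ) : ‖Complex.exp (-(Complex.I * u * y))‖ = 1 := by
  have : -(Complex.I * u * y) = ((-(u * y) : ℝ) : ℂ) * Complex.I := by push_cast; ring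
  rw [this, Complex.norm_exp_ofReal_mul_I]

theorem hasDerivAt_windowFT (a b u : ℝ) : HasDerivAt (windowFT a b) (windowFTDeriv a b u) u := by
  have h := intervalIntegral.hasDerivAt_integral_of_dominated_loc_of_deriv_le (μ := volume) (a := a) (b := b)
    (F := fun (u y : ℝ) => Complex.exp (-(Complex.I * u * y)))
    (F' := fun (u y : ℝ) => -(Complex.I * y) * Complex.exp (-(Complex.I * u * y)))
    (bound := fun y => |y|) (x₀ := u) (s := Set.univ) Filter.univ_mem
    (Filter.Eventually.of_forall fun u => Continuous.aestronglyMeasurable (by fun_prop))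
    (Continuous.intervalIntegrable (by fun_prop) _ _)
    (Continuous.aestronglyMeasurable (by fun_prop))
    (ae_of_all _ fun y _ u _ => by
      rw [norm_mul, norm_exp_neg_I_mul, norm_neg, norm_mul, Complex.norm_I, Complex.norm_real]; simp)
    (Continuous.intervalIntegrable (by fun_prop) _ _)
    (ae_of_all _ fun y _ w _ => by
      have h1 : HasDerivAt (fun u : ℝ => -(Complex.I * u * y)) (-(Complex.I * y)) w := by
        have h2 : HasDerivAt (fun u : ℝ => Complex.I * u * y) (Complex.I * y) w := by
          simpa using ((Complex.ofRealCLM.hasDerivAt (x := w)).const_mul Complex.I).mul_const (y : ℂ)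
        exact h2.fun_neg
      exact h1.cexp.congr_deriv (by ring))
  exact h.2

theorem norm_windowFT_le (a b u : ℝ) : ‖windowFT a b u‖ ≤ |b - a| := by
  have := intervalIntegral.norm_integral_le_of_norm_le_const (a := a) (b := b) (C := 1)
    (f := fun y : ℝ => Complex.exp (-(Complex.I * u * y))) fun y _ => (norm_exp_neg_I_mul u y).le
  simpa [windowFT] using this

theorem norm_windowFTDeriv_le (a b u : ℝ) :
    ‖windowFTDeriv a b u‖ ≤ (max |a| |b|) * |b - a| := by
  refine intervalIntegral.norm_integral_le_of_norm_le_const fun y hy => ?_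
  rw [norm_mul, norm_exp_neg_I_mul, norm_neg, norm_mul, Complex.norm_I, Complex.norm_real, mul_one,
    one_mul, Real.norm_eq_abs]
  have := Set.uIoc_subset_uIcc hy
  rw [Set.mem_uIcc] at this
  rcases this with h | h
  · exact abs_le_max_abs_abs h.1 h.2
  · rw [max_comm]; exact abs_le_max_abs_abs h.1 h.2

theorem norm_windowFT_le_inv (a b : ℝ) {u : ℝ} (hu : u ≠ 0) : ‖windowFT a b u‖ ≤ 2 * |u|⁻¹ := by
  have hc : -(Complex.I * u) ≠ 0 :=
    neg_ne_zero.2 (mul_ne_zero Complex.I_ne_zero (Complex.ofReal_ne_zero.2 hu))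
  have h := integral_exp_mul_complex (a := a) (b := b) hc
  have e : windowFT a b u = ∫ x in a..b, Complex.exp (-(Complex.I * u) * x) := by
    simp only [windowFT, neg_mul]
  rw [e, h, norm_div, norm_neg, norm_mul, Complex.norm_I, Complex.norm_real, one_mul,
    Real.norm_eq_abs, div_eq_mul_inv]
  gcongr
  refine (norm_sub_le _ _).trans ?_
  rw [neg_mul, neg_mul, norm_exp_neg_I_mul, norm_exp_neg_I_mul]
  norm_num

theorem norm_windowFT_le_capInv {a b R : ℝ} (ha : |a| ≤ 2 * R) (hb : |b| ≤ 2 * R) {u : ℝ} (hu : u ≠ 0) :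
    ‖windowFT a b u‖ ≤ 4 * capInv R u := by
  rw [capInv, mul_min_of_nonneg _ _ (by norm_num)]
  refine le_min ((norm_windowFT_le a b u).trans ?_) ((norm_windowFT_le_inv a b hu).trans ?_)
  · have := abs_sub b a; linarith
  · have : 0 ≤ |u|⁻¹ := by positivity
    linarith

/-- The Fourier transform of the convolution of the indicator of `(a, b)` with a Gaussian. -/
noncomputable def smoothFT (δ a b u : ℝ) : ℂ := (Real.exp (-δ * u ^ 2) : ℝ) * windowFT a b u

/-- The derivative of `smoothFT δ a b`. -/
noncomputable def smoothFTDeriv (δ a b u : ℝ) : ℂ :=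
  ((Real.exp (-δ * u ^ 2) * (-δ * (2 * u)) : ℝ) : ℂ) * windowFT a b u +
    (Real.exp (-δ * u ^ 2) : ℝ) * windowFTDeriv a b u

theorem hasDerivAt_smoothFT (δ a b u : ℝ) :
    HasDerivAt (smoothFT δ a b) (smoothFTDeriv δ a b u) u := by
  have h1 : HasDerivAt (fun u : ℝ => -δ * u ^ 2) (-δ * (2 * u)) u := by
    simpa using (hasDerivAt_pow 2 u).const_mul (-δ)
  exact h1.exp.ofReal_comp.mul (hasDerivAt_windowFT a b u)

theorem exp_neg_mul_sq_le {δ : ℝ} (hδ : 0 < δ) (u : ℝ) :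
    Real.exp (-δ * u ^ 2) ≤ 24 * Real.exp δ / δ ^ 4 * ((1 + u ^ 2) ^ 4)⁻¹ := by
  have h0 : 0 ≤ δ * (1 + u ^ 2) := by positivity
  have h1 := Real.pow_div_factorial_le_exp _ h0 4
  have h2 : Real.exp (-δ * u ^ 2) = Real.exp δ * (Real.exp (δ * (1 + u ^ 2)))⁻¹ := by
    rw [← Real.exp_neg, ← Real.exp_add]; ring_nf
  have h3 : (Real.exp (δ * (1 + u ^ 2)))⁻¹ ≤ ((δ * (1 + u ^ 2)) ^ 4 / (Nat.factorial 4))⁻¹ :=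
    inv_anti₀ (by positivity) h1
  rw [h2]
  calc _ ≤ Real.exp δ * ((δ * (1 + u ^ 2)) ^ 4 / (Nat.factorial 4))⁻¹ := by gcongr
    _ = _ := by
      have : ((Nat.factorial 4 : ℕ) : ℝ) = 24 := by norm_num [Nat.factorial]
      rw [this, mul_pow]
      have : 1 + u ^ 2 ≠ 0 := by positivity
      field_simp

theorem isTestPair_smoothFT {δ : ℝ} (hδ : 0 < δ) (a b : ℝ) :
    IsTestPair (smoothFT δ a b) (smoothFTDeriv δ a b) := by
  have hc : Continuous (windowFT a b) :=
    continuous_iff_continuousAt.2 fun u => (hasDerivAt_windowFT a b u).continuousAt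
  refine ⟨hasDerivAt_smoothFT δ a b, ?_, ?_⟩
  · have : smoothFTDeriv δ a b = deriv (smoothFT δ a b) := by
      ext u; exact (hasDerivAt_smoothFT δ a b u).deriv.symm
    rw [this]
    exact measurable_deriv _
  set G := 24 * Real.exp δ / δ ^ 4
  have hG : 0 ≤ G := by positivity
  set m := max |a| |b|
  have hm : 0 ≤ m := (abs_nonneg a).trans (le_max_left _ _)
  have hg : ∀ u : ℝ, Real.exp (-δ * u ^ 2) * (1 + u ^ 2) ≤ G * decay u := fun u => by
    have h := exp_neg_mul_sq_le hδ u
    calc _ ≤ G * ((1 + u ^ 2) ^ 4)⁻¹ * (1 + u ^ 2) := by gcongr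
      _ = _ := by
        have : 1 + u ^ 2 ≠ 0 := by positivity
        rw [decay]; field_simp
  have hu : ∀ u : ℝ, |u| ≤ 1 + u ^ 2 := fun u => by nlinarith [sq_abs u, sq_nonneg (1 - |u|)]
  refine ⟨G * (|b - a| * (1 + 2 * δ + m)), by positivity, fun u => ?_⟩
  have e0 := Real.exp_pos (-δ * u ^ 2)
  have hd := decay_pos u
  have hW := norm_windowFT_le a b u
  have hW' := norm_windowFTDeriv_le a b u
  have h1 : Real.exp (-δ * u ^ 2) ≤ G * decay u :=
    le_trans (le_mul_of_one_le_right e0.le (by nlinarith [sq_nonneg u])) (hg u)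
  have h2 : Real.exp (-δ * u ^ 2) * |u| ≤ G * decay u :=
    le_trans (mul_le_mul_of_nonneg_left (hu u) e0.le) (hg u)
  have hba := abs_nonneg (b - a)
  have hGd : 0 ≤ G * decay u := by positivity
  constructor
  · rw [smoothFT, norm_mul, Complex.norm_real, Real.norm_of_nonneg e0.le]
    calc _ ≤ G * decay u * |b - a| := by gcongr
      _ = G * decay u * |b - a| * 1 := by ring
      _ ≤ G * decay u * |b - a| * (1 + 2 * δ + m) := by gcongr; linarith
      _ = _ := by ring
  · rw [smoothFTDeriv]
    refine (norm_add_le _ _).trans ?_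
    rw [norm_mul, norm_mul, Complex.norm_real, Complex.norm_real, Real.norm_of_nonneg e0.le,
      Real.norm_eq_abs, abs_mul, abs_of_pos e0, abs_mul, abs_neg, abs_of_pos hδ, abs_mul, abs_two]
    calc _ = 2 * δ * (Real.exp (-δ * u ^ 2) * |u|) * ‖windowFT a b u‖ +
          Real.exp (-δ * u ^ 2) * ‖windowFTDeriv a b u‖ := by ring
      _ ≤ 2 * δ * (G * decay u) * |b - a| + G * decay u * (m * |b - a|) := by gcongr
      _ = G * decay u * |b - a| * (2 * δ + m) := by ring
      _ ≤ G * decay u * |b - a| * (1 + 2 * δ + m) := by gcongr; linarith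
      _ = _ := by ring

theorem norm_smoothFT_le_capInv {δ a b R : ℝ} (hδ : 0 < δ) (ha : |a| ≤ 2 * R) (hb : |b| ≤ 2 * R)
    {u : ℝ} (hu : u ≠ 0) : ‖smoothFT δ a b u‖ ≤ 4 * capInv R u := by
  rw [smoothFT, norm_mul, Complex.norm_real, Real.norm_of_nonneg (Real.exp_pos _).le]
  have h1 : Real.exp (-δ * u ^ 2) ≤ 1 := Real.exp_le_one_iff.2 (by nlinarith [sq_nonneg u])
  exact (mul_le_of_le_one_left (norm_nonneg _) h1).trans (norm_windowFT_le_capInv ha hb hu)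

/-- The centered Gaussian density with variance `2 δ`. -/
noncomputable def gaussDensity (δ x : ℝ) : ℝ :=
  (2 * Real.pi)⁻¹ * (√(Real.pi / δ) * Real.exp (-x ^ 2 / (4 * δ)))

theorem integral_exp_mul_gaussian {δ : ℝ} (hδ : 0 < δ) (t : ℝ) :
    ∫ u : ℝ, Complex.exp (Complex.I * t * u) * (Real.exp (-δ * u ^ 2) : ℝ) =
      2 * Real.pi * (gaussDensity δ t : ℂ) := by
  have h := fourierIntegral_gaussian (b := (δ : ℂ)) (by simpa using hδ) t
  have e : ∀ u : ℝ, ((Real.exp (-δ * u ^ 2) : ℝ) : ℂ) = Complex.exp (-δ * u ^ 2) := fun u => by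
    push_cast; rfl
  simp_rw [e]
  rw [h, gaussDensity]
  have e2 : ((Real.pi : ℂ) / δ) ^ (1 / 2 : ℂ) = ((√(Real.pi / δ) : ℝ) : ℂ) := by
    rw [Real.sqrt_eq_rpow, Complex.ofReal_cpow (by positivity)]
    push_cast; rfl
  rw [e2]
  have : (Real.pi : ℂ) ≠ 0 := Complex.ofReal_ne_zero.2 Real.pi_ne_zero
  push_cast
  field_simp

theorem integral_exp_mul_smoothFT {δ a b : ℝ} (hδ : 0 < δ) (hab : a ≤ b) (x : ℝ) :
    ∫ u : ℝ, Complex.exp (Complex.I * x * u) * smoothFT δ a b u =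
      2 * Real.pi * ((∫ y in a..b, gaussDensity δ (x - y) : ℝ) : ℂ) := by
  have e1 : ∀ u : ℝ, Complex.exp (Complex.I * x * u) * smoothFT δ a b u =
      ∫ y in Set.Ioc a b, Complex.exp (Complex.I * ((x - y : ℝ) : ℂ) * u) *
        (Real.exp (-δ * u ^ 2) : ℝ) := fun u => by
    rw [smoothFT, windowFT, intervalIntegral.integral_of_le hab, ← mul_assoc, ← integral_const_mul]
    refine integral_congr_ae (ae_of_all _ fun y => ?_)
    simp only
    have : Complex.I * ((x - y : ℝ) : ℂ) * u = Complex.I * x * u + -(Complex.I * u * y) := by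
      push_cast; ring
    rw [this, Complex.exp_add]; ring
  have hi : Integrable (Function.uncurry fun (u y : ℝ) =>
      Complex.exp (Complex.I * ((x - y : ℝ) : ℂ) * u) * (Real.exp (-δ * u ^ 2) : ℝ))
      (volume.prod (volume.restrict (Set.Ioc a b))) := by
    have h0 : Integrable (fun _ : ℝ => (1 : ℝ)) (volume.restrict (Set.Ioc a b)) :=
      integrable_const _
    refine ((integrable_exp_neg_mul_sq hδ).mul_prod h0).mono'
      (Continuous.aestronglyMeasurable (by unfold Function.uncurry; fun_prop))
      (ae_of_all _ fun p => ?_)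
    have : Complex.I * ((x - p.2 : ℝ) : ℂ) * p.1 = (((x - p.2) * p.1 : ℝ) : ℂ) * Complex.I := by
      push_cast; ring
    rw [Function.uncurry, norm_mul, this, Complex.norm_exp_ofReal_mul_I, Complex.norm_real,
      Real.norm_of_nonneg (Real.exp_pos _).le, one_mul, mul_one]
  simp_rw [e1]
  rw [integral_integral_swap hi]
  simp_rw [integral_exp_mul_gaussian hδ]
  rw [integral_const_mul, intervalIntegral.integral_of_le hab, integral_complex_ofReal]

/-- Multiplication by `x` becomes differentiation of the Fourier transform. -/
theorem integral_exp_mul_smoothFTDeriv {δ a b : ℝ} (hδ : 0 < δ) (hab : a ≤ b) (x : ℝ) :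
    ∫ u : ℝ, Complex.exp (Complex.I * x * u) * smoothFTDeriv δ a b u =
      -(Complex.I * (2 * Real.pi)) * ((x * ∫ y in a..b, gaussDensity δ (x - y) : ℝ) : ℂ) := by
  have tp := isTestPair_smoothFT hδ a b
  obtain ⟨M, hM0, hM⟩ := tp.bound
  have hd : ∀ u : ℝ, HasDerivAt (fun u : ℝ => Complex.exp (Complex.I * x * u))
      (Complex.exp (Complex.I * x * u) * (Complex.I * x)) u := fun u => by
    have h1 : HasDerivAt (fun u : ℝ => Complex.I * x * u) (Complex.I * x) u := by
      simpa using (Complex.ofRealCLM.hasDerivAt (x := u)).const_mul (Complex.I * x)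
    exact h1.cexp
  have hn : ∀ u : ℝ, ‖Complex.exp (Complex.I * x * u)‖ = 1 := fun u => by
    have : Complex.I * x * u = ((x * u : ℝ) : ℂ) * Complex.I := by push_cast; ring
    rw [this, Complex.norm_exp_ofReal_mul_I]
  have m1 := tp.continuous.measurable
  have m2 := tp.measurable_deriv
  have hle : ∀ u : ℝ, decay u ≤ decay u * (1 + |u|) ^ 4 := fun u =>
    le_mul_of_one_le_right (decay_pos u).le (one_le_pow₀ (by linarith [abs_nonneg u]))
  have i1 : Integrable fun u : ℝ => Complex.exp (Complex.I * x * u) * smoothFTDeriv δ a b u :=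
    integrable_of_norm_le_decay (C := M) (Measurable.aestronglyMeasurable (by fun_prop)) fun u => by
      rw [norm_mul, hn, one_mul]
      exact (hM u).2.trans (mul_le_mul_of_nonneg_left (hle u) hM0)
  have i2 : Integrable fun u : ℝ => Complex.exp (Complex.I * x * u) * smoothFT δ a b u :=
    integrable_of_norm_le_decay (C := M) (Measurable.aestronglyMeasurable (by fun_prop)) fun u => by
      rw [norm_mul, hn, one_mul]
      exact (hM u).1.trans (mul_le_mul_of_nonneg_left (hle u) hM0)
  have e : ∀ u : ℝ, Complex.exp (Complex.I * x * u) * (Complex.I * x) * smoothFT δ a b u =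
      (Complex.I * x) * (Complex.exp (Complex.I * x * u) * smoothFT δ a b u) := fun u => by ring
  have i3 : Integrable fun u : ℝ =>
      Complex.exp (Complex.I * x * u) * (Complex.I * x) * smoothFT δ a b u := by
    simp_rw [e]; exact i2.const_mul _
  rw [integral_mul_deriv_eq_deriv_mul_of_integrable (fun u _ => hd u) (fun u _ => tp.hasDerivAt u) i1 i3 i2]
  simp_rw [e]
  rw [integral_const_mul, integral_exp_mul_smoothFT hδ hab]
  push_cast; ring

theorem gaussDensity_nonneg (δ x : ℝ) : 0 ≤ gaussDensity δ x := by
  unfold gaussDensity; positivity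

theorem measurable_gaussDensity (δ : ℝ) : Measurable (gaussDensity δ) := by
  unfold gaussDensity; fun_prop

theorem gaussDensity_one_eq (z : ℝ) :
    gaussDensity 1 z = (2 * Real.pi)⁻¹ * √Real.pi * Real.exp (-(1 / 4) * z ^ 2) := by
  rw [gaussDensity, mul_assoc]; norm_num; left; ring

theorem integrable_gaussDensity_one : Integrable (gaussDensity 1) := by
  have := (integrable_exp_neg_mul_sq (b := 1 / 4) (by norm_num)).const_mul
    ((2 * Real.pi)⁻¹ * √Real.pi)
  exact this.congr (ae_of_all _ fun z => (gaussDensity_one_eq z).symm)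

theorem integrable_gaussDensity_mul (c : ℝ) :
    Integrable fun z => gaussDensity 1 z * (c + |z|) := by
  have h := (integrable_mul_exp_neg_mul_sq (b := 1 / 4) (by norm_num)).norm.const_mul
    ((2 * Real.pi)⁻¹ * √Real.pi)
  refine ((integrable_gaussDensity_one.mul_const c).add h).congr (ae_of_all _ fun z => ?_)
  simp only [Pi.add_apply, gaussDensity_one_eq, norm_mul, Real.norm_eq_abs, Real.abs_exp]
  ring

theorem integral_gaussDensity_one : ∫ z, gaussDensity 1 z = 1 := by
  simp_rw [gaussDensity_one_eq]
  rw [integral_const_mul, integral_gaussian]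
  have hp := Real.pi_pos
  have e : √(Real.pi / (1 / 4)) = 2 * √Real.pi := by
    rw [show Real.pi / (1 / 4) = 2 ^ 2 * Real.pi by ring, Real.sqrt_mul (by norm_num),
      Real.sqrt_sq (by norm_num)]
  rw [e]
  have h := Real.mul_self_sqrt hp.le
  field_simp
  nlinarith

theorem gaussDensity_scale {ρ : ℝ} (hρ : 0 < ρ) (z : ℝ) :
    gaussDensity (ρ ^ 2) (ρ * z) = ρ⁻¹ * gaussDensity 1 z := by
  rw [gaussDensity, gaussDensity, Real.sqrt_div' _ (sq_nonneg ρ), Real.sqrt_sq hρ.le, div_one]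
  have : -(ρ * z) ^ 2 / (4 * ρ ^ 2) = -z ^ 2 / (4 * 1) := by field_simp
  rw [this]; ring

/-- The truncation `x ↦ x 1_{(a, b)}(x)`, with the indicator smoothed by a Gaussian. -/
noncomputable def smoothTrunc (δ a b x : ℝ) : ℝ := x * ∫ y in a..b, gaussDensity δ (x - y)

theorem measurable_smoothTrunc (δ a b : ℝ) : Measurable (smoothTrunc δ a b) := by
  have h : StronglyMeasurable (fun q : ℝ × ℝ => gaussDensity δ (q.1 - q.2)) :=
    ((measurable_gaussDensity δ).comp (measurable_fst.sub measurable_snd)).stronglyMeasurable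
  have h1 := h.integral_prod_right' (ν := volume.restrict (Set.Ioc a b))
  have h2 := h.integral_prod_right' (ν := volume.restrict (Set.Ioc b a))
  exact measurable_id.mul (h1.sub h2).measurable

/-- The scale `ρ` of the Gaussian, of variance `2 ρ²`, is moved into the indicator, so that dominated
convergence applies as `ρ → 0`. -/
theorem integral_gaussDensity_eq {ρ a b : ℝ} (hρ : 0 < ρ) (hab : a ≤ b) (x : ℝ) :
    ∫ y in a..b, gaussDensity (ρ ^ 2) (x - y) =
      ∫ z, gaussDensity 1 z * (Set.Ioo a b).indicator 1 (x - ρ * z) := by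
  have e : ∀ z, gaussDensity 1 z * (Set.Ioo a b).indicator 1 (x - ρ * z) =
      ρ * (fun w => gaussDensity (ρ ^ 2) w * (Set.Ioo a b).indicator 1 (x - w)) (ρ * z) := fun z => by
    simp only
    rw [gaussDensity_scale hρ]; field_simp
  rw [integral_congr_ae (ae_of_all _ e), integral_const_mul, Measure.integral_comp_mul_left
    (fun w => gaussDensity (ρ ^ 2) w * (Set.Ioo a b).indicator 1 (x - w)), abs_of_pos (inv_pos.2 hρ), smul_eq_mul,
    mul_inv_cancel_left₀ hρ.ne', intervalIntegral.integral_of_le hab, integral_Ioc_eq_integral_Ioo,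
    ← integral_indicator measurableSet_Ioo, ← integral_sub_left_eq_self _ _ x]
  refine integral_congr_ae (ae_of_all _ fun y => ?_)
  by_cases h : x - y ∈ Set.Ioo a b
  · simp [Set.indicator_of_mem h]
  · simp [Set.indicator_of_notMem h]

theorem abs_smoothTrunc_le {ρ a b R : ℝ} (hρ : 0 < ρ) (hρ1 : ρ ≤ 1) (hab : a ≤ b)
    (ha : |a| ≤ R) (hb : |b| ≤ R) (x : ℝ) :
    |smoothTrunc (ρ ^ 2) a b x| ≤ ∫ z, gaussDensity 1 z * (R + |z|) := by
  have hR : 0 ≤ R := (abs_nonneg a).trans ha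
  rw [smoothTrunc, integral_gaussDensity_eq hρ hab, ← integral_const_mul, ← Real.norm_eq_abs]
  refine norm_integral_le_of_norm_le (integrable_gaussDensity_mul R) (ae_of_all _ fun z => ?_)
  have hg := gaussDensity_nonneg 1 z
  by_cases h : x - ρ * z ∈ Set.Ioo a b
  · rw [Set.indicator_of_mem h, Pi.one_apply, mul_one, norm_mul, Real.norm_of_nonneg hg, mul_comm]
    refine mul_le_mul_of_nonneg_left ?_ hg
    have h1 : |x - ρ * z| ≤ R :=
      abs_le.2 ⟨by linarith [(abs_le.1 ha).1, h.1], by linarith [(abs_le.1 hb).2, h.2]⟩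
    have h2 := abs_add_le (x - ρ * z) (ρ * z)
    rw [sub_add_cancel, abs_mul, abs_of_pos hρ] at h2
    have h3 : ρ * |z| ≤ |z| := mul_le_of_le_one_left (abs_nonneg z) hρ1
    rw [Real.norm_eq_abs]; linarith
  · rw [Set.indicator_of_notMem h]
    simp only [mul_zero, norm_zero]; positivity

/-- Approximation of the lower end of a set `I`, from below when the infimum belongs to `I` and from
above otherwise, so that perturbations of smaller order do not matter. -/
theorem exists_seq_lower {I : Set ℝ} (hI : BddBelow I) :
    ∃ a : ℕ → ℝ, Filter.Tendsto a Filter.atTop (nhds (sInf I)) ∧ ∀ x z : ℝ,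
      (x ∈ I → ∀ᶠ n : ℕ in Filter.atTop, a n < x - ((n : ℝ) + 1)⁻¹ ^ 2 * z) ∧
      ((∀ y ∈ I, x < y) → I.Nonempty → ∀ᶠ n : ℕ in Filter.atTop, x - ((n : ℝ) + 1)⁻¹ ^ 2 * z < a n) := by
  classical
  have t0 : Filter.Tendsto (fun n : ℕ => ((n : ℝ) + 1)⁻¹) Filter.atTop (nhds 0) := by
    simpa [one_div] using tendsto_one_div_add_atTop_nhds_zero_nat (𝕜 := ℝ)
  have hpos : ∀ n : ℕ, 0 < ((n : ℝ) + 1)⁻¹ := fun n => by positivity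
  have tx : ∀ x z : ℝ, Filter.Tendsto (fun n : ℕ => x - ((n : ℝ) + 1)⁻¹ ^ 2 * z) Filter.atTop
      (nhds x) := fun x z => by simpa using ((t0.pow 2).mul_const z).const_sub x
  have small : ∀ z : ℝ, ∀ᶠ n : ℕ in Filter.atTop, ((n : ℝ) + 1)⁻¹ * z < 1 := fun z => by
    have : Filter.Tendsto (fun n : ℕ => ((n : ℝ) + 1)⁻¹ * z) Filter.atTop (nhds 0) := by
      simpa using t0.mul_const z
    exact this.eventually_lt_const zero_lt_one
  by_cases hm : sInf I ∈ I
  · refine ⟨fun n => sInf I - ((n : ℝ) + 1)⁻¹, by simpa using t0.const_sub (sInf I), fun x z => ⟨fun hx => ?_, fun hx _ => ?_⟩⟩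
    · have h1 : sInf I ≤ x := csInf_le hI hx
      filter_upwards [small z] with n hn
      have := mul_lt_mul_of_pos_left hn (hpos n)
      nlinarith
    · have h1 := hx _ hm
      have t2 : Filter.Tendsto (fun n : ℕ => sInf I - ((n : ℝ) + 1)⁻¹) Filter.atTop (nhds (sInf I)) := by
        simpa using t0.const_sub (sInf I)
      exact (tx x z).eventually_lt t2 h1
  · refine ⟨fun n => sInf I + ((n : ℝ) + 1)⁻¹, by simpa using t0.const_add (sInf I), fun x z => ⟨fun hx => ?_, fun hx hne => ?_⟩⟩
    · have h1 : sInf I < x := lt_of_le_of_ne (csInf_le hI hx) fun h => hm (h ▸ hx)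
      have t2 : Filter.Tendsto (fun n : ℕ => sInf I + ((n : ℝ) + 1)⁻¹) Filter.atTop (nhds (sInf I)) := by
        simpa using t0.const_add (sInf I)
      exact t2.eventually_lt (tx x z) h1
    · have h1 : x ≤ sInf I := le_csInf hne fun y hy => (hx y hy).le
      filter_upwards [small (-z)] with n hn
      have := mul_lt_mul_of_pos_left hn (hpos n)
      nlinarith

/-- An interval `I` is approximated by open intervals `(a n, b n)` such that small perturbations
`x - (n+1)⁻² z` of any point `x` lie in them, for large `n`, exactly if `x ∈ I`. Hence smoothed
indicators converge to the indicator of `I` at every point, end points included, and no continuity of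
the laws is needed. -/
theorem exists_seq_interval {I : Set ℝ} (hI : I.OrdConnected) (hne : I.Nonempty) {R : ℝ} (hR : 0 < R)
    (hIR : I ⊆ Set.Icc (-R) R) :
    ∃ a b : ℕ → ℝ, (∀ᶠ n in Filter.atTop, a n ≤ b n ∧ |a n| ≤ 2 * R ∧ |b n| ≤ 2 * R) ∧
      ∀ x z : ℝ, ∀ᶠ n : ℕ in Filter.atTop,
        (x - ((n : ℝ) + 1)⁻¹ ^ 2 * z ∈ Set.Ioo (a n) (b n) ↔ x ∈ I) := by
  have hb : BddBelow I := ⟨-R, fun x hx => (hIR hx).1⟩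
  have hb' : BddBelow (-I) := ⟨-R, fun x hx => by have := (hIR hx).2; linarith⟩
  obtain ⟨a, ta, ha⟩ := exists_seq_lower hb
  obtain ⟨b, tb, hb2⟩ := exists_seq_lower hb'
  obtain ⟨w, hw⟩ := hne
  have key : ∀ x z : ℝ, x ∈ I → ∀ᶠ n : ℕ in Filter.atTop,
      x - ((n : ℝ) + 1)⁻¹ ^ 2 * z ∈ Set.Ioo (a n) (-b n) := fun x z hx => by
    filter_upwards [(ha x z).1 hx, (hb2 (-x) (-z)).1 (by simpa using hx)] with n h1 h2
    exact ⟨h1, by linarith⟩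
  refine ⟨a, fun n => -b n, ?_, fun x z => ?_⟩
  · have ba : |sInf I| < 2 * R := by
      have h1 : -R ≤ sInf I := le_csInf ⟨w, hw⟩ fun y hy => (hIR hy).1
      have h2 : sInf I ≤ w := csInf_le hb hw
      have h3 := (hIR hw).2
      rw [abs_lt]; constructor <;> linarith
    have bb : |sInf (-I)| < 2 * R := by
      have h1 : -R ≤ sInf (-I) := le_csInf ⟨-w, by simpa using hw⟩ fun y hy => by
        have := (hIR hy).2; linarith
      have h2 : sInf (-I) ≤ -w := csInf_le hb' (by simpa using hw)
      have h3 := (hIR hw).1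
      rw [abs_lt]; constructor <;> linarith
    filter_upwards [key w 0 hw, ta.abs.eventually_lt_const ba, tb.abs.eventually_lt_const bb] with n h1 h2 h3
    exact ⟨(h1.1.trans h1.2).le, h2.le, by rw [abs_neg]; exact h3.le⟩
  · by_cases hx : x ∈ I
    · filter_upwards [key x z hx] with n hn
      exact iff_of_true hn hx
    · -- outside of the interval, the point lies entirely on one side of it
      have : (∀ y ∈ I, x < y) ∨ (∀ y ∈ I, y < x) := by
        by_contra! hcon
        obtain ⟨⟨y, hy, hyx⟩, ⟨y', hy', hxy⟩⟩ := hcon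
        exact hx (hI.out hy hy' ⟨hyx, hxy⟩)
      rcases this with h | h
      · filter_upwards [(ha x z).2 h ⟨w, hw⟩] with n hn
        exact iff_of_false (fun hm => absurd hm.1 (not_lt.2 hn.le)) hx
      · filter_upwards [(hb2 (-x) (-z)).2 (fun y hy => by have := h _ hy; linarith)
          ⟨-w, by simpa using hw⟩] with n hn
        exact iff_of_false (fun hm => absurd hm.2 (not_lt.2 (by linarith))) hx

theorem tendsto_smoothTrunc {I : Set ℝ} {a b : ℕ → ℝ}
    (hab : ∀ᶠ n in Filter.atTop, a n ≤ b n)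
    (h : ∀ x z : ℝ, ∀ᶠ n : ℕ in Filter.atTop,
        (x - ((n : ℝ) + 1)⁻¹ ^ 2 * z ∈ Set.Ioo (a n) (b n) ↔ x ∈ I)) (x : ℝ) :
    Filter.Tendsto (fun n : ℕ => smoothTrunc ((((n : ℝ) + 1)⁻¹ ^ 2) ^ 2) (a n) (b n) x)
      Filter.atTop (nhds (I.indicator id x)) := by
  have hlim : Filter.Tendsto (fun n : ℕ => ∫ z, gaussDensity 1 z *
      (Set.Ioo (a n) (b n)).indicator 1 (x - ((n : ℝ) + 1)⁻¹ ^ 2 * z)) Filter.atTop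
      (nhds (∫ z, gaussDensity 1 z * I.indicator 1 x)) := by
    refine tendsto_integral_of_dominated_convergence (gaussDensity 1) (fun n => ?_)
      integrable_gaussDensity_one (fun n => ae_of_all _ fun z => ?_) (ae_of_all _ fun z => ?_)
    · have h1 : Measurable ((Set.Ioo (a n) (b n)).indicator (1 : ℝ → ℝ)) :=
        measurable_one.indicator measurableSet_Ioo
      have h2 := measurable_gaussDensity 1
      exact Measurable.aestronglyMeasurable (by fun_prop)
    · rw [norm_mul, Real.norm_of_nonneg (gaussDensity_nonneg 1 z)]
      refine mul_le_of_le_one_right (gaussDensity_nonneg 1 z) ?_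
      refine (norm_indicator_le_norm_self _ _).trans ?_
      simp
    · refine tendsto_const_nhds.congr' ?_
      filter_upwards [h x z] with n hn
      by_cases hx : x ∈ I
      · rw [Set.indicator_of_mem hx, Set.indicator_of_mem (hn.2 hx)]; rfl
      · rw [Set.indicator_of_notMem hx, Set.indicator_of_notMem fun h' => hx (hn.1 h')]
  have h2 := hlim.const_mul x
  rw [integral_mul_const, integral_gaussDensity_one, one_mul] at h2
  have e : x * I.indicator 1 x = I.indicator id x := by
    by_cases hx : x ∈ I <;> simp [hx]
  rw [e] at h2
  refine h2.congr' ?_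
  filter_upwards [hab] with n hn
  rw [smoothTrunc, integral_gaussDensity_eq (by positivity) hn]

/-! ### Covariances of truncations to intervals -/

section Fourier

variable {Ω : Type*} [MeasurableSpace Ω] {P : Measure Ω} [IsProbabilityMeasure P] {X Y : Ω → ℝ}

theorem norm_exp_I_mul_mul (x u : ℝ) : ‖Complex.exp (Complex.I * x * u)‖ = 1 := by
  have : Complex.I * x * u = ((x * u : ℝ) : ℂ) * Complex.I := by push_cast; ring
  rw [this, Complex.norm_exp_ofReal_mul_I]

theorem integral_integral_exp_mul (hX : Measurable X) {A : ℝ → ℂ} (hA : Integrable A) :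
    ∫ ω, (∫ u : ℝ, Complex.exp (Complex.I * X ω * u) * A u) ∂P =
      ∫ u : ℝ, A u * ∫ ω, Complex.exp (Complex.I * ((u * X ω : ℝ) : ℂ)) ∂P := by
  have hi : Integrable (Function.uncurry fun (ω : Ω) (u : ℝ) =>
      Complex.exp (Complex.I * X ω * u) * A u) (P.prod volume) := by
    have h1 : Integrable (fun _ : Ω => (1 : ℝ)) P := integrable_const _
    refine (h1.mul_prod hA.norm).mono' ?_ (ae_of_all _ fun q => ?_)
    · refine AEStronglyMeasurable.mul (Measurable.aestronglyMeasurable (by fun_prop)) ?_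
      exact hA.aestronglyMeasurable.comp_snd
    · rw [Function.uncurry, norm_mul, norm_exp_I_mul_mul]
  rw [integral_integral_swap hi]
  refine integral_congr_ae (ae_of_all _ fun u => ?_)
  simp only
  rw [integral_mul_const, mul_comm]
  congr 1
  refine integral_congr_ae (ae_of_all _ fun ω => ?_)
  simp only
  congr 1; push_cast; ring

theorem integral_mul_integral_exp_mul (hX : Measurable X) (hY : Measurable Y) {A B : ℝ → ℂ}
    (hA : Integrable A) (hB : Integrable B) :
    ∫ ω, (∫ u : ℝ, Complex.exp (Complex.I * X ω * u) * A u) *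
        (∫ v : ℝ, Complex.exp (Complex.I * Y ω * v) * B v) ∂P =
      ∫ p : ℝ × ℝ, A p.1 * (B p.2 *
        ∫ ω, Complex.exp (Complex.I * ((p.1 * X ω + p.2 * Y ω : ℝ) : ℂ)) ∂P) := by
  have hAB : Integrable (fun p : ℝ × ℝ => A p.1 * B p.2) := hA.mul_prod hB
  have hi : Integrable (Function.uncurry fun (ω : Ω) (p : ℝ × ℝ) =>
      (Complex.exp (Complex.I * X ω * p.1) * A p.1) * (Complex.exp (Complex.I * Y ω * p.2) * B p.2))
      (P.prod volume) := by
    have h1 : Integrable (fun _ : Ω => (1 : ℝ)) P := integrable_const _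
    have hm : AEStronglyMeasurable (Function.uncurry fun (ω : Ω) (p : ℝ × ℝ) =>
        Complex.exp (Complex.I * X ω * p.1) * Complex.exp (Complex.I * Y ω * p.2) * (A p.1 * B p.2))
        (P.prod volume) := by
      refine AEStronglyMeasurable.mul (Measurable.aestronglyMeasurable (by fun_prop)) ?_
      exact hAB.aestronglyMeasurable.comp_snd
    refine (h1.mul_prod hAB.norm).mono' (hm.congr (ae_of_all _ fun q => ?_)) (ae_of_all _ fun q => ?_)
    · simp only [Function.uncurry]; ring
    · rw [Function.uncurry, norm_mul, norm_mul, norm_mul, norm_exp_I_mul_mul, norm_exp_I_mul_mul,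
        norm_mul, one_mul, one_mul, one_mul]
  simp_rw [← integral_prod_mul (fun u : ℝ => Complex.exp (Complex.I * X _ * u) * A u)
    (fun v : ℝ => Complex.exp (Complex.I * Y _ * v) * B v)]
  rw [← Measure.volume_eq_prod, integral_integral_swap hi]
  refine integral_congr_ae (ae_of_all _ fun p => ?_)
  simp only
  rw [← mul_assoc, ← integral_const_mul]
  refine integral_congr_ae (ae_of_all _ fun ω => ?_)
  have : Complex.I * ((p.1 * X ω + p.2 * Y ω : ℝ) : ℂ) =
      Complex.I * X ω * p.1 + Complex.I * Y ω * p.2 := by push_cast; ring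
  simp only
  rw [this, Complex.exp_add]; ring

end Fourier

theorem smoothTrunc_eq_integral {δ a b : ℝ} (hδ : 0 < δ) (hab : a ≤ b) (x : ℝ) :
    (smoothTrunc δ a b x : ℂ) = (Complex.I / (2 * Real.pi)) *
      ∫ u : ℝ, Complex.exp (Complex.I * x * u) * smoothFTDeriv δ a b u := by
  rw [integral_exp_mul_smoothFTDeriv hδ hab, smoothTrunc]
  have : (Real.pi : ℂ) ≠ 0 := Complex.ofReal_ne_zero.2 Real.pi_ne_zero
  field_simp
  rw [Complex.I_sq]; ring

theorem IsTestPair.integrable_deriv {A A' : ℝ → ℂ} (h : IsTestPair A A') : Integrable A' := by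
  obtain ⟨M, hM0, hM⟩ := h.bound
  refine integrable_of_norm_le_decay (C := M) h.measurable_deriv.aestronglyMeasurable fun u =>
    (hM u).2.trans (mul_le_mul_of_nonneg_left ?_ hM0)
  exact le_mul_of_one_le_right (decay_pos u).le (one_le_pow₀ (by linarith [abs_nonneg u]))

section Trunc

variable {Ω S : Type*} [MeasurableSpace Ω] [MeasurableSpace S] {P : Measure Ω}
  [IsProbabilityMeasure P] {X Y : Ω → ℝ} {α : ℝ} {μ : Measure S} [SFinite μ] {f g : S → ℝ}

theorem abs_cov_smoothTrunc_le (hα : 1 < α) (hα2 : α < 2) (hX : Measurable X) (hY : Measurable Y)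
    (hf : Measurable f) (hg : Measurable g) (hfi : Integrable (fun s => |f s| ^ α) μ)
    (hgi : Integrable (fun s => |g s| ^ α) μ)
    (hφ : ∀ u v : ℝ, ∫ ω, Complex.exp (Complex.I * ((u * X ω + v * Y ω : ℝ) : ℂ)) ∂P =
      (stableChar α μ f g u v : ℂ))
    {ε s t : ℝ} (hs : ∫ x, |f x| ^ α ∂μ = s) (ht : ∫ x, |g x| ^ α ∂μ = t) (hs0 : 0 < s)
    (ht0 : 0 < t) (hε : 0 < ε) (hε1 : ε ≤ 1)
    (hN : ∀ u v, ε * (|u| ^ α * s + |v| ^ α * t) ≤ stableExponent α μ f g u v)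
    {δ a b a' b' R R' : ℝ} (hδ : 0 < δ) (hR : 0 < R) (hR' : 0 < R') (hab : a ≤ b) (hab' : a' ≤ b')
    (ha : |a| ≤ 2 * R) (hb : |b| ≤ 2 * R) (ha' : |a'| ≤ 2 * R') (hb' : |b'| ≤ 2 * R') :
    |(∫ ω, smoothTrunc δ a b (X ω) * smoothTrunc δ a' b' (Y ω) ∂P) -
        (∫ ω, smoothTrunc δ a b (X ω) ∂P) * ∫ ω, smoothTrunc δ a' b' (Y ω) ∂P| ≤
      16 * smoothConst α ε s t * (R * R') ^ (1 - α / 2) *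
        (bracketOne α μ f g + bracketTwo α μ f g) := by
  have tA := isTestPair_smoothFT hδ a b
  have tB := isTestPair_smoothFT hδ a' b'
  have e1 : ((∫ ω, smoothTrunc δ a b (X ω) ∂P : ℝ) : ℂ) = (Complex.I / (2 * Real.pi)) *
      ∫ u, smoothFTDeriv δ a b u * stableChar α μ f g u 0 := by
    rw [← integral_complex_ofReal]
    simp_rw [smoothTrunc_eq_integral hδ hab]
    rw [integral_const_mul, integral_integral_exp_mul hX tA.integrable_deriv]
    simp only [← hφ, zero_mul, add_zero]
  have e2 : ((∫ ω, smoothTrunc δ a' b' (Y ω) ∂P : ℝ) : ℂ) = (Complex.I / (2 * Real.pi)) *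
      ∫ v, smoothFTDeriv δ a' b' v * stableChar α μ f g 0 v := by
    rw [← integral_complex_ofReal]
    simp_rw [smoothTrunc_eq_integral hδ hab']
    rw [integral_const_mul, integral_integral_exp_mul hY tB.integrable_deriv]
    simp only [← hφ, zero_mul, zero_add]
  have e3 : ((∫ ω, smoothTrunc δ a b (X ω) * smoothTrunc δ a' b' (Y ω) ∂P : ℝ) : ℂ) =
      (Complex.I / (2 * Real.pi)) ^ 2 * ∫ p : ℝ × ℝ, smoothFTDeriv δ a b p.1 *
        (smoothFTDeriv δ a' b' p.2 * stableChar α μ f g p.1 p.2) := by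
    rw [← integral_complex_ofReal]
    simp_rw [Complex.ofReal_mul, smoothTrunc_eq_integral hδ hab, smoothTrunc_eq_integral hδ hab',
      mul_mul_mul_comm _ (integral _ _) _ (integral _ _)]
    rw [integral_const_mul, integral_mul_integral_exp_mul hX hY tA.integrable_deriv
      tB.integrable_deriv, sq]
    simp only [hφ]
  have h := norm_integral_test_sub_le hα hα2 hf hg hfi hgi hs ht hs0 ht0 hε hε1 hN tA tB
    (a := 4) (by norm_num) hR hR' (fun u hu => norm_smoothFT_le_capInv hδ ha hb hu)
    (fun u hu => norm_smoothFT_le_capInv hδ ha' hb' hu)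
  have hc : ‖(Complex.I / (2 * Real.pi)) ^ 2‖ ≤ 1 := by
    rw [norm_pow, norm_div, Complex.norm_I, norm_mul, Complex.norm_real,
      Real.norm_of_nonneg Real.pi_pos.le, Complex.norm_ofNat]
    refine pow_le_one₀ (by positivity) ?_
    rw [div_le_one (by positivity)]
    linarith [Real.pi_gt_three]
  rw [← Real.norm_eq_abs, ← Complex.norm_real, Complex.ofReal_sub, Complex.ofReal_mul, e1, e2, e3,
    mul_mul_mul_comm, ← sq, ← mul_sub, norm_mul]
  refine (mul_le_of_le_one_left (norm_nonneg _) hc).trans (h.trans_eq ?_)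
  norm_num

/-- The covariance of two truncations to intervals. The growth exponent `1 - α/2` in the
lengths is what the heavy tails of the two components allow. -/
theorem abs_cov_indicator_le (hα : 1 < α) (hα2 : α < 2) (hX : Measurable X) (hY : Measurable Y)
    (hf : Measurable f) (hg : Measurable g) (hfi : Integrable (fun s => |f s| ^ α) μ)
    (hgi : Integrable (fun s => |g s| ^ α) μ)
    (hφ : ∀ u v : ℝ, ∫ ω, Complex.exp (Complex.I * ((u * X ω + v * Y ω : ℝ) : ℂ)) ∂P =
      (stableChar α μ f g u v : ℂ))
    {ε s t : ℝ} (hs : ∫ x, |f x| ^ α ∂μ = s) (ht : ∫ x, |g x| ^ α ∂μ = t) (hs0 : 0 < s)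
    (ht0 : 0 < t) (hε : 0 < ε) (hε1 : ε ≤ 1)
    (hN : ∀ u v, ε * (|u| ^ α * s + |v| ^ α * t) ≤ stableExponent α μ f g u v)
    {I J : Set ℝ} (hI : I.OrdConnected) (hJ : J.OrdConnected) {R R' : ℝ} (hR : 0 < R) (hR' : 0 < R')
    (hIR : I ⊆ Set.Icc (-R) R) (hJR : J ⊆ Set.Icc (-R') R') :
    |(∫ ω, I.indicator id (X ω) * J.indicator id (Y ω) ∂P) -
        (∫ ω, I.indicator id (X ω) ∂P) * ∫ ω, J.indicator id (Y ω) ∂P| ≤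
      16 * smoothConst α ε s t * (R * R') ^ (1 - α / 2) *
        (bracketOne α μ f g + bracketTwo α μ f g) := by
  have hnn : 0 ≤ 16 * smoothConst α ε s t * (R * R') ^ (1 - α / 2) *
        (bracketOne α μ f g + bracketTwo α μ f g) := by
    have h1 := smoothConst_nonneg (ε := ε) hα hα2 hs0.le ht0.le
    have h2 : 0 ≤ bracketOne α μ f g := add_nonneg bracketOneStar_nonneg bracketOneStar_nonneg
    have h3 : 0 ≤ bracketTwo α μ f g := bracketTwo_nonneg
    positivity
  rcases I.eq_empty_or_nonempty with rfl | hI0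
  · simpa using hnn
  rcases J.eq_empty_or_nonempty with rfl | hJ0
  · simpa using hnn
  obtain ⟨a, b, hab, hlim⟩ := exists_seq_interval hI hI0 hR hIR
  obtain ⟨a', b', hab', hlim'⟩ := exists_seq_interval hJ hJ0 hR' hJR
  set δ : ℕ → ℝ := fun n => (((n : ℝ) + 1)⁻¹ ^ 2) ^ 2
  have hδ : ∀ n, 0 < δ n := fun n => by positivity
  have hρ : ∀ n : ℕ, 0 < ((n : ℝ) + 1)⁻¹ ^ 2 := fun n => by positivity
  have hρ1 : ∀ n : ℕ, ((n : ℝ) + 1)⁻¹ ^ 2 ≤ 1 := fun n =>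
    pow_le_one₀ (by positivity) (inv_le_one_of_one_le₀ (by linarith [n.cast_nonneg (α := ℝ)]))
  have lX : ∀ ω, Filter.Tendsto (fun n => smoothTrunc (δ n) (a n) (b n) (X ω)) Filter.atTop
      (nhds (I.indicator id (X ω))) := fun ω => tendsto_smoothTrunc (hab.mono fun n h => h.1) hlim _
  have lY : ∀ ω, Filter.Tendsto (fun n => smoothTrunc (δ n) (a' n) (b' n) (Y ω)) Filter.atTop
      (nhds (J.indicator id (Y ω))) := fun ω => tendsto_smoothTrunc (hab'.mono fun n h => h.1) hlim' _
  set C := ∫ z, gaussDensity 1 z * (2 * R + |z|)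
  set C' := ∫ z, gaussDensity 1 z * (2 * R' + |z|)
  have bX : ∀ᶠ n in Filter.atTop, ∀ ω, ‖smoothTrunc (δ n) (a n) (b n) (X ω)‖ ≤ C := by
    filter_upwards [hab] with n hn ω
    exact abs_smoothTrunc_le (hρ n) (hρ1 n) hn.1 hn.2.1 hn.2.2 _
  have bY : ∀ᶠ n in Filter.atTop, ∀ ω, ‖smoothTrunc (δ n) (a' n) (b' n) (Y ω)‖ ≤ C' := by
    filter_upwards [hab'] with n hn ω
    exact abs_smoothTrunc_le (hρ n) (hρ1 n) hn.1 hn.2.1 hn.2.2 _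
  have mX : ∀ n, Measurable fun ω => smoothTrunc (δ n) (a n) (b n) (X ω) := fun n =>
    (measurable_smoothTrunc _ _ _).comp hX
  have mY : ∀ n, Measurable fun ω => smoothTrunc (δ n) (a' n) (b' n) (Y ω) := fun n =>
    (measurable_smoothTrunc _ _ _).comp hY
  have tX := tendsto_integral_filter_of_dominated_convergence (μ := P) (fun _ => C)
    (Filter.Eventually.of_forall fun n => (mX n).aestronglyMeasurable)
    (bX.mono fun n h => ae_of_all _ h) (integrable_const _) (ae_of_all _ lX)
  have tY := tendsto_integral_filter_of_dominated_convergence (μ := P) (fun _ => C')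
    (Filter.Eventually.of_forall fun n => (mY n).aestronglyMeasurable)
    (bY.mono fun n h => ae_of_all _ h) (integrable_const _) (ae_of_all _ lY)
  have tXY := tendsto_integral_filter_of_dominated_convergence (μ := P) (fun _ => C * C')
    (Filter.Eventually.of_forall fun n => ((mX n).mul (mY n)).aestronglyMeasurable)
    (by
      filter_upwards [bX, bY] with n h1 h2
      exact ae_of_all _ fun ω => by
        rw [Pi.mul_apply, norm_mul]
        exact mul_le_mul (h1 ω) (h2 ω) (norm_nonneg _) ((norm_nonneg _).trans (h1 ω)))
    (integrable_const _) (ae_of_all _ fun ω => (lX ω).mul (lY ω))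
  refine le_of_tendsto (tXY.sub (tX.mul tY)).abs ?_
  filter_upwards [hab, hab'] with n h1 h2
  exact abs_cov_smoothTrunc_le hα hα2 hX hY hf hg hfi hgi hφ hs ht hs0 ht0 hε hε1 hN (hδ n) hR hR'
    h1.1 h2.1 h1.2.1 h1.2.2 h2.2.1 h2.2.2

end Trunc

/-! ### Layer decomposition of regular functions -/

/-- A nonnegative function `κ`, supported in `{|x| > b}` and at most `c |x|^{β-1}`, whose superlevel
sets are intervals. For `K` as in the theorem, the restrictions of `K(x)/x` to the two
half-lines are of this form, up to sign. -/
structure IsLayered (β c b : ℝ) (κ : ℝ → ℝ) : Prop where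
  nonneg : ∀ x, 0 ≤ κ x
  ordConnected : ∀ l, 0 ≤ l → {x | l < κ x}.OrdConnected
  lt_abs : ∀ x, κ x ≠ 0 → b < |x|
  le_rpow : ∀ x, κ x ≤ c * |x| ^ (β - 1)

namespace IsLayered

variable {β c b : ℝ} {κ : ℝ → ℝ}

theorem measurable (h : IsLayered β c b κ) : Measurable κ := by
  refine measurable_of_Ioi fun l => ?_
  rcases le_or_gt 0 l with hl | hl
  · exact (h.ordConnected l hl).measurableSet
  · have : κ ⁻¹' Set.Ioi l = Set.univ := by
      ext x; simpa using hl.trans_le (h.nonneg x)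
    rw [this]; exact MeasurableSet.univ

theorem comp_neg (h : IsLayered β c b κ) : IsLayered β c b fun x => κ (-x) where
  nonneg x := h.nonneg _
  ordConnected l hl := by
    refine ⟨fun x hx y hy z hz => ?_⟩
    exact (h.ordConnected l hl).out hy hx ⟨neg_le_neg hz.2, neg_le_neg hz.1⟩
  lt_abs x hx := by simpa using h.lt_abs _ hx
  le_rpow x := by simpa using h.le_rpow (-x)

theorem lt_of_lt (h : IsLayered β c b κ) (hβ : β < 1) (hb : 0 < b) (hc : 0 ≤ c) {l x : ℝ} (hl : 0 < l) (hx : l < κ x) :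
    l < c * b ^ (β - 1) := by
  have h1 := h.lt_abs x (hl.trans hx).ne'
  refine hx.trans_le ((h.le_rpow x).trans ?_)
  exact mul_le_mul_of_nonneg_left (Real.rpow_le_rpow_of_nonpos hb h1.le (by linarith)) hc

theorem abs_le_of_lt (h : IsLayered β c b κ) (hβ : β < 1) (hb : 0 < b) {l x : ℝ} (hl : 0 < l) (hx : l < κ x) :
    |x| ≤ (c / l) ^ (1 / (1 - β)) := by
  have h0 : 0 < |x| := hb.trans (h.lt_abs x (hl.trans hx).ne')
  have h1 : 0 < 1 - β := by linarith
  have h2 : l * |x| ^ (1 - β) ≤ c := by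
    have h3 := (hx.trans_le (h.le_rpow x)).le
    have h4 : 0 < |x| ^ (1 - β) := by positivity
    calc l * |x| ^ (1 - β) ≤ c * |x| ^ (β - 1) * |x| ^ (1 - β) := by gcongr
      _ = c := by rw [mul_assoc, ← Real.rpow_add h0]; simp
  have h3 : |x| ^ (1 - β) ≤ c / l := by rw [le_div_iff₀ hl]; linarith
  calc |x| = (|x| ^ (1 - β)) ^ (1 / (1 - β)) := by
        rw [← Real.rpow_mul h0.le, mul_one_div_cancel h1.ne', Real.rpow_one]
    _ ≤ _ := by gcongr

theorem integral_indicator_eq (h : IsLayered β c b κ) (x : ℝ) :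
    IntegrableOn (fun l => {y | l < κ y}.indicator id x) (Set.Ioi 0) ∧
    ∫ l in Set.Ioi (0 : ℝ), {y | l < κ y}.indicator id x = x * κ x := by
  have e : (fun l => {y | l < κ y}.indicator id x) = (Set.Iio (κ x)).indicator fun _ => x := by
    ext l; simp [Set.indicator]
  rw [e]
  constructor
  · rw [IntegrableOn, integrable_indicator_iff measurableSet_Iio, IntegrableOn,
      Measure.restrict_restrict measurableSet_Iio, Set.inter_comm, Set.Ioi_inter_Iio]
    exact integrable_const _
  · rw [setIntegral_indicator measurableSet_Iio, Set.Ioi_inter_Iio, setIntegral_const, smul_eq_mul,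
      measureReal_def, Real.volume_Ioo, sub_zero, ENNReal.toReal_ofReal (h.nonneg x), mul_comm]

theorem integral_norm_indicator_eq (h : IsLayered β c b κ) (x : ℝ) :
    ∫ l in Set.Ioi (0 : ℝ), ‖{y | l < κ y}.indicator id x‖ = |x * κ x| := by
  have e : (fun l => ‖{y | l < κ y}.indicator id x‖) = (Set.Iio (κ x)).indicator fun _ => |x| := by
    ext l
    by_cases hl : l < κ x <;> simp [Set.indicator, hl]
  rw [e, setIntegral_indicator measurableSet_Iio, Set.Ioi_inter_Iio, setIntegral_const, smul_eq_mul,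
      measureReal_def, Real.volume_Ioo, sub_zero, ENNReal.toReal_ofReal (h.nonneg x), mul_comm, abs_mul,
      abs_of_nonneg (h.nonneg x)]

theorem measurable_indicator (h : IsLayered β c b κ) :
    Measurable fun p : ℝ × ℝ => {y | p.1 < κ y}.indicator id p.2 := by
  have e : (fun p : ℝ × ℝ => {y | p.1 < κ y}.indicator id p.2) =
      {p : ℝ × ℝ | p.1 < κ p.2}.indicator fun p => p.2 := by
    ext p; simp [Set.indicator]
  rw [e]
  exact measurable_snd.indicator (measurableSet_lt measurable_fst (h.measurable.comp measurable_snd))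

end IsLayered

/-- One of the two factors in the covariance bound for a pair of layers: the layer at height `l` lies in
`[-R, R]` with `R = (c / l)^{1/(1-β)}`, and `(c / l)^e` is `R^θ` for `e = θ / (1-β)`. The layer is
empty for `l ≥ c b^{β-1}`. -/
noncomputable def layerBound (β c b e l : ℝ) : ℝ :=
  (Set.Iio (c * b ^ (β - 1))).indicator (fun l => (c / l) ^ e) l

theorem layerBound_integral {β c b e : ℝ} (hc : 0 ≤ c) (hb : 0 < b) (he0 : 0 ≤ e) (he : e < 1) :
    IntegrableOn (layerBound β c b e) (Set.Ioi 0) ∧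
      ∫ l in Set.Ioi (0 : ℝ), layerBound β c b e l =
        c * b ^ ((β - 1) * (1 - e)) / (1 - e) := by
  set T := c * b ^ (β - 1) with hT
  have hT0 : 0 ≤ T := by positivity
  have hcongr : ∀ l ∈ Set.Ioo 0 T, (c / l) ^ e = c ^ e * l ^ (-e) := fun l hl => by
    rw [Real.div_rpow hc hl.1.le, Real.rpow_neg hl.1.le, div_eq_mul_inv]
  have hi : IntegrableOn (fun l : ℝ => c ^ e * l ^ (-e)) (Set.Ioo 0 T) := by
    rcases hT0.eq_or_lt with h0 | h0
    · rw [← h0, Set.Ioo_self]; exact integrableOn_empty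
    · exact ((intervalIntegral.integrableOn_Ioo_rpow_iff h0).2 (by linarith)).const_mul _
  constructor
  · unfold layerBound
    rw [IntegrableOn, integrable_indicator_iff measurableSet_Iio, IntegrableOn,
      Measure.restrict_restrict measurableSet_Iio, Set.inter_comm, Set.Ioi_inter_Iio]
    exact hi.congr_fun (fun l hl => (hcongr l hl).symm) measurableSet_Ioo
  · unfold layerBound
    have e1 : c ^ e * c ^ (1 - e) = c := by
      rw [← Real.rpow_add_of_nonneg hc he0 (by linarith)]; simp
    have e2 : -e + 1 = 1 - e := by ring
    rw [setIntegral_indicator measurableSet_Iio, Set.Ioi_inter_Iio,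
      setIntegral_congr_fun measurableSet_Ioo hcongr, integral_const_mul,
      ← integral_Ioc_eq_integral_Ioo, ← intervalIntegral.integral_of_le hT0,
      integral_rpow (Or.inl (by linarith)), Real.zero_rpow (by linarith), sub_zero, hT,
      Real.mul_rpow hc (by positivity), ← Real.rpow_mul hb.le, e2, ← mul_div_assoc, ← mul_assoc, e1]

namespace IsLayered

variable {Ω : Type*} [MeasurableSpace Ω] {P : Measure Ω}

/-- The truncation `x κ(x)` is a mixture of truncations of the identity to intervals. -/
theorem integral_comp_eq [SFinite P] {β c b : ℝ} {κ : ℝ → ℝ} (h : IsLayered β c b κ) {X : Ω → ℝ}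
    (hX : Measurable X) (hi : Integrable (fun ω => X ω * κ (X ω)) P) :
    Integrable (fun l => ∫ ω, {y | l < κ y}.indicator id (X ω) ∂P) (volume.restrict (Set.Ioi 0)) ∧
    ∫ ω, X ω * κ (X ω) ∂P =
      ∫ l in Set.Ioi (0 : ℝ), (∫ ω, {y | l < κ y}.indicator id (X ω) ∂P) := by
  have hF : Integrable (fun p : Ω × ℝ => {y | p.2 < κ y}.indicator id (X p.1))
      (P.prod (volume.restrict (Set.Ioi 0))) := by
    have hm : Measurable (fun p : Ω × ℝ => {y | p.2 < κ y}.indicator id (X p.1)) :=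
      h.measurable_indicator.comp (measurable_snd.prodMk (hX.comp measurable_fst))
    refine (integrable_prod_iff hm.aestronglyMeasurable).2
      ⟨ae_of_all _ fun ω => (h.integral_indicator_eq (X ω)).1, ?_⟩
    simp_rw [h.integral_norm_indicator_eq]
    exact hi.abs
  refine ⟨hF.integral_prod_right, ?_⟩
  rw [← integral_prod_symm _ hF, integral_prod _ hF]
  simp_rw [(h.integral_indicator_eq _).2]

/-- Bilinear version of `IsLayered.integral_comp_eq`. -/
theorem integral_comp_mul_comp_eq [SFinite P] {β c c' b : ℝ} {κ κ' : ℝ → ℝ}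
    (h : IsLayered β c b κ) (h' : IsLayered β c' b κ') {X Y : Ω → ℝ}
    (hX : Measurable X) (hY : Measurable Y)
    (hi : Integrable (fun ω => X ω * κ (X ω) * (Y ω * κ' (Y ω))) P) :
    Integrable (fun z : ℝ × ℝ => ∫ ω, {y | z.1 < κ y}.indicator id (X ω) *
        {y | z.2 < κ' y}.indicator id (Y ω) ∂P)
      ((volume.restrict (Set.Ioi 0)).prod (volume.restrict (Set.Ioi 0))) ∧
    ∫ ω, X ω * κ (X ω) * (Y ω * κ' (Y ω)) ∂P =
      ∫ z : ℝ × ℝ, (∫ ω, {y | z.1 < κ y}.indicator id (X ω) *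
        {y | z.2 < κ' y}.indicator id (Y ω) ∂P)
        ∂((volume.restrict (Set.Ioi 0)).prod (volume.restrict (Set.Ioi 0))) := by
  set ν := volume.restrict (Set.Ioi (0 : ℝ)) with hν
  have hF : Integrable (fun p : Ω × (ℝ × ℝ) => {y | p.2.1 < κ y}.indicator id (X p.1) *
      {y | p.2.2 < κ' y}.indicator id (Y p.1)) (P.prod (ν.prod ν)) := by
    have hm : Measurable (fun p : Ω × (ℝ × ℝ) => {y | p.2.1 < κ y}.indicator id (X p.1) *
        {y | p.2.2 < κ' y}.indicator id (Y p.1)) :=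
      (h.measurable_indicator.comp
        ((measurable_fst.comp measurable_snd).prodMk (hX.comp measurable_fst))).mul
      (h'.measurable_indicator.comp
        ((measurable_snd.comp measurable_snd).prodMk (hY.comp measurable_fst)))
    refine (integrable_prod_iff hm.aestronglyMeasurable).2
      ⟨ae_of_all _ fun ω =>
        (h.integral_indicator_eq (X ω)).1.mul_prod (h'.integral_indicator_eq (Y ω)).1, ?_⟩
    have e : ∀ ω, ∫ z : ℝ × ℝ, ‖{y | z.1 < κ y}.indicator id (X ω) *
        {y | z.2 < κ' y}.indicator id (Y ω)‖ ∂(ν.prod ν) =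
        ‖X ω * κ (X ω) * (Y ω * κ' (Y ω))‖ := fun ω => by
      simp_rw [norm_mul]
      rw [integral_prod_mul (fun l => ‖{y | l < κ y}.indicator id (X ω)‖)
        (fun l => ‖{y | l < κ' y}.indicator id (Y ω)‖), hν, h.integral_norm_indicator_eq,
        h'.integral_norm_indicator_eq, abs_mul, abs_mul]
      rfl
    simp_rw [e]
    exact hi.norm
  refine ⟨hF.integral_prod_right, ?_⟩
  rw [← integral_prod_symm _ hF, integral_prod _ hF]
  refine integral_congr_ae (ae_of_all _ fun ω => ?_)
  simp only
  rw [integral_prod_mul (fun l => {y | l < κ y}.indicator id (X ω))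
    (fun l => {y | l < κ' y}.indicator id (Y ω)), hν, (h.integral_indicator_eq _).2,
    (h'.integral_indicator_eq _).2]

/-- A covariance bound for truncations of the identity to intervals, growing like the power `θ` of
their lengths, gives a covariance bound for layered functions: integrate it over the layers. -/
theorem abs_cov_le [IsProbabilityMeasure P] {β c c' b θ Γ : ℝ} {κ κ' : ℝ → ℝ}
    (h : IsLayered β c b κ) (h' : IsLayered β c' b κ') (hc : 0 ≤ c) (hc' : 0 ≤ c') (hb : 0 < b)
    (hθ : 0 ≤ θ) (hβ : β < 1 - θ) {X Y : Ω → ℝ} (hX : Measurable X) (hY : Measurable Y)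
    (hiX : Integrable (fun ω => X ω * κ (X ω)) P) (hiY : Integrable (fun ω => Y ω * κ' (Y ω)) P)
    (hi : Integrable (fun ω => X ω * κ (X ω) * (Y ω * κ' (Y ω))) P)
    (hcov : ∀ (I J : Set ℝ) (R R' : ℝ), I.OrdConnected → J.OrdConnected → 0 < R → 0 < R' →
      I ⊆ Set.Icc (-R) R → J ⊆ Set.Icc (-R') R' →
      |∫ ω, I.indicator id (X ω) * J.indicator id (Y ω) ∂P -
        (∫ ω, I.indicator id (X ω) ∂P) * ∫ ω, J.indicator id (Y ω) ∂P| ≤ Γ * (R * R') ^ θ) :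
    |∫ ω, X ω * κ (X ω) * (Y ω * κ' (Y ω)) ∂P -
      (∫ ω, X ω * κ (X ω) ∂P) * ∫ ω, Y ω * κ' (Y ω) ∂P| ≤
      Γ / (1 - θ / (1 - β)) ^ 2 * c * c' * b ^ (2 * (β - 1 + θ)) := by
  have hβ1 : 0 < 1 - β := by linarith
  set e := θ / (1 - β) with he
  have he0 : 0 ≤ e := by positivity
  have he1 : e < 1 := by rw [he, div_lt_one hβ1]; linarith
  obtain ⟨i1, e1⟩ := h.integral_comp_eq hX hiX
  obtain ⟨i2, e2⟩ := h'.integral_comp_eq hY hiY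
  obtain ⟨i3, e3⟩ := h.integral_comp_mul_comp_eq h' hX hY hi
  obtain ⟨b1, f1⟩ := layerBound_integral (β := β) hc hb he0 he1
  obtain ⟨b2, f2⟩ := layerBound_integral (β := β) hc' hb he0 he1
  rw [e1, e2, e3, ← integral_prod_mul, ← integral_sub i3 (i1.mul_prod i2)]
  have hbd : Integrable (fun z : ℝ × ℝ => Γ * (layerBound β c b e z.1 * layerBound β c' b e z.2))
      ((volume.restrict (Set.Ioi 0)).prod (volume.restrict (Set.Ioi 0))) :=
    (b1.mul_prod b2).const_mul Γ
  have key := norm_integral_le_of_norm_le hbd (f := fun z : ℝ × ℝ =>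
    (∫ ω, {y | z.1 < κ y}.indicator id (X ω) * {y | z.2 < κ' y}.indicator id (Y ω) ∂P) -
      (∫ ω, {y | z.1 < κ y}.indicator id (X ω) ∂P) *
        ∫ ω, {y | z.2 < κ' y}.indicator id (Y ω) ∂P) ?_
  · refine key.trans (le_of_eq ?_)
    rw [integral_const_mul, integral_prod_mul, f1, f2]
    have e4 : b ^ (2 * (β - 1 + θ)) = b ^ ((β - 1) * (1 - e)) * b ^ ((β - 1) * (1 - e)) := by
      rw [← Real.rpow_add hb]
      congr 1
      rw [he]; field_simp; ring
    rw [e4]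
    generalize 1 - e = d
    ring
  rw [Measure.prod_restrict]
  refine (ae_restrict_iff' (measurableSet_Ioi.prod measurableSet_Ioi)).2 (ae_of_all _ ?_)
  rintro ⟨l, l'⟩ ⟨hl, hl'⟩
  simp only [Set.mem_Ioi] at hl hl'
  simp only [Real.norm_eq_abs, layerBound]
  have hemp : ∀ {c : ℝ} {κ : ℝ → ℝ} {l : ℝ}, IsLayered β c b κ → 0 ≤ c → 0 < l →
      ¬ l < c * b ^ (β - 1) → {y | l < κ y} = ∅ := fun h hc hl hn => by
    refine Set.eq_empty_of_forall_notMem fun y hy => hn ?_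
    exact h.lt_of_lt (by linarith) hb hc hl hy
  by_cases hT : l < c * b ^ (β - 1)
  swap
  · simp [hemp h hc hl hT, hT]
  by_cases hT' : l' < c' * b ^ (β - 1)
  swap
  · simp [hemp h' hc' hl' hT', hT']
  have hc0 : 0 < c := hc.lt_of_ne fun h0 => by rw [← h0, zero_mul] at hT; linarith
  have hc0' : 0 < c' := hc'.lt_of_ne fun h0 => by rw [← h0, zero_mul] at hT'; linarith
  have hR : 0 < (c / l) ^ (1 / (1 - β)) := by positivity
  have hR' : 0 < (c' / l') ^ (1 / (1 - β)) := by positivity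
  refine (hcov _ _ _ _ (h.ordConnected l hl.le) (h'.ordConnected l' hl'.le) hR hR'
    (fun y hy => abs_le.1 (h.abs_le_of_lt (by linarith) hb hl hy))
    (fun y hy => abs_le.1 (h'.abs_le_of_lt (by linarith) hb hl' hy))).trans (le_of_eq ?_)
  rw [Set.indicator_of_mem (by exact hT), Set.indicator_of_mem (by exact hT'),
    Real.mul_rpow hR.le hR'.le, ← Real.rpow_mul (by positivity), ← Real.rpow_mul (by positivity)]
  rw [show 1 / (1 - β) * θ = e by rw [he]; ring]

end IsLayered

theorem AssumptionK1.nonneg {β c b : ℝ} {K : ℝ → ℝ} (hb : 0 ≤ b) (h : AssumptionK1 β c b K) :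
    0 ≤ c := by
  have h1 : b < |b + 1| := by rw [abs_of_pos (by linarith)]; linarith
  have h2 := (abs_nonneg _).trans (h (b + 1) h1)
  have h3 : 0 < |b + 1| ^ β := Real.rpow_pos_of_pos (hb.trans_lt h1) _
  exact nonneg_of_mul_nonneg_left h2 h3

/-- If `K(x)/x` is antitone on `(b, ∞)` and `K` grows slower than linearly, then `K(x)/x` is
nonnegative there, its limit at infinity being zero. -/
theorem isLayered_of_antitoneOn {β c b : ℝ} {K : ℝ → ℝ} (hβ : β < 1) (hb : 0 < b) (hc : 0 ≤ c)
    (hK : ∀ x, b < x → |K x| ≤ c * x ^ β) (hanti : AntitoneOn (fun x => K x / x) (Set.Ioi b)) :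
    IsLayered β c b ((Set.Ioi b).indicator fun x => K x / x) := by
  have hle : ∀ x, b < x → |K x / x| ≤ c * x ^ (β - 1) := fun x hx => by
    have hx0 : 0 < x := hb.trans hx
    rw [abs_div, abs_of_pos hx0, div_le_iff₀ hx0, mul_assoc, ← Real.rpow_add_one hx0.ne',
      sub_add_cancel]
    exact hK x hx
  have hnn : ∀ x, b < x → 0 ≤ K x / x := fun x hx => by
    have h1 : Filter.Tendsto (fun y : ℝ => -(c * y ^ (β - 1))) Filter.atTop (nhds 0) := by
      have := ((tendsto_rpow_neg_atTop (y := 1 - β) (by linarith)).const_mul c).neg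
      simpa using this
    refine le_of_tendsto h1 ?_
    filter_upwards [Filter.eventually_ge_atTop x] with y hy
    have hby : b < y := hx.trans_le hy
    exact (abs_le.1 (hle y hby)).1.trans (hanti hx hby hy)
  have hnn' : ∀ x, 0 ≤ (Set.Ioi b).indicator (fun x => K x / x) x := fun x =>
    Set.indicator_nonneg (fun y hy => hnn y hy) x
  refine ⟨hnn', fun l hl => ⟨fun x hx y hy z hz => ?_⟩, fun x hx => ?_, fun x => ?_⟩
  · have hbx : b < x := Set.mem_of_indicator_ne_zero (hl.trans_lt hx).ne'
    have hby : b < y := Set.mem_of_indicator_ne_zero (hl.trans_lt hy).ne'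
    have hbz : b < z := hbx.trans_le hz.1
    change l < (Set.Ioi b).indicator (fun x => K x / x) y at hy
    change l < (Set.Ioi b).indicator (fun x => K x / x) z
    rw [Set.indicator_of_mem (by exact hby)] at hy
    rw [Set.indicator_of_mem (by exact hbz)]
    exact hy.trans_le (hanti hbz hby hz.2)
  · exact (Set.mem_of_indicator_ne_zero hx).trans_le (le_abs_self x)
  · by_cases hx : b < x
    · rw [Set.indicator_of_mem (by exact hx), abs_of_pos (hb.trans hx)]
      exact (le_abs_self _).trans (hle x hx)
    · rw [Set.indicator_of_notMem (by exact hx)]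
      positivity

/-- Splitting `K` into the parts on the two half-lines; the sign `ς` takes care of the two kinds of
monotonicity allowed on the negative half-line. -/
theorem exists_isLayered {β c b : ℝ} {K : ℝ → ℝ} (hβ : β < 1) (hb : 0 < b)
    (h1 : AssumptionK1 β c b K) (h2 : AssumptionK2 b K) :
    ∃ (κ₁ κ₂ : ℝ → ℝ) (ς : ℝ), IsLayered β c b κ₁ ∧ IsLayered β c b κ₂ ∧ |ς| = 1 ∧
      ∀ x, truncAbove b K x = x * κ₁ x + ς * (x * κ₂ x) := by
  have hc := h1.nonneg hb.le
  have hp : IsLayered β c b ((Set.Ioi b).indicator fun x => K x / x) :=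
    isLayered_of_antitoneOn hβ hb hc (fun x hx => by
      have hx0 : 0 < x := hb.trans hx
      simpa [abs_of_pos hx0] using h1 x (by rwa [abs_of_pos hx0])) h2.1
  obtain ⟨ς, hς, hn⟩ : ∃ ς : ℝ, |ς| = 1 ∧ IsLayered β c b
      ((Set.Ioi b).indicator fun x => (-ς * K (-x)) / x) := by
    have hK : ∀ ς : ℝ, |ς| = 1 → ∀ x, b < x → |-ς * K (-x)| ≤ c * x ^ β := fun ς hς x hx => by
      have hx0 : 0 < x := hb.trans hx
      rw [abs_mul, abs_neg, hς, one_mul]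
      simpa [abs_of_pos hx0] using h1 (-x) (by rwa [abs_neg, abs_of_pos hx0])
    have hmem : ∀ {x : ℝ}, x ∈ Set.Ioi b → -x ∈ Set.Iio (-b) := fun hx => neg_lt_neg (Set.mem_Ioi.1 hx)
    rcases h2.2 with h | h
    · refine ⟨1, by simp, isLayered_of_antitoneOn hβ hb hc (hK 1 (by simp)) ?_⟩
      intro x hx y hy hxy
      have := h (hmem hy) (hmem hx) (neg_le_neg hxy)
      simp only [div_neg] at this
      simp only [neg_mul, one_mul, neg_div]
      exact this
    · refine ⟨-1, by simp, isLayered_of_antitoneOn hβ hb hc (hK (-1) (by simp)) ?_⟩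
      intro x hx y hy hxy
      have := h (hmem hy) (hmem hx) (neg_le_neg hxy)
      simp only [div_neg] at this
      simp only [neg_neg, one_mul]
      linarith
  -- the part on `(-∞, -b)` is reflected to `(b, ∞)`
  refine ⟨_, _, ς, hp, hn.comp_neg, hς, fun x => ?_⟩
  have hς2 : ς * ς = 1 := by rw [← abs_mul_abs_self, hς, one_mul]
  rw [truncAbove]
  rcases lt_or_ge b x with hx | hx
  · have hx0 : 0 < x := hb.trans hx
    have hx' : b < |x| := by rwa [abs_of_pos hx0]
    rw [Set.indicator_of_mem (by exact hx'), Set.indicator_of_mem (by exact hx),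
      Set.indicator_of_notMem (by simp; linarith), mul_div_cancel₀ _ hx0.ne']
    ring
  rw [Set.indicator_of_notMem (s := Set.Ioi b) (a := x) (by simpa using hx), mul_zero, zero_add]
  rcases lt_or_ge b (-x) with hx1 | hx1
  · have hx0 : x < 0 := by linarith
    have hx' : b < |x| := by rwa [abs_of_neg hx0]
    rw [Set.indicator_of_mem (by exact hx'), Set.indicator_of_mem (by exact hx1), neg_neg]
    have e : x * (-ς * K x / -x) = ς * K x := by
      have : x ≠ 0 := hx0.ne
      field_simp
    rw [e, ← mul_assoc, hς2, one_mul]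
  · have hx' : ¬ b < |x| := not_lt.2 (abs_le.2 ⟨by linarith, hx⟩)
    rw [Set.indicator_of_notMem (by exact hx'), Set.indicator_of_notMem (by simpa using hx1)]
    simp

/-! ### Moments of stable variables -/

section Moments

variable {Ω : Type*} [MeasurableSpace Ω] {P : Measure Ω} [IsProbabilityMeasure P] {X : Ω → ℝ}
  {α s : ℝ}

/-- The tail of a stable variable is `O(r^{-α})`. -/
theorem measureReal_lt_abs_le (hα : 0 < α) (hα2 : α < 2) (hX : Measurable X) (hs : 0 ≤ s)
    (hφ : ∀ u : ℝ, ∫ ω, Complex.exp (Complex.I * ((u * X ω : ℝ) : ℂ)) ∂P =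
      ((Real.exp (-(|u| ^ α * s)) : ℝ) : ℂ)) {r : ℝ} (hr : 0 < r) :
    P.real {ω | r < |X ω|} ≤ 8 * s * r ^ (-α) := by
  have : IsProbabilityMeasure (P.map X) := Measure.isProbabilityMeasure_map hX.aemeasurable
  have hch : ∀ u, charFun (P.map X) u = ((Real.exp (-(|u| ^ α * s)) : ℝ) : ℂ) := fun u => by
    rw [← hφ u, charFun_apply_real, integral_map hX.aemeasurable (by fun_prop)]
    congr 1
    ext ω
    congr 1
    push_cast
    ring
  have h1 := measureReal_abs_gt_le_integral_charFun (μ := P.map X) hr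
  rw [measureReal_def, Measure.map_apply hX (measurableSet_lt measurable_const (by fun_prop))] at h1
  refine h1.trans ?_
  have h2 : ‖∫ t in (-2 * r⁻¹)..(2 * r⁻¹), 1 - charFun (P.map X) t‖ ≤
      ((2 * r⁻¹) ^ α * s) * |2 * r⁻¹ - -2 * r⁻¹| := by
    refine intervalIntegral.norm_integral_le_of_norm_le_const fun t ht => ?_
    have hr' : 0 < r⁻¹ := by positivity
    rw [Set.uIoc_of_le (by linarith)] at ht
    have ht' : |t| ≤ 2 * r⁻¹ := abs_le.2 ⟨by linarith [ht.1], ht.2⟩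
    rw [hch, ← Complex.ofReal_one, ← Complex.ofReal_sub, Complex.norm_real, Real.norm_eq_abs,
      abs_of_nonneg (by simp only [sub_nonneg, Real.exp_le_one_iff, neg_nonpos]; positivity)]
    calc 1 - Real.exp (-(|t| ^ α * s)) ≤ |t| ^ α * s := by
          linarith [Real.add_one_le_exp (-(|t| ^ α * s))]
      _ ≤ _ := by gcongr
  have h3 : |2 * r⁻¹ - -2 * r⁻¹| = 4 * r⁻¹ := by
    rw [abs_of_nonneg (by have : 0 < r⁻¹ := by positivity
                          linarith)]; ring
  rw [h3] at h2
  calc 2⁻¹ * r * _ ≤ 2⁻¹ * r * ((2 * r⁻¹) ^ α * s * (4 * r⁻¹)) := by gcongr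
    _ = 2 * 2 ^ α * s * r ^ (-α) := by
      rw [Real.mul_rpow (by norm_num) (by positivity), Real.inv_rpow hr.le, ← Real.rpow_neg hr.le]
      field_simp
      ring
    _ ≤ 8 * s * r ^ (-α) := by
      have : (2 : ℝ) ^ α ≤ 2 ^ (2 : ℝ) := Real.rpow_le_rpow_of_exponent_le (by norm_num) hα2.le
      rw [Real.rpow_two] at this
      gcongr
      linarith

theorem integrable_abs_rpow_of_lt (hα : 0 < α) (hα2 : α < 2) (hX : Measurable X) (hs : 0 ≤ s)
    (hφ : ∀ u : ℝ, ∫ ω, Complex.exp (Complex.I * ((u * X ω : ℝ) : ℂ)) ∂P =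
      ((Real.exp (-(|u| ^ α * s)) : ℝ) : ℂ)) {q : ℝ} (hq : 0 < q) (hqα : q < α) :
    Integrable (fun ω => |X ω| ^ q) P := by
  have hm : Measurable fun ω => |X ω| ^ q := by fun_prop
  refine ⟨hm.aestronglyMeasurable, ?_⟩
  rw [hasFiniteIntegral_iff_ofReal (ae_of_all _ fun ω => by positivity),
    lintegral_rpow_eq_lintegral_meas_lt_mul P (ae_of_all _ fun ω => abs_nonneg _)
      (by fun_prop) hq]
  refine ENNReal.mul_lt_top ENNReal.ofReal_lt_top ?_
  rw [← Set.Ioc_union_Ioi_eq_Ioi zero_le_one]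
  refine (lintegral_union_le _ _ _).trans_lt (ENNReal.add_lt_top.2 ⟨?_, ?_⟩)
  · have h0 : IntegrableOn (fun t : ℝ => t ^ (q - 1)) (Set.Ioc 0 1) :=
      (intervalIntegrable_iff_integrableOn_Ioc_of_le zero_le_one).1
        (intervalIntegral.intervalIntegrable_rpow' (by linarith))
    refine (setLIntegral_mono' measurableSet_Ioc (fun t _ => ?_)).trans_lt h0.lintegral_lt_top
    exact (mul_le_mul_left (prob_le_one) _).trans (by rw [one_mul])
  · have h0 : IntegrableOn (fun t : ℝ => 8 * s * t ^ (q - 1 - α)) (Set.Ioi 1) :=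
      (integrableOn_Ioi_rpow_of_lt (by linarith) zero_lt_one).const_mul _
    refine (setLIntegral_mono' measurableSet_Ioi (fun t ht => ?_)).trans_lt h0.lintegral_lt_top
    have ht0 : (0 : ℝ) < t := zero_lt_one.trans ht
    have h1 := measureReal_lt_abs_le hα hα2 hX hs hφ ht0
    have h2 : P {ω | t < |X ω|} ≤ ENNReal.ofReal (8 * s * t ^ (-α)) := by
      rw [← ofReal_measureReal]
      exact ENNReal.ofReal_le_ofReal h1
    refine (mul_le_mul_left h2 _).trans (le_of_eq ?_)
    rw [← ENNReal.ofReal_mul (by positivity), mul_assoc, ← Real.rpow_add ht0]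
    ring_nf

/-- Functions growing slower than `|x|^{α/2}` are square integrable under an `α`-stable law. -/
theorem memLp_two_comp_of_le (hα : 0 < α) (hα2 : α < 2) (hX : Measurable X) (hs : 0 ≤ s)
    (hφ : ∀ u : ℝ, ∫ ω, Complex.exp (Complex.I * ((u * X ω : ℝ) : ℂ)) ∂P =
      ((Real.exp (-(|u| ^ α * s)) : ℝ) : ℂ)) {β c : ℝ} (hβ : 0 < β) (hβα : β < α / 2)
    {k : ℝ → ℝ} (hk : Measurable k) (hle : ∀ x, |k x| ≤ c * |x| ^ β) :
    MemLp (fun ω => k (X ω)) 2 P := by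
  have hm : Measurable fun ω => k (X ω) := hk.comp hX
  rw [memLp_two_iff_integrable_sq hm.aestronglyMeasurable]
  refine ((integrable_abs_rpow_of_lt hα hα2 hX hs hφ (q := 2 * β) (by linarith)
    (by linarith)).const_mul (c ^ 2)).mono' (hm.pow_const 2).aestronglyMeasurable
    (ae_of_all _ fun ω => ?_)
  have h1 : |X ω| ^ (2 * β) = (|X ω| ^ β) ^ 2 := by
    rw [mul_comm, Real.rpow_mul (abs_nonneg _), Real.rpow_two]
  rw [h1, ← mul_pow, Real.norm_eq_abs, abs_pow]
  exact pow_le_pow_left₀ (abs_nonneg _) (hle _) 2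

end Moments

/-! ### Covariance of truncated functions of a stable vector -/

theorem measurable_truncAbove {β c b : ℝ} {K : ℝ → ℝ} (hβ : β < 1) (hb : 0 < b)
    (h1 : AssumptionK1 β c b K) (h2 : AssumptionK2 b K) : Measurable (truncAbove b K) := by
  obtain ⟨κ₁, κ₂, ς, k1, k2, -, h⟩ := exists_isLayered hβ hb h1 h2
  rw [funext h]
  exact (measurable_id.mul k1.measurable).add ((measurable_id.mul k2.measurable).const_mul ς)

theorem abs_truncAbove_le {β c b : ℝ} {K : ℝ → ℝ} (hb : 0 ≤ b) (h1 : AssumptionK1 β c b K) (x : ℝ) :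
    |truncAbove b K x| ≤ c * |x| ^ β := by
  have hc := h1.nonneg hb
  by_cases hx : b < |x|
  · rw [truncAbove, Set.indicator_of_mem (by exact hx)]
    exact h1 x hx
  · rw [truncAbove, Set.indicator_of_notMem (by exact hx), abs_zero]
    positivity

theorem IsLayered.abs_mul_le {β c b : ℝ} {κ : ℝ → ℝ} (h : IsLayered β c b κ) (hc : 0 ≤ c)
    (hb : 0 < b) (x : ℝ) : |x * κ x| ≤ c * |x| ^ β := by
  by_cases hx : κ x = 0
  · rw [hx, mul_zero, abs_zero]; positivity
  have hx0 : 0 < |x| := hb.trans (h.lt_abs x hx)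
  rw [abs_mul, abs_of_nonneg (h.nonneg x)]
  calc |x| * κ x ≤ |x| * (c * |x| ^ (β - 1)) := by gcongr; exact h.le_rpow x
    _ = c * (|x| ^ (β - 1) * |x|) := by ring
    _ = c * |x| ^ β := by rw [← Real.rpow_add_one hx0.ne', sub_add_cancel]

theorem covariance_eq_zero_of_ae_eq_zero {Ω : Type*} [MeasurableSpace Ω] {P : Measure Ω}
    {A B : Ω → ℝ} (h : A =ᵐ[P] 0) :
    covariance A B P = 0 := by
  have h0 : ∫ ω, A ω ∂P = 0 := integral_eq_zero_of_ae h
  rw [covariance, h0]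
  refine integral_eq_zero_of_ae ?_
  filter_upwards [h] with ω hω
  simp [hω]

section Covariance

variable {Ω : Type*} [MeasurableSpace Ω] {P : Measure Ω} [IsProbabilityMeasure P] {X Y : Ω → ℝ}

theorem covariance_add_mul_add_mul {ς ς' : ℝ} {A B A' B' : Ω → ℝ} (hA : MemLp A 2 P)
    (hB : MemLp B 2 P) (hA' : MemLp A' 2 P) (hB' : MemLp B' 2 P) :
    covariance (fun ω => A ω + ς * B ω) (fun ω => A' ω + ς' * B' ω) P =
      covariance A A' P + ς' * covariance A B' P +
        (ς * covariance B A' P + ς * ς' * covariance B B' P) := by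
  have h1 := covariance_add_left hA (hB.const_mul ς) (hA'.add (hB'.const_mul ς'))
  have h2 := covariance_add_right hA hA' (hB'.const_mul ς')
  have h3 := covariance_add_right (hB.const_mul ς) hA' (hB'.const_mul ς')
  rw [covariance_const_mul_right] at h2
  rw [covariance_const_mul_left, covariance_const_mul_left, covariance_const_mul_right,
    covariance_const_mul_left] at h3
  rw [h2, covariance_const_mul_left, h3] at h1
  exact h1.trans (by ring)

/-- The covariance bound for `K_b(X)` and `L_b(Y)`, given the one for truncations of the identity
to intervals. -/
theorem abs_covariance_truncAbove_le {β c c' b θ Γ : ℝ} {K L : ℝ → ℝ} (hb : 0 < b)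
    (hθ : 0 ≤ θ) (hβ : β < 1 - θ) (hX : Measurable X) (hY : Measurable Y)
    (hK1 : AssumptionK1 β c b K) (hK2 : AssumptionK2 b K)
    (hL1 : AssumptionK1 β c' b L) (hL2 : AssumptionK2 b L)
    (hmX : ∀ k : ℝ → ℝ, Measurable k → (∀ x, |k x| ≤ c * |x| ^ β) → MemLp (fun ω => k (X ω)) 2 P)
    (hmY : ∀ k : ℝ → ℝ, Measurable k → (∀ x, |k x| ≤ c' * |x| ^ β) → MemLp (fun ω => k (Y ω)) 2 P)
    (hcov : ∀ (I J : Set ℝ) (R R' : ℝ), I.OrdConnected → J.OrdConnected → 0 < R → 0 < R' →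
      I ⊆ Set.Icc (-R) R → J ⊆ Set.Icc (-R') R' →
      |∫ ω, I.indicator id (X ω) * J.indicator id (Y ω) ∂P -
        (∫ ω, I.indicator id (X ω) ∂P) * ∫ ω, J.indicator id (Y ω) ∂P| ≤ Γ * (R * R') ^ θ) :
    |covariance (fun ω => truncAbove b K (X ω)) (fun ω => truncAbove b L (Y ω)) P| ≤
      4 * (Γ / (1 - θ / (1 - β)) ^ 2 * c * c' * b ^ (2 * (β - 1 + θ))) := by
  have hβ1 : β < 1 := by linarith
  have hc := hK1.nonneg hb.le
  have hc' := hL1.nonneg hb.le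
  obtain ⟨κ₁, κ₂, ς, k1, k2, hς, hK⟩ := exists_isLayered hβ1 hb hK1 hK2
  obtain ⟨κ₁', κ₂', ς', k1', k2', hς', hL⟩ := exists_isLayered hβ1 hb hL1 hL2
  have mX : ∀ {κ : ℝ → ℝ}, IsLayered β c b κ → MemLp (fun ω => X ω * κ (X ω)) 2 P := fun k =>
    hmX (fun x => x * _) (measurable_id.mul k.measurable) (k.abs_mul_le hc hb)
  have mY : ∀ {κ : ℝ → ℝ}, IsLayered β c' b κ → MemLp (fun ω => Y ω * κ (Y ω)) 2 P := fun k =>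
    hmY (fun x => x * _) (measurable_id.mul k.measurable) (k.abs_mul_le hc' hb)
  have key : ∀ {κ κ' : ℝ → ℝ}, IsLayered β c b κ → IsLayered β c' b κ' →
      |covariance (fun ω => X ω * κ (X ω)) (fun ω => Y ω * κ' (Y ω)) P| ≤
        Γ / (1 - θ / (1 - β)) ^ 2 * c * c' * b ^ (2 * (β - 1 + θ)) := fun k k' => by
    rw [covariance_eq_sub (mX k) (mY k')]
    exact k.abs_cov_le k' hc hc' hb hθ hβ hX hY ((mX k).integrable one_le_two)
      ((mY k').integrable one_le_two) ((mX k).integrable_mul (mY k')) hcov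
  simp_rw [hK, hL]
  rw [covariance_add_mul_add_mul (mX k1) (mX k2) (mY k1') (mY k2')]
  have sg : ∀ {ρ z B : ℝ}, |ρ| = 1 → |z| ≤ B → |ρ * z| ≤ B := fun h1 h2 => by
    rwa [abs_mul, h1, one_mul]
  have hςς : |ς * ς'| = 1 := by rw [abs_mul, hς, hς', one_mul]
  have a1 := key k1 k1'
  have a2 := sg hς' (key k1 k2')
  have a3 := sg hς (key k2 k1')
  have a4 := sg hςς (key k2 k2')
  refine (abs_add_le _ _).trans ?_
  linarith [abs_add_le (covariance (fun ω => X ω * κ₁ (X ω)) (fun ω => Y ω * κ₁' (Y ω)) P)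
      (ς' * covariance (fun ω => X ω * κ₁ (X ω)) (fun ω => Y ω * κ₂' (Y ω)) P),
    abs_add_le (ς * covariance (fun ω => X ω * κ₂ (X ω)) (fun ω => Y ω * κ₁' (Y ω)) P)
      (ς * ς' * covariance (fun ω => X ω * κ₂ (X ω)) (fun ω => Y ω * κ₂' (Y ω)) P)]

/-- A stable variable with scale zero vanishes almost surely, and so do its truncations. -/
theorem truncAbove_comp_ae_eq_zero {α b : ℝ} (hα : 0 < α) (hα2 : α < 2) (hX : Measurable X)
    (hφ : ∀ u : ℝ, ∫ ω, Complex.exp (Complex.I * ((u * X ω : ℝ) : ℂ)) ∂P =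
      ((Real.exp (-(|u| ^ α * 0)) : ℝ) : ℂ)) (hb : 0 < b) (K : ℝ → ℝ) :
    (fun ω => truncAbove b K (X ω)) =ᵐ[P] 0 := by
  have h1 := measureReal_lt_abs_le hα hα2 hX le_rfl hφ hb
  have h2 : P {ω | b < |X ω|} = 0 := by
    rw [← measureReal_eq_zero_iff]
    exact le_antisymm (h1.trans (by simp)) measureReal_nonneg
  have h3 : ∀ᵐ ω ∂P, ¬ b < |X ω| := by rw [ae_iff]; simpa using h2
  filter_upwards [h3] with ω hω
  exact Set.indicator_of_notMem (by exact hω) K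

end Covariance

/-! ### Reduction to a σ-finite control measure -/

theorem alphaNorm_rpow {S : Type*} [MeasurableSpace S] {α : ℝ} {μ : Measure S} (hα : α ≠ 0)
    (f : S → ℝ) : alphaNorm α μ f ^ α = ∫ s, |f s| ^ α ∂μ := by
  rw [alphaNorm, ← Real.rpow_mul (integral_nonneg fun _ => by positivity), one_div,
    inv_mul_cancel₀ hα, Real.rpow_one]

/-- Two functions in `L^α` can be replaced by measurable ones, and the measure by its restriction to
a σ-finite set off which both of them vanish. -/
theorem exists_sigmaFinite_measurable {S : Type*} [MeasurableSpace S] {α : ℝ} {μ : Measure S}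
    (hα : 0 < α) {f g : S → ℝ} (hf : MemLp f (ENNReal.ofReal α) μ)
    (hg : MemLp g (ENNReal.ofReal α) μ) :
    ∃ (ν : Measure S) (f' g' : S → ℝ), SigmaFinite ν ∧ Measurable f' ∧ Measurable g' ∧
      Integrable (fun s => |f' s| ^ α) ν ∧ Integrable (fun s => |g' s| ^ α) ν ∧
      ∀ Φ : ℝ → ℝ → ℝ, Φ 0 0 = 0 → ∫ s, Φ (f s) (g s) ∂μ = ∫ s, Φ (f' s) (g' s) ∂ν := by
  have hp0 : ENNReal.ofReal α ≠ 0 := by simpa using hα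
  have int : ∀ {h : S → ℝ} (hh : MemLp h (ENNReal.ofReal α) μ),
      Integrable (fun s => |hh.1.mk h s| ^ α) μ := fun {h} hh => by
    have h1 := hh.integrable_norm_rpow hp0 ENNReal.ofReal_ne_top
    rw [ENNReal.toReal_ofReal hα.le] at h1
    refine h1.congr ?_
    filter_upwards [hh.1.ae_eq_mk] with s hs
    rw [← hs, Real.norm_eq_abs]
  have mf := hf.1.stronglyMeasurable_mk.measurable
  have mg := hg.1.stronglyMeasurable_mk.measurable
  have hm : Measurable fun s => |hf.1.mk f s| ^ α + |hg.1.mk g s| ^ α := by fun_prop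
  have hfin := (memLp_one_iff_integrable.2 ((int hf).add (int hg))).finStronglyMeasurable_of_stronglyMeasurable
    hm.stronglyMeasurable one_ne_zero ENNReal.one_ne_top
  obtain ⟨t, ht, hzero, hσ⟩ := hfin.exists_set_sigmaFinite
  refine ⟨μ.restrict t, hf.1.mk f, hg.1.mk g, hσ, mf, mg, (int hf).restrict, (int hg).restrict,
    fun Φ hΦ => ?_⟩
  rw [setIntegral_eq_integral_of_forall_compl_eq_zero]
  · refine integral_congr_ae ?_
    filter_upwards [hf.1.ae_eq_mk, hg.1.ae_eq_mk] with s h1 h2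
    rw [← h1, ← h2]
  · intro s hs
    have h0 : |hf.1.mk f s| ^ α + |hg.1.mk g s| ^ α = 0 := hzero s hs
    have a1 : 0 ≤ |hf.1.mk f s| ^ α := by positivity
    have a2 : 0 ≤ |hg.1.mk g s| ^ α := by positivity
    have b1 : |hf.1.mk f s| ^ α = 0 := by linarith
    have b2 : |hg.1.mk g s| ^ α = 0 := by linarith
    rw [Real.rpow_eq_zero (abs_nonneg _) hα.ne', abs_eq_zero] at b1 b2
    rw [b1, b2, hΦ]

theorem theorem2p2 (α β ε₁ ε₂ σ τ : ℝ) (hα₁ : 1 < α) (hα₂ : α < 2)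
    (hβ₁ : 0 < β) (hβ₂ : β < α / 2) (hε₁ : 0 < ε₁) (hε₂ : 0 < ε₂) :
    ∃ C : ℝ,
      ∀ (Ω : Type*) [MeasurableSpace Ω] (P : Measure Ω) [IsProbabilityMeasure P]
        (S : Type*) [MeasurableSpace S] (μ : Measure S) (f g : S → ℝ) (ξ η : Ω → ℝ)
        (K L : ℝ → ℝ) (cK cL b : ℝ),
        IsStableVector α P ξ η μ f g →
        alphaNorm α μ f = σ → alphaNorm α μ g = τ →
        AssumptionA1 α ε₁ μ f g → AssumptionA2 α ε₂ μ f g →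
        1 ≤ b →
        AssumptionK1 β cK b K → AssumptionK2 b K →
        AssumptionK1 β cL b L → AssumptionK2 b L →
        MemLp (fun ω => truncAbove b K (ξ ω)) 2 P ∧
        MemLp (fun ω => truncAbove b L (η ω)) 2 P ∧
        |covariance (fun ω => truncAbove b K (ξ ω)) (fun ω => truncAbove b L (η ω)) P| ≤
          C * cK * cL * b ^ (2 * β - α) * (bracketOne α μ f g + bracketTwo α μ f g) := by
  have hα0 : 0 < α := by linarith
  refine ⟨4 * (16 * smoothConst α (min ε₂ 1) (σ ^ α) (τ ^ α) /
    (1 - (1 - α / 2) / (1 - β)) ^ 2), ?_⟩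
  intro Ω _ P _ S _ μ f g ξ η K L cK cL b hst hσ hτ _ hA2 hb hK1 hK2 hL1 hL2
  have hb0 : 0 < b := by linarith
  have hβ1 : β < 1 := by linarith
  have hcK := hK1.nonneg hb0.le
  have hcL := hL1.nonneg hb0.le
  obtain ⟨ν, f', g', hν, mf, mg, hfi, hgi, hint⟩ :=
    exists_sigmaFinite_measurable hα0 hst.memLp_fst hst.memLp_snd
  have hs : ∫ s, |f' s| ^ α ∂ν = σ ^ α := by
    rw [← hσ, alphaNorm_rpow hα0.ne']
    exact (hint (fun x _ => |x| ^ α) (by simp [hα0.ne'])).symm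
  have ht : ∫ s, |g' s| ^ α ∂ν = τ ^ α := by
    rw [← hτ, alphaNorm_rpow hα0.ne']
    exact (hint (fun _ y => |y| ^ α) (by simp [hα0.ne'])).symm
  have hexp : ∀ u v : ℝ, alphaNorm α μ (fun s => u * f s + v * g s) ^ α =
      stableExponent α ν f' g' u v := fun u v => by
    rw [alphaNorm_rpow hα0.ne']
    exact hint (fun x y => |u * x + v * y| ^ α) (by simp [hα0.ne'])
  have hscale : ∀ (u : ℝ) (h : S → ℝ), alphaNorm α μ (fun s => u * h s) ^ α =
      |u| ^ α * alphaNorm α μ h ^ α := fun u h => by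
    rw [alphaNorm_rpow hα0.ne', alphaNorm_rpow hα0.ne', ← integral_const_mul]
    simp_rw [abs_mul, Real.mul_rpow (abs_nonneg _) (abs_nonneg _)]
  have hB1 : bracketOne α ν f' g' = bracketOne α μ f g := by
    rw [bracketOne, bracketOne, bracketOneStar, bracketOneStar, bracketOneStar, bracketOneStar,
      hint (fun x y => |x| ^ (α - 1) * |y|) (by simp),
      hint (fun x y => |y| ^ (α - 1) * |x|) (by simp)]
  have hB2 : bracketTwo α ν f' g' = bracketTwo α μ f g :=
    (hint (fun x y => |x * y| ^ (α / 2)) (by simp [hα0.ne'])).symm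
  have hs0 : 0 ≤ σ ^ α := hs ▸ integral_nonneg fun _ => by positivity
  have ht0 : 0 ≤ τ ^ α := ht ▸ integral_nonneg fun _ => by positivity
  have hN : ∀ u v : ℝ, min ε₂ 1 * (|u| ^ α * σ ^ α + |v| ^ α * τ ^ α) ≤
      stableExponent α ν f' g' u v := fun u v => by
    have h := hA2 u v
    rw [hexp, hscale, hscale, hσ, hτ] at h
    refine le_trans ?_ h
    exact mul_le_mul_of_nonneg_right (min_le_left _ _) (by positivity)
  obtain ⟨X, hX, hξX⟩ := hst.aemeasurable_fst
  obtain ⟨Y, hY, hηY⟩ := hst.aemeasurable_snd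
  have hφ : ∀ u v : ℝ, ∫ ω, Complex.exp (Complex.I * ((u * X ω + v * Y ω : ℝ) : ℂ)) ∂P =
      (stableChar α ν f' g' u v : ℂ) := fun u v => by
    rw [stableChar, ← hexp, ← hst.charFun_eq u v]
    refine integral_congr_ae ?_
    filter_upwards [hξX, hηY] with ω h1 h2
    rw [h1, h2]
  have hφX : ∀ u : ℝ, ∫ ω, Complex.exp (Complex.I * ((u * X ω : ℝ) : ℂ)) ∂P =
      ((Real.exp (-(|u| ^ α * σ ^ α)) : ℝ) : ℂ) := fun u => by
    have h := hφ u 0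
    rw [stableChar, stableExponent_zero_right, hs] at h
    simpa using h
  have hφY : ∀ v : ℝ, ∫ ω, Complex.exp (Complex.I * ((v * Y ω : ℝ) : ℂ)) ∂P =
      ((Real.exp (-(|v| ^ α * τ ^ α)) : ℝ) : ℂ) := fun v => by
    have h := hφ 0 v
    have e : stableExponent α ν f' g' 0 v = |v| ^ α * τ ^ α := by
      rw [stableExponent, ← ht, ← integral_const_mul]
      simp_rw [zero_mul, zero_add, abs_mul, Real.mul_rpow (abs_nonneg _) (abs_nonneg _)]
    rw [stableChar, e] at h
    simpa using h
  have eX : (fun ω => truncAbove b K (ξ ω)) =ᵐ[P] fun ω => truncAbove b K (X ω) :=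
    hξX.fun_comp _
  have eY : (fun ω => truncAbove b L (η ω)) =ᵐ[P] fun ω => truncAbove b L (Y ω) :=
    hηY.fun_comp _
  have hmX := fun (k : ℝ → ℝ) (hk : Measurable k) (hle : ∀ x, |k x| ≤ cK * |x| ^ β) =>
    memLp_two_comp_of_le hα0 hα₂ hX hs0 hφX hβ₁ hβ₂ hk hle
  have hmY := fun (k : ℝ → ℝ) (hk : Measurable k) (hle : ∀ x, |k x| ≤ cL * |x| ^ β) =>
    memLp_two_comp_of_le hα0 hα₂ hY ht0 hφY hβ₁ hβ₂ hk hle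
  refine ⟨(memLp_congr_ae eX).2 (hmX _ (measurable_truncAbove hβ1 hb0 hK1 hK2)
      (abs_truncAbove_le hb0.le hK1)),
    (memLp_congr_ae eY).2 (hmY _ (measurable_truncAbove hβ1 hb0 hL1 hL2)
      (abs_truncAbove_le hb0.le hL1)), ?_⟩
  have hB : 0 ≤ bracketOne α μ f g + bracketTwo α μ f g :=
    add_nonneg (add_nonneg bracketOneStar_nonneg bracketOneStar_nonneg) bracketTwo_nonneg
  have hC := smoothConst_nonneg (ε := min ε₂ 1) hα₁ hα₂ hs0 ht0
  have hrhs : 0 ≤ 4 * (16 * smoothConst α (min ε₂ 1) (σ ^ α) (τ ^ α) /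
      (1 - (1 - α / 2) / (1 - β)) ^ 2) * cK * cL * b ^ (2 * β - α) *
        (bracketOne α μ f g + bracketTwo α μ f g) := by positivity
  have hcovξη : covariance (fun ω => truncAbove b K (ξ ω)) (fun ω => truncAbove b L (η ω)) P =
      covariance (fun ω => truncAbove b K (X ω)) (fun ω => truncAbove b L (Y ω)) P := by
    rw [covariance, covariance, integral_congr_ae eX, integral_congr_ae eY]
    refine integral_congr_ae ?_
    filter_upwards [eX, eY] with ω h1 h2
    rw [h1, h2]
  rw [hcovξη]
  -- for a degenerate component the weight `expWeight` is not integrable, but the covariance vanishes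
  rcases hs0.eq_or_lt with h0 | hs0
  · rw [← h0] at hφX
    rw [covariance_eq_zero_of_ae_eq_zero (truncAbove_comp_ae_eq_zero hα0 hα₂ hX hφX hb0 K), abs_zero]
    exact hrhs
  rcases ht0.eq_or_lt with h0 | ht0
  · rw [← h0] at hφY
    rw [covariance_comm,
      covariance_eq_zero_of_ae_eq_zero (truncAbove_comp_ae_eq_zero hα0 hα₂ hY hφY hb0 L), abs_zero]
    exact hrhs
  have key := abs_covariance_truncAbove_le (P := P) (θ := 1 - α / 2)
    (Γ := 16 * smoothConst α (min ε₂ 1) (σ ^ α) (τ ^ α) *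
      (bracketOne α μ f g + bracketTwo α μ f g)) hb0 (by linarith) (by linarith) hX hY
    hK1 hK2 hL1 hL2 hmX hmY fun I J R R' hI hJ hR hR' hIR hJR => by
      have h := abs_cov_indicator_le hα₁ hα₂ hX hY mf mg hfi hgi hφ hs ht hs0 ht0
        (lt_min hε₂ one_pos) (min_le_right _ _) hN hI hJ hR hR' hIR hJR
      rw [hB1, hB2] at h
      exact h.trans (le_of_eq (by ring))
  refine key.trans (le_of_eq ?_)
  rw [show 2 * (β - 1 + (1 - α / 2)) = 2 * β - α by ring]
  ring
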